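/- Let $N\ge 2$ and let $\Omega\subset\mathbb{R}^N$ be a nonempty, open, connected, bounded set with $C^2$ boundary (lying locally on one side of it). Let $\nu$ be the outer unit normal to $\partial\Omega$, let $\kappa_1,\dots,\kappa_{N-1}$ be the principal curvatures of $\partial\Omega$ (the eigenvalues of $d\nu$ on the tangent hyperplane, so that they are nonnegative for convex sets), and put $$\mathcal{M}=\frac{1}{N-1}\sum_{i=1}^{N-1}\kappa_i,\qquad \kappa_{\min}=\min_{x\in\partial\Omega}\ \min_{1\le i\le N-1}\kappa_i(x).$$ Let $|\Omega|$ be the Lebesgue measure of $\Omega$, let $|\partial\Omega|$ be the $(N-1)$-dimensional Hausdorff measure of $\partial\Omega$, let $\beta>0$, and put $$R=\frac{N|\Omega|}{|\partial\Omega|},\qquad C=-R^2-R\left(\frac{N+1}{\beta}\right).$$ Let $u\in C^2(\overline\Omega)$ satisfy $$\Delta u=N\ \text{ in }\Omega,\qquad \frac{\partial u}{\partial\nu}+\beta u=0\ \text{ on }\partial\Omega,$$ $$|\nabla u|^2+2Nu-2\beta^2u^2+(N-1)\beta u^2\mathcal{M}=C\ \text{ on }\partial\Omega.$$ If $\beta+\kappa_{\min}\ge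 0$, then $\Omega$ is a ball and $u$ is radially symmetric about the centre of this ball, that is, there are $z\in\mathbb{R}^N$, $r>0$ and a function $f$ with $\Omega=B_r(z)$ and $u(x)=f(|x-z|)$ for all $x\in\overline\Omega$. -/

import Mathlib

open Set Filter Topology MeasureTheory InnerProductSpace
open scoped Gradient Laplacian

/-- `ρ` is a `C²` local defining function of `Ω` at `p`: near `p` it is of class `C²` with nonzero
gradient, and `Ω` coincides with `{ρ < 0}` near `p`. -/
def IsLocalDefiningFunction {N : ℕ} (Ω : Set (EuclideanSpace ℝ (Fin N)))
    (p : EuclideanSpace ℝ (Fin N)) (ρ : EuclideanSpace ℝ (Fin N) → ℝ) : Prop :=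
  ContDiffAt ℝ 2 ρ p ∧ ∇ ρ p ≠ 0 ∧ ∀ᶠ x in 𝓝 p, (x ∈ Ω ↔ ρ x < 0)

/-- The boundary of `Ω` is of class `C²`, with `Ω` lying locally on one side of it. -/
def HasC2Boundary {N : ℕ} (Ω : Set (EuclideanSpace ℝ (Fin N))) : Prop :=
  ∀ p ∈ frontier Ω, ∃ ρ, IsLocalDefiningFunction Ω p ρ

open Classical in
/-- A choice of a local defining function of `Ω` at `p` (zero if there is none). -/
noncomputable def localDefiningFunction {N : ℕ} (Ω : Set (EuclideanSpace ℝ (Fin N)))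
    (p : EuclideanSpace ℝ (Fin N)) : EuclideanSpace ℝ (Fin N) → ℝ :=
  if h : ∃ ρ, IsLocalDefiningFunction Ω p ρ then h.choose else fun _ => 0

/-- The field `∇ρ / |∇ρ|` of a local defining function `ρ` at the boundary point `p`. On the part
of `∂Ω` near `p` it is the outer unit normal, so that this is a `C¹` extension of the outer unit
normal to a neighbourhood of `p`. -/
noncomputable def normalField {N : ℕ} (Ω : Set (EuclideanSpace ℝ (Fin N)))
    (p : EuclideanSpace ℝ (Fin N)) (x : EuclideanSpace ℝ (Fin N)) : EuclideanSpace ℝ (Fin N) :=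
  ‖∇ (localDefiningFunction Ω p) x‖⁻¹ • ∇ (localDefiningFunction Ω p) x

/-- The outer unit normal `ν(p)` of `Ω` at the boundary point `p`. -/
noncomputable def outerUnitNormal {N : ℕ} (Ω : Set (EuclideanSpace ℝ (Fin N)))
    (p : EuclideanSpace ℝ (Fin N)) : EuclideanSpace ℝ (Fin N) :=
  normalField Ω p p

/-- The tangent hyperplane of `∂Ω` at `p`, that is, the orthogonal complement of `ν(p)`. -/
noncomputable def boundaryTangentSpace {N : ℕ} (Ω : Set (EuclideanSpace ℝ (Fin N)))
    (p : EuclideanSpace ℝ (Fin N)) : Submodule ℝ (EuclideanSpace ℝ (Fin N)) :=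
  (Submodule.span ℝ {outerUnitNormal Ω p})ᗮ

/-- The shape operator `dν_p` of `∂Ω` at `p`, as an endomorphism of the tangent hyperplane; it is
positive for convex sets. Only tangential derivatives of the field enter, so it does not depend on
the extension of the normal. The differential of a unit field takes values in the tangent
hyperplane; the orthogonal projection serves only to record this in the type. -/
noncomputable def shapeOperator {N : ℕ} (Ω : Set (EuclideanSpace ℝ (Fin N)))
    (p : EuclideanSpace ℝ (Fin N)) :
    boundaryTangentSpace Ω p →ₗ[ℝ] boundaryTangentSpace Ω p :=
  ((boundaryTangentSpace Ω p).orthogonalProjectionOnto ∘L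
    fderiv ℝ (normalField Ω p) p ∘L (boundaryTangentSpace Ω p).subtypeL).toLinearMap

theorem shapeOperator_isSymmetric {N : ℕ} (Ω : Set (EuclideanSpace ℝ (Fin N)))
    (p : EuclideanSpace ℝ (Fin N)) : (shapeOperator Ω p).IsSymmetric := by
  have key : ∀ v w : boundaryTangentSpace Ω p,
      inner ℝ (shapeOperator Ω p v) w =
        ‖∇ (localDefiningFunction Ω p) p‖⁻¹ *
          fderiv ℝ (fderiv ℝ (localDefiningFunction Ω p)) p v w := by
    intro v w
    have h1 : inner ℝ (shapeOperator Ω p v) w =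
        inner ℝ (fderiv ℝ (normalField Ω p) p v) (w : EuclideanSpace ℝ (Fin N)) := by
      simp [shapeOperator]
    rw [h1]
    by_cases h : ∃ ρ, IsLocalDefiningFunction Ω p ρ
    · have hρ : IsLocalDefiningFunction Ω p (localDefiningFunction Ω p) := by
        unfold localDefiningFunction
        rw [dif_pos h]
        exact h.choose_spec
      have hw : inner ℝ (∇ (localDefiningFunction Ω p) p) (w : EuclideanSpace ℝ (Fin N)) = 0 := by
        have h2 := (Submodule.mem_orthogonal_singleton_iff_inner_right).1 w.2
        unfold outerUnitNormal normalField at h2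
        rw [inner_smul_left] at h2
        simpa [hρ.2.1] using h2
      unfold normalField
      generalize localDefiningFunction Ω p = ρ at hρ hw
      have hd : DifferentiableAt ℝ (fderiv ℝ ρ) p :=
        (hρ.1.fderiv_right (m := 1) (by norm_num)).differentiableAt (by norm_num)
      let A : StrongDual ℝ (EuclideanSpace ℝ (Fin N)) →L[ℝ] EuclideanSpace ℝ (Fin N) :=
        ⟨⟨⟨(toDual ℝ (EuclideanSpace ℝ (Fin N))).symm, by simp⟩, by simp⟩,
          (toDual ℝ (EuclideanSpace ℝ (Fin N))).symm.continuous⟩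
      have hA : ∀ L w, inner ℝ (A L) w = L w := fun L w => toDual_symm_apply
      have hg : HasFDerivAt (∇ ρ) (A ∘L fderiv ℝ (fderiv ℝ ρ) p) p :=
        A.hasFDerivAt.comp p hd.hasFDerivAt
      have hc : DifferentiableAt ℝ (fun x => ‖∇ ρ x‖⁻¹) p :=
        (hg.differentiableAt.norm ℝ hρ.2.1).inv (by simpa using hρ.2.1)
      have hs : HasFDerivAt (fun x => ‖∇ ρ x‖⁻¹ • ∇ ρ x) _ p := hc.hasFDerivAt.smul hg
      rw [hs.fderiv]
      simp [inner_add_left, inner_smul_left, hw, hA]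
    · have h0 : localDefiningFunction Ω p = fun _ => 0 := by
        unfold localDefiningFunction
        rw [dif_neg h]
      have hn : normalField Ω p = fun _ => 0 := by
        funext x
        simp [normalField, h0, gradient]
      simp [hn, h0]
  intro v w
  rw [real_inner_comm (shapeOperator Ω p w) v, key, key]
  congr 1
  by_cases h : ∃ ρ, IsLocalDefiningFunction Ω p ρ
  · have hρ : IsLocalDefiningFunction Ω p (localDefiningFunction Ω p) := by
      unfold localDefiningFunction
      rw [dif_pos h]
      exact h.choose_spec
    exact (hρ.1.isSymmSndFDerivAt (by simp)).eq v w
  · simp [localDefiningFunction, dif_neg h]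

/-- The principal curvatures `κ_i(p)` of `∂Ω` at `p`: the eigenvalues, with multiplicity, of the
shape operator. At a boundary point of a set with `C²` boundary the tangent hyperplane has dimension
`N - 1`, so that there are `N - 1` of them. -/
noncomputable def principalCurvature {N : ℕ} (Ω : Set (EuclideanSpace ℝ (Fin N)))
    (p : EuclideanSpace ℝ (Fin N)) (i : Fin (Module.finrank ℝ (boundaryTangentSpace Ω p))) : ℝ :=
  (shapeOperator_isSymmetric Ω p).eigenvalues rfl i

/-- The mean curvature `𝓜(p)`, the arithmetic mean of the `N - 1` principal curvatures. -/
noncomputable def meanCurvature {N : ℕ} (Ω : Set (EuclideanSpace ℝ (Fin N)))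
    (p : EuclideanSpace ℝ (Fin N)) : ℝ :=
  (1 / ((N : ℝ) - 1)) * ∑ i, principalCurvature Ω p i

/-- The smallest principal curvature `κ_min` of `∂Ω`. It is taken in the extended reals so that it
is the true infimum in every case; for a bounded set with `C²` boundary the infimum is a finite
minimum. -/
noncomputable def minPrincipalCurvature {N : ℕ} (Ω : Set (EuclideanSpace ℝ (Fin N))) : EReal :=
  ⨅ p ∈ frontier Ω, ⨅ i, (principalCurvature Ω p i : EReal)

/-- The gradient on the closed set `closure Ω` (one-sided at boundary points) of a function of class
`C²` on `closure Ω`. -/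
noncomputable def closureGradient {N : ℕ} (Ω : Set (EuclideanSpace ℝ (Fin N)))
    (u : EuclideanSpace ℝ (Fin N) → ℝ) (x : EuclideanSpace ℝ (Fin N)) :
    EuclideanSpace ℝ (Fin N) :=
  gradientWithin u (closure Ω) x

/-- The outer normal derivative `∂u/∂ν` at the boundary point `x`. -/
noncomputable def outerNormalDeriv {N : ℕ} (Ω : Set (EuclideanSpace ℝ (Fin N)))
    (u : EuclideanSpace ℝ (Fin N) → ℝ) (x : EuclideanSpace ℝ (Fin N)) : ℝ :=
  inner ℝ (closureGradient Ω u x) (outerUnitNormal Ω x)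

/-- The volume `|Ω|`, that is, the Lebesgue measure of `Ω`. -/
noncomputable def domainVolume {N : ℕ} (Ω : Set (EuclideanSpace ℝ (Fin N))) : ℝ :=
  (volume Ω).toReal

/-- The surface measure `|∂Ω|`, that is, the `(N - 1)`-dimensional Hausdorff measure of `∂Ω` in the
normalization that agrees with Lebesgue measure on `(N - 1)`-dimensional Euclidean space. -/
noncomputable def boundaryArea {N : ℕ} (Ω : Set (EuclideanSpace ℝ (Fin N))) : ℝ :=
  (μHE[N - 1] (frontier Ω)).toReal

/-! The proof shows that `D²u` is the identity, by an integral identity of Reilly type in which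
every inequality must be an equality. Write `v = ∂u/∂ν = -βu` on the boundary and let `w` be the
tangential part of `∇u`. Two facts hold for any `u` of class `C²` up to the boundary: `∫_Ω ((Δu)² -
|D²u|²) = ∫_∂Ω (Δu v - D²u(∇u, ν))` (`integral_sum_hessian_minors`), and the tangential divergence
of `u∇u`, corrected by the curvature term, has boundary integral zero
(`integral_tangential_divergence`). Add `β` times the second to the first. With the Robin condition
and its tangential derivative, all second derivatives of `u` leave the boundary integrand, which
becomes `⟨dν w, w⟩ + 2β|w|² + (N-1)𝓜 v²`.

The curvature bound makes this at least `β|w|² + (N-1)𝓜 v²`, and `β` times the overdetermined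
condition rewrites the latter as `βC + βv² + 2Nv`. The convexity inequality `v² ≥ 2Rv - R²` leaves a
bound affine in `v` (`boundary_integrand_ge`). Since `∫ v = N|Ω| = R|∂Ω|`, the value of `C` makes
its integral exactly `N(N-1)|Ω|`. But `Δu = N` gives `(Δu)² - |D²u|² = N² - N - |D²u - I|²`, so `∫
|D²u - I|² ≤ 0` and `D²u = I` (`fderivWithin_fderivWithin_eq_inner`).

Hence, `Ω` being connected, `u = |x - z|²/2 + c` (`exists_eq_half_norm_sq`), and the Robin condition
says that `⟨x - z, ν⟩` is a decreasing function of `|x - z|` on the boundary. At the farthest and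
the nearest boundary point `x - z` is parallel to `ν`; comparing the two forces equal distances, so
the boundary lies on a sphere (`eq_ball_of_inner_normal_eq`).

The analytic burden is the low regularity: the vector fields behind the Reilly identity are only
continuous when `u` is `C²`. Both identities are therefore drawn from `curl_formula`, which
integrates `df ∧ dg` for `f` and `g` merely `C¹` and is obtained by averaging along segments that
point into `Ω`. It rests on the Gauss–Green formula `integral_fderivWithin_eq` for the Hausdorff
measure of the boundary, proved by Fubini along lines and the area formula
`comap_projAlong_eq_withDensity`. -/

section LineFubini

/-! ### Projection along a direction and Fubini along lines -/

variable {V : Type*} [NormedAddCommGroup V] [InnerProductSpace ℝ V]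

/-- The orthogonal projection along `e`. -/
noncomputable def projAlong (e : V) : V →L[ℝ] (Submodule.span ℝ {e})ᗮ :=
  (Submodule.span ℝ {e})ᗮ.orthogonalProjectionOnto

theorem coe_projAlong (e : V) (he : ‖e‖ = 1) (x : V) :
    (projAlong e x : V) = x - (inner ℝ e x : ℝ) • e := by
  unfold projAlong
  rw [← Submodule.starProjection_apply, Submodule.starProjection_orthogonal_val,
    Submodule.starProjection_unit_singleton ℝ he]

variable [FiniteDimensional ℝ V]

/-- The Gram operator of the restricted projection is the identity minus `w ⊗ w`, where `w` is the
component of `e` orthogonal to `n`. Its determinant is `1 - |w|² = ⟪e, n⟫²`, and `normDet` is the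
nonnegative square root. -/
theorem normDet_projAlong_domRestrict (e n : V) (he : ‖e‖ = 1) (hn : ‖n‖ = 1) :
    ((projAlong e).toLinearMap.domRestrict (Submodule.span ℝ {n})ᗮ).normDet
      = |inner ℝ e n| := by
  set T := (Submodule.span ℝ {n})ᗮ with hT
  set f := (projAlong e).toLinearMap.domRestrict T with hf
  set w : T := T.orthogonalProjectionOnto e with hw
  have hw' : (w : V) = e - (inner ℝ n e : ℝ) • n := coe_projAlong n hn e
  have hin : ∀ a : T, inner ℝ e (a : V) = inner ℝ w a := by
    intro a
    have h0 : inner ℝ n (a : V) = 0 := (Submodule.mem_orthogonal_singleton_iff_inner_right).1 a.2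
    rw [Submodule.coe_inner, hw', inner_sub_left, inner_smul_left, h0]
    simp
  have hadj : f.adjoint ∘ₗ f = LinearMap.transvection (-(innerₗ T w)) w := by
    ext1 a
    refine ext_inner_left ℝ fun b => ?_
    rw [LinearMap.comp_apply, LinearMap.adjoint_inner_right, LinearMap.transvection.apply]
    have h1 : inner ℝ (f b) (f a) = inner ℝ (b : V) (a : V)
        - inner ℝ e (a : V) * inner ℝ e (b : V) := by
      rw [Submodule.coe_inner]
      simp only [hf, LinearMap.domRestrict_apply, ContinuousLinearMap.coe_coe, coe_projAlong e he]
      simp only [inner_sub_left, inner_sub_right, inner_smul_left, inner_smul_right,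
        real_inner_self_eq_norm_sq, he, real_inner_comm e (b : V)]
      simp
      ring
    rw [h1, hin, hin, inner_add_right]
    simp [inner_smul_right, real_inner_comm b w]
    ring
  have hsq := f.normDet_sq
  rw [hadj, LinearMap.transvection.det] at hsq
  have hww : inner ℝ w w = 1 - (inner ℝ e n) ^ 2 := by
    rw [Submodule.coe_inner, hw']
    simp only [inner_sub_left, inner_sub_right, inner_smul_left, inner_smul_right,
      real_inner_self_eq_norm_sq, he, hn, real_inner_comm e n]
    simp
    ring
  have : f.normDet ^ 2 = (inner ℝ e n) ^ 2 := by
    have h3 : (-(innerₗ T w)) w = -(inner ℝ w w) := rfl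
    rw [h3, hww] at hsq
    simpa using hsq
  rw [← abs_of_nonneg f.normDet_nonneg]
  exact (sq_eq_sq_iff_abs_eq_abs _ _).1 this

variable [MeasurableSpace V] [BorelSpace V]

/-- The splitting of the space into lines in the direction of a unit vector `e`. -/
noncomputable def lineProdEquiv (e : V) (he : ‖e‖ = 1) : ℝ × (Submodule.span ℝ {e})ᗮ ≃ᵐ V :=
  ((LinearIsometryEquiv.toSpanUnitSingleton e he).toHomeomorph.toMeasurableEquiv.prodCongr
    (MeasurableEquiv.refl _)).trans ((Submodule.span ℝ {e}).measurableEquivProd (0 : V)).symm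

theorem lineProdEquiv_apply (e : V) (he : ‖e‖ = 1) (p : ℝ × (Submodule.span ℝ {e})ᗮ) :
    lineProdEquiv e he p = p.1 • e + p.2 := by
  simp [lineProdEquiv, MeasurableEquiv.prodCongr]

theorem measurePreserving_lineProdEquiv (e : V) (he : ‖e‖ = 1) :
    MeasurePreserving (lineProdEquiv e he) (volume.prod volume) volume := by
  have h1 := ((Submodule.span ℝ {e}).measurePreserving_measurableEquivProd (0 : V)).symm
  rw [InnerProductSpace.euclideanHausdorffMeasure_eq_volume] at h1
  have h2 := ((LinearIsometryEquiv.toSpanUnitSingleton e he).measurePreserving).prod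
    (MeasurePreserving.id (volume : Measure (Submodule.span ℝ {e})ᗮ))
  exact h1.comp h2

end LineFubini

/-! ### Comparison of measures -/

/-- Second countability reduces the neighbourhoods to countably many; making their interiors
disjoint cuts any measurable set into pieces on which the local inequality applies, and the pieces
are summed. -/
theorem MeasureTheory.Measure.le_of_locally_le {X : Type*} [TopologicalSpace X]
    [SecondCountableTopology X] [MeasurableSpace X] [OpensMeasurableSpace X] {μ ν : Measure X}
    (h : ∀ x, ∃ U ∈ 𝓝 x, ∀ B ⊆ U, MeasurableSet B → μ B ≤ ν B) : μ ≤ ν := by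
  choose U hU hle using h
  obtain ⟨s, hs, hcov⟩ := TopologicalSpace.countable_cover_nhds (f := fun x => interior (U x))
    (fun x => interior_mem_nhds.2 (hU x))
  refine Measure.le_intro fun A hA _ => ?_
  rcases s.eq_empty_or_nonempty with rfl | hne
  · have : A = ∅ := by
      have : (univ : Set X) = ∅ := by simpa using hcov.symm
      exact eq_empty_of_subset_empty (this ▸ subset_univ A)
    simp [this]
  obtain ⟨g, rfl⟩ := hs.exists_eq_range hne
  set D := disjointed fun k => interior (U (g k))
  have hD : ∀ k, MeasurableSet (D k) :=
    fun k => MeasurableSet.disjointed (fun k => isOpen_interior.measurableSet) k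
  have hAD : A = ⋃ k, A ∩ D k := by
    rw [← inter_iUnion, iUnion_disjointed]
    simp only [biUnion_range] at hcov
    rw [hcov, inter_univ]
  have hdis : Pairwise (Function.onFun Disjoint fun k => A ∩ D k) := fun i j hij =>
    ((disjoint_disjointed _) hij).mono inter_subset_right inter_subset_right
  rw [hAD, measure_iUnion hdis fun k => hA.inter (hD k),
    measure_iUnion hdis fun k => hA.inter (hD k)]
  refine ENNReal.tsum_le_tsum fun k => hle (g k) _ ?_ (hA.inter (hD k))
  exact inter_subset_right.trans ((disjointed_subset _ k).trans interior_subset)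

theorem ENNReal.le_of_forall_one_lt_le_mul {a b : ENNReal}
    (h : ∀ c : NNReal, 1 < c → a ≤ c * b) : a ≤ b := by
  rcases eq_or_ne b ⊤ with rfl | hb
  · simp
  have ht : Tendsto (fun c : NNReal => (c : ENNReal) * b) (𝓝[>] 1) (𝓝 ((1 : NNReal) * b)) :=
    (ENNReal.Tendsto.mul_const (ENNReal.tendsto_coe.2 tendsto_id) (Or.inr hb)).mono_left
      nhdsWithin_le_nhds
  rw [ENNReal.coe_one, one_mul] at ht
  exact ge_of_tendsto ht (eventually_mem_nhdsWithin.mono fun c hc => h c hc)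

theorem exists_one_lt_pow_le (c : NNReal) (hc : 1 < c) (d : ℕ) :
    ∃ k : NNReal, 1 < k ∧ k ^ d ≤ c := by
  have h : Tendsto (fun k : NNReal => k ^ d) (𝓝[>] 1) (𝓝 (1 ^ d)) :=
    ((continuous_pow d).tendsto 1).mono_left nhdsWithin_le_nhds
  rw [one_pow] at h
  have h1 := (h.eventually (eventually_le_nhds hc)).and eventually_mem_nhdsWithin
  obtain ⟨k, hk, hk1⟩ := h1.exists
  exact ⟨k, hk1, hk⟩

theorem euclideanHausdorffMeasure_image_le {X Y : Type*} [EMetricSpace X] [MeasurableSpace X]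
    [BorelSpace X] [EMetricSpace Y] [MeasurableSpace Y] [BorelSpace Y] {f : X → Y} {s : Set X}
    {k : NNReal} (hf : LipschitzOnWith k f s) (d : ℕ) :
    (μHE[d] : Measure Y) (f '' s) ≤ (k : ENNReal) ^ d * (μHE[d] : Measure X) s := by
  simp_rw [Measure.euclideanHausdorffMeasure_def, Measure.smul_apply, Measure.nnreal_smul_coe_apply]
  rw [mul_left_comm]
  gcongr
  simpa using hf.hausdorffMeasure_image_le (d := (d : ℝ)) (by positivity)

/-! ### The area formula for the projection of a hypersurface -/

section Area

variable {V : Type*} [NormedAddCommGroup V] [InnerProductSpace ℝ V] [FiniteDimensional ℝ V]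
  [MeasurableSpace V] [BorelSpace V]

/-- On a set that is almost orthogonal to `n`, the measure of the projection along `e` is almost
`⟪e, n⟫` times the Hausdorff measure. -/
theorem measure_projAlong_image_comparison {d : ℕ} (hd : Module.finrank ℝ V = d + 1) {e n : V}
    (he : ‖e‖ = 1) (hn : ‖n‖ = 1) (hpos : 0 < inner ℝ e n) {k : NNReal} (hk : 1 < k)
    {B : Set V} (hB : ∀ x ∈ B, ∀ y ∈ B,
      |inner ℝ n (x - y)| ≤ (1 - (k : ℝ)⁻¹) * inner ℝ e n * ‖x - y‖) :
    volume (projAlong e '' B) ≤ ENNReal.ofReal (inner ℝ e n) * (k : ENNReal) ^ d * μHE[d] B ∧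
    ENNReal.ofReal (inner ℝ e n) * μHE[d] B ≤ (k : ENNReal) ^ d * volume (projAlong e '' B) := by
  set T := (Submodule.span ℝ {n})ᗮ with hT
  set κ : ℝ := inner ℝ e n with hκ
  have hk0 : (1 : ℝ) < k := by exact_mod_cast hk
  have hn0 : n ≠ 0 := by rintro rfl; simp at hn
  have he0 : e ≠ 0 := by rintro rfl; simp at he
  have hrank : ∀ v : V, v ≠ 0 → Module.finrank ℝ (Submodule.span ℝ {v})ᗮ = d := fun v hv => by
    have := (Submodule.span ℝ {v}).finrank_add_finrank_orthogonal
    rw [finrank_span_singleton hv] at this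
    omega
  -- oblique projection onto `T` along `e`
  let Q : V → T := fun x => ⟨x - (κ⁻¹ * inner ℝ n x) • e, by
    rw [hT, Submodule.mem_orthogonal_singleton_iff_inner_right, inner_sub_right, inner_smul_right,
      real_inner_comm e n, ← hκ]
    field_simp
    ring⟩
  have hQsub : ∀ x y, ((Q x - Q y : T) : V) = (x - y) - (κ⁻¹ * inner ℝ n (x - y)) • e := by
    intro x y
    simp only [Q, AddSubgroupClass.coe_sub, inner_sub_right]
    module
  -- The factor `⟪e, n⟫` in the tolerance of `hB` absorbs the `κ⁻¹` of the oblique projection. On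
  -- `B` the map `Q` therefore differs from the identity by a map of Lipschitz constant `1 - 1/k`.
  have hdiff : ∀ x ∈ B, ∀ y ∈ B, ‖(κ⁻¹ * inner ℝ n (x - y)) • e‖ ≤ (1 - (k : ℝ)⁻¹) * ‖x - y‖ := by
    intro x hx y hy
    rw [norm_smul, he, mul_one, norm_mul, Real.norm_eq_abs, Real.norm_eq_abs,
      abs_of_pos (inv_pos.2 hpos)]
    calc κ⁻¹ * |inner ℝ n (x - y)| ≤ κ⁻¹ * ((1 - (k : ℝ)⁻¹) * κ * ‖x - y‖) := by
          gcongr; exact hB x hx y hy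
      _ = _ := by field_simp
  have hkinv : (k : ℝ) * (k : ℝ)⁻¹ = 1 := mul_inv_cancel₀ (by positivity)
  have hQ1 : LipschitzOnWith k Q B := by
    refine LipschitzOnWith.of_dist_le_mul fun x hx y hy => ?_
    rw [dist_eq_norm, dist_eq_norm, Submodule.coe_norm, hQsub]
    refine (norm_sub_le _ _).trans ?_
    have h1 := hdiff x hx y hy
    -- This is `(k - 1)² ≥ 0` divided by `k`. The tolerance `1 - 1/k` is chosen so that the lower
    -- bound for `Q` is exactly `1/k` and the upper bound `2 - 1/k` stays below `k`.
    have h2 : 2 - (k : ℝ)⁻¹ ≤ k := by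
      have : 0 < (k : ℝ)⁻¹ := by positivity
      nlinarith [mul_pos this (sub_pos.2 hk0), mul_nonneg this.le (sq_nonneg ((k : ℝ) - 1))]
    nlinarith [norm_nonneg (x - y)]
  have hQ2 : ∀ x ∈ B, ∀ y ∈ B, ‖x - y‖ ≤ k * ‖Q x - Q y‖ := by
    intro x hx y hy
    have h1 := hdiff x hx y hy
    have h2 : ‖x - y‖ ≤ ‖Q x - Q y‖ + ‖(κ⁻¹ * inner ℝ n (x - y)) • e‖ := by
      rw [Submodule.coe_norm, hQsub]
      simpa using norm_add_le ((x - y) - (κ⁻¹ * inner ℝ n (x - y)) • e)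
        ((κ⁻¹ * inner ℝ n (x - y)) • e)
    have h3 : (k : ℝ)⁻¹ * ‖x - y‖ ≤ ‖Q x - Q y‖ := by nlinarith
    calc ‖x - y‖ = k * ((k : ℝ)⁻¹ * ‖x - y‖) := by rw [← mul_assoc, hkinv, one_mul]
      _ ≤ _ := by gcongr
  have hQinj : InjOn Q B := by
    intro x hx y hy h
    have := hQ2 x hx y hy
    rw [h, sub_self, norm_zero, mul_zero] at this
    exact sub_eq_zero.1 (norm_le_zero_iff.1 this)
  have hvol : volume (projAlong e '' B) = ENNReal.ofReal κ * μHE[d] (Q '' B) := by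
    -- `Q` moves points only along `e`, which the projection kills. So `B` can be replaced by the
    -- flat set `Q '' B`, on which the projection is linear with Jacobian `κ`.
    have h1 : projAlong e '' B = (projAlong e).toLinearMap.domRestrict T '' (Q '' B) := by
      rw [image_image]
      refine image_congr fun x _ => ?_
      simp only [LinearMap.domRestrict_apply, ContinuousLinearMap.coe_coe, Q, map_sub, map_smul]
      have : projAlong e e = 0 := by
        rw [Subtype.ext_iff, coe_projAlong e he, real_inner_self_eq_norm_sq, he]
        simp
      rw [this, smul_zero, sub_zero]
    have h2 := LinearMap.euclideanHausdorffMeasure_image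
      ((projAlong e).toLinearMap.domRestrict T) (Q '' B)
    rw [normDet_projAlong_domRestrict e n he hn, abs_of_pos hpos, ← h1, hrank n hn0] at h2
    rw [← h2, ← InnerProductSpace.euclideanHausdorffMeasure_eq_volume, hrank e he0]
  have hle1 : μHE[d] (Q '' B) ≤ (k : ENNReal) ^ d * μHE[d] B :=
    euclideanHausdorffMeasure_image_le hQ1 d
  have hle2 : μHE[d] B ≤ (k : ENNReal) ^ d * μHE[d] (Q '' B) := by
    rcases B.eq_empty_or_nonempty with rfl | hne
    · simp
    have : Nonempty V := ⟨0⟩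
    have h : LipschitzOnWith k (Function.invFunOn Q B) (Q '' B) := by
      refine LipschitzOnWith.of_dist_le_mul ?_
      rintro _ ⟨x, hx, rfl⟩ _ ⟨y, hy, rfl⟩
      rw [hQinj.leftInvOn_invFunOn hx, hQinj.leftInvOn_invFunOn hy, dist_eq_norm, dist_eq_norm]
      exact hQ2 x hx y hy
    have h1 := euclideanHausdorffMeasure_image_le h d
    rwa [hQinj.invFunOn_image Subset.rfl] at h1
  rw [hvol]
  constructor
  · calc _ ≤ ENNReal.ofReal κ * ((k : ENNReal) ^ d * μHE[d] B) := by gcongr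
      _ = _ := by ring
  · calc _ ≤ ENNReal.ofReal κ * ((k : ENNReal) ^ d * μHE[d] (Q '' B)) := by gcongr
      _ = _ := by ring

/-- The area formula for the projection of a hypersurface `S` with unit normal `n` along `e`. -/
theorem comap_projAlong_eq_withDensity {d : ℕ} (hd : Module.finrank ℝ V = d + 1) {e : V}
    (he : ‖e‖ = 1) {S : Set V} (hS : MeasurableSet S) {n : V → V} (hncont : ContinuousOn n S)
    (hn : ∀ x ∈ S, ‖n x‖ = 1) (hpos : ∀ x ∈ S, 0 < inner ℝ e (n x))
    (htan : ∀ q ∈ S, ∀ δ > 0, ∃ W ∈ 𝓝 q, ∀ x ∈ S ∩ W, ∀ y ∈ S ∩ W,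
      |inner ℝ (n q) (x - y)| ≤ δ * ‖x - y‖)
    (hinj : InjOn (projAlong e) S) :
    Measure.comap (S.domRestrict (projAlong e)) volume =
      (Measure.comap ((↑) : S → V) μHE[d]).withDensity
        (fun x => ENNReal.ofReal (inner ℝ e (n x))) := by
  have hemb : MeasurableEmbedding (S.domRestrict (projAlong e)) :=
    (projAlong e).continuous.continuousOn.measurableEmbedding hS hinj
  have hval : MeasurableEmbedding ((↑) : S → V) := MeasurableEmbedding.subtype_coe hS
  have hcont : Continuous fun x : S => inner ℝ e (n x) :=
    continuous_const.inner hncont.domRestrict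
  have hmeas : Measurable fun x : S => ENNReal.ofReal (inner ℝ e (n x)) :=
    ENNReal.measurable_ofReal.comp hcont.measurable
  -- Near each point the two measures agree up to a factor `c`. This local bound becomes global for
  -- each fixed `c`, and only then does `c` tend to `1`.
  have key : ∀ (c : NNReal), 1 < c → ∀ q : S, ∃ U ∈ 𝓝 q, ∀ B ⊆ U, MeasurableSet B →
      Measure.comap (S.domRestrict (projAlong e)) volume B ≤
        c * ((Measure.comap ((↑) : S → V) μHE[d]).withDensity
          (fun x => ENNReal.ofReal (inner ℝ e (n x)))) B ∧
      ((Measure.comap ((↑) : S → V) μHE[d]).withDensity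
          (fun x => ENNReal.ofReal (inner ℝ e (n x)))) B ≤
        c * Measure.comap (S.domRestrict (projAlong e)) volume B := by
    intro c hc q
    -- Of the `d + 1` factors `k`, `d` pay for the distortion of the Hausdorff measure and one for
    -- the oscillation of `⟪e, n x⟫` around its value at `q`.
    obtain ⟨k, hk1, hkc⟩ := exists_one_lt_pow_le c hc (d + 1)
    have hk0 : (1 : ℝ) < k := by exact_mod_cast hk1
    set κ : ℝ := inner ℝ e (n q) with hκ
    have hκ0 : 0 < κ := hpos q q.2
    have hkinv : (k : ℝ)⁻¹ < 1 := inv_lt_one_of_one_lt₀ hk0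
    obtain ⟨W, hW, hWle⟩ := htan q q.2 ((1 - (k : ℝ)⁻¹) * κ) (mul_pos (by linarith) hκ0)
    have hU1 : ∀ᶠ x : S in 𝓝 q, (x : V) ∈ W := continuous_subtype_val.continuousAt.eventually hW
    have hU2 : ∀ᶠ x : S in 𝓝 q, κ < k * inner ℝ e (n x) :=
      (hcont.const_smul (k : ℝ)).continuousAt.eventually_const_lt (by
        show κ < k * κ; nlinarith)
    have hU3 : ∀ᶠ x : S in 𝓝 q, inner ℝ e (n x) < k * κ :=
      hcont.continuousAt.eventually_lt_const (by show κ < k * κ; nlinarith)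
    refine ⟨_, hU1.and (hU2.and hU3), fun B hBU hB => ?_⟩
    have hBS : ∀ x ∈ ((↑) : S → V) '' B, x ∈ S ∩ W := by
      rintro _ ⟨x, hx, rfl⟩
      exact ⟨x.2, (hBU hx).1⟩
    obtain ⟨h1, h2⟩ := measure_projAlong_image_comparison hd he (hn q q.2) hκ0 hk1
      (B := ((↑) : S → V) '' B) (fun x hx y hy => hWle x (hBS x hx) y (hBS y hy))
    rw [hemb.comap_apply, withDensity_apply _ hB]
    have him : S.domRestrict (projAlong e) '' B = projAlong e '' (((↑) : S → V) '' B) := by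
      rw [image_image]; rfl
    rw [him]
    rw [← hval.comap_apply] at h1 h2
    have hkc' : (k : ENNReal) ^ d * k ≤ c := by
      rw [← pow_succ]; exact_mod_cast hkc
    have hofk : ENNReal.ofReal (k : ℝ) = k := ENNReal.ofReal_coe_nnreal
    set I := ∫⁻ x in B, ENNReal.ofReal (inner ℝ e (n x)) ∂Measure.comap ((↑) : S → V) μHE[d]
    constructor
    · have h3 : ENNReal.ofReal κ * Measure.comap ((↑) : S → V) μHE[d] B ≤
          k * I := by
        rw [← setLIntegral_const, ← lintegral_const_mul _ hmeas]
        refine setLIntegral_mono (hmeas.const_mul _) fun x hx => ?_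
        rw [← hofk, ← ENNReal.ofReal_mul (by positivity)]
        exact ENNReal.ofReal_le_ofReal (hBU hx).2.1.le
      calc _ ≤ _ := h1
        _ = (k : ENNReal) ^ d * (ENNReal.ofReal κ * Measure.comap ((↑) : S → V) μHE[d] B) := by
            ring
        _ ≤ (k : ENNReal) ^ d * (k * I) := by gcongr
        _ = ((k : ENNReal) ^ d * k) * I := by ring
        _ ≤ c * I := by gcongr
    · have h3 : I ≤
          k * (ENNReal.ofReal κ * Measure.comap ((↑) : S → V) μHE[d] B) := by
        rw [← mul_assoc, ← setLIntegral_const]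
        refine setLIntegral_mono measurable_const fun x hx => ?_
        rw [← hofk, ← ENNReal.ofReal_mul (by positivity)]
        exact ENNReal.ofReal_le_ofReal (hBU hx).2.2.le
      calc _ ≤ _ := h3
        _ ≤ k * ((k : ENNReal) ^ d * volume (projAlong e '' (((↑) : S → V) '' B))) := by gcongr
        _ = ((k : ENNReal) ^ d * k) * volume (projAlong e '' (((↑) : S → V) '' B)) := by ring
        _ ≤ c * volume (projAlong e '' (((↑) : S → V) '' B)) := by gcongr
  refine le_antisymm ?_ ?_
  · refine Measure.le_intro fun A hA _ => ENNReal.le_of_forall_one_lt_le_mul fun c hc => ?_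
    have := Measure.le_of_locally_le (X := S) (ν := c • ((Measure.comap ((↑) : S → V) μHE[d]).withDensity
          (fun x => ENNReal.ofReal (inner ℝ e (n x))))) (fun q => by
        obtain ⟨U, hU, h⟩ := key c hc q
        exact ⟨U, hU, fun B hBU hB => (h B hBU hB).1⟩)
    exact this A
  · refine Measure.le_intro fun A hA _ => ENNReal.le_of_forall_one_lt_le_mul fun c hc => ?_
    have := Measure.le_of_locally_le (X := S)
      (ν := c • Measure.comap (S.domRestrict (projAlong e)) volume) (fun q => by
        obtain ⟨U, hU, h⟩ := key c hc q
        exact ⟨U, hU, fun B hBU hB => (h B hBU hB).2⟩)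
    exact this A

end Area

/-! ### Local geometry of a `C²` boundary -/

section Boundary

variable {N : ℕ} {Ω : Set (EuclideanSpace ℝ (Fin N))} {p q : EuclideanSpace ℝ (Fin N)}
  {ρ ρ₁ ρ₂ : EuclideanSpace ℝ (Fin N) → ℝ}

theorem inner_gradient_eq_fderiv (f : EuclideanSpace ℝ (Fin N) → ℝ)
    (x v : EuclideanSpace ℝ (Fin N)) : inner ℝ (∇ f x) v = fderiv ℝ f x v := by
  simp [gradient]

theorem continuousAt_gradient (h : ContDiffAt ℝ 2 ρ p) : ContinuousAt (∇ ρ) p :=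
  (toDual ℝ (EuclideanSpace ℝ (Fin N))).symm.continuous.continuousAt.comp
    (h.fderiv_right (m := 1) (by norm_num)).continuousAt

theorem contDiffAt_gradient (h : ContDiffAt ℝ 2 ρ p) : ContDiffAt ℝ 1 (∇ ρ) p := by
  let A : StrongDual ℝ (EuclideanSpace ℝ (Fin N)) →L[ℝ] EuclideanSpace ℝ (Fin N) :=
    ⟨⟨⟨(toDual ℝ (EuclideanSpace ℝ (Fin N))).symm, by simp⟩, by simp⟩,
      (toDual ℝ (EuclideanSpace ℝ (Fin N))).symm.continuous⟩
  exact A.contDiff.contDiffAt.comp p (h.fderiv_right (m := 1) (by norm_num))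

theorem eventually_lt_of_inner_gradient_neg (h : DifferentiableAt ℝ ρ p)
    {v : EuclideanSpace ℝ (Fin N)} (hv : inner ℝ (∇ ρ p) v < 0) :
    ∀ᶠ s : ℝ in 𝓝[>] 0, ρ (p + s • v) < ρ p := by
  have h1 : HasDerivAt (fun s : ℝ => ρ (p + s • v)) (inner ℝ (∇ ρ p) v) 0 := by
    rw [inner_gradient_eq_fderiv]
    exact (h.hasFDerivAt.hasLineDerivAt v)
  have h2 := (hasDerivAt_iff_tendsto_slope_zero.1 h1).mono_left
    (nhdsWithin_mono 0 (fun s (hs : s ∈ Ioi (0 : ℝ)) => ne_of_gt hs) : 𝓝[>] (0 : ℝ) ≤ 𝓝[≠] 0)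
  filter_upwards [h2.eventually_lt_const hv, self_mem_nhdsWithin] with s hs hs0
  simp only [zero_add, zero_smul, add_zero, smul_eq_mul] at hs
  have := (mul_neg_iff.1 hs)
  rcases this with h3 | h3
  · linarith [h3.2]
  · exact absurd h3.1 (not_lt.2 (inv_nonneg.2 (le_of_lt hs0)))

theorem IsLocalDefiningFunction.eq_zero (h : IsLocalDefiningFunction Ω p ρ) (hΩ : IsOpen Ω)
    (hp : p ∈ frontier Ω) : ρ p = 0 := by
  rw [hΩ.frontier_eq] at hp
  refine le_antisymm ?_ (not_lt.1 fun hlt => hp.2 (h.2.2.self_of_nhds.2 hlt))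
  have h1 : ∃ᶠ x in 𝓝 p, ρ x ≤ 0 :=
    ((mem_closure_iff_frequently.1 hp.1).and_eventually h.2.2).mono
      fun x hx => (hx.2.1 hx.1).le
  by_contra hcon
  exact h1 ((h.1.continuousAt.eventually_const_lt (not_le.1 hcon)).mono fun x hx => not_le.2 hx)

theorem tendsto_add_smul_nhdsGT (p v : EuclideanSpace ℝ (Fin N)) :
    Tendsto (fun s : ℝ => p + s • v) (𝓝[>] 0) (𝓝 p) := by
  have : Continuous fun s : ℝ => p + s • v := by fun_prop
  simpa using (this.tendsto 0).mono_left (nhdsWithin_le_nhds (s := Ioi 0))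

/-- A direction in which `ρ₁` decreases enters `Ω`, so `ρ₂` cannot increase along it. This inclusion
of half-spaces makes the two gradients positive multiples of each other. -/
theorem IsLocalDefiningFunction.normal_unique (h₁ : IsLocalDefiningFunction Ω p ρ₁)
    (h₂ : IsLocalDefiningFunction Ω p ρ₂) (hΩ : IsOpen Ω) (hp : p ∈ frontier Ω) :
    ‖∇ ρ₁ p‖⁻¹ • ∇ ρ₁ p = ‖∇ ρ₂ p‖⁻¹ • ∇ ρ₂ p := by
  have hz₁ := h₁.eq_zero hΩ hp
  have hz₂ := h₂.eq_zero hΩ hp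
  have key : ∀ v, inner ℝ (∇ ρ₁ p) v < 0 → inner ℝ (∇ ρ₂ p) v ≤ 0 := by
    intro v hv
    by_contra hcon
    have e1 := eventually_lt_of_inner_gradient_neg (h₁.1.differentiableAt (by norm_num)) hv
    have e2 := eventually_lt_of_inner_gradient_neg (ρ := fun x => -ρ₂ x) (p := p) (v := v)
      (h₂.1.differentiableAt (by norm_num)).neg (by
        rw [inner_gradient_eq_fderiv, fderiv_fun_neg, neg_apply,
          ← inner_gradient_eq_fderiv]
        linarith [not_le.1 hcon])
    have t := tendsto_add_smul_nhdsGT p v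
    obtain ⟨s, a1, a2, a3, a4⟩ :=
      (e1.and (e2.and ((t.eventually h₁.2.2).and (t.eventually h₂.2.2)))).exists
    rw [hz₁] at a1
    have := a4.1 (a3.2 a1)
    linarith
  obtain ⟨-, hg₁, -⟩ := h₁
  obtain ⟨-, hg₂, -⟩ := h₂
  generalize ∇ ρ₁ p = g₁ at *
  generalize ∇ ρ₂ p = g₂ at *
  have hn₁ : 0 < ‖g₁‖ := norm_pos_iff.2 hg₁
  -- A vector orthogonal to `g₁` is the limit of `v - ε g₁`, which lies in the open half-space where
  -- `key` applies.
  have key2 : ∀ v, inner ℝ g₁ v = 0 → inner ℝ g₂ v ≤ 0 := by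
    intro v hv
    have h1 : ∀ ε > 0, inner ℝ g₂ v ≤ ε * inner ℝ g₂ g₁ := by
      intro ε hε
      have := key (v - ε • g₁) (by
        rw [inner_sub_right, hv, inner_smul_right, real_inner_self_eq_norm_sq]
        have : 0 < ε * ‖g₁‖ ^ 2 := by positivity
        linarith)
      rw [inner_sub_right, inner_smul_right] at this
      linarith
    have h2 : Tendsto (fun ε : ℝ => ε * inner ℝ g₂ g₁) (𝓝[>] 0) (𝓝 (0 * inner ℝ g₂ g₁)) :=
      (tendsto_id.mul_const _).mono_left nhdsWithin_le_nhds
    rw [zero_mul] at h2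
    exact ge_of_tendsto h2 (eventually_mem_nhdsWithin.mono h1)
  set c : ℝ := inner ℝ g₁ g₂ / ‖g₁‖ ^ 2 with hc
  have hv0 : inner ℝ g₁ (g₂ - c • g₁) = 0 := by
    rw [inner_sub_right, inner_smul_right, real_inner_self_eq_norm_sq, hc]
    field_simp
    ring
  have h3 := key2 _ hv0
  have h4 : inner ℝ g₂ (g₂ - c • g₁) = ‖g₂ - c • g₁‖ ^ 2 := by
    rw [← real_inner_self_eq_norm_sq, inner_sub_left, inner_smul_left, hv0]
    simp
  have h5 : g₂ = c • g₁ := by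
    rw [h4] at h3
    have : ‖g₂ - c • g₁‖ = 0 := by nlinarith [norm_nonneg (g₂ - c • g₁)]
    exact sub_eq_zero.1 (norm_eq_zero.1 this)
  have hc0 : 0 < c := by
    have h6 := key (-g₁) (by
      rw [inner_neg_right, real_inner_self_eq_norm_sq]
      have : 0 < ‖g₁‖ ^ 2 := by positivity
      linarith)
    rw [inner_neg_right, real_inner_comm] at h6
    refine lt_of_le_of_ne (div_nonneg (by linarith) (by positivity)) ?_
    rintro h7
    rw [← h7, zero_smul] at h5
    exact hg₂ h5
  rw [h5, norm_smul, Real.norm_of_nonneg hc0.le, smul_smul]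
  congr 1
  field_simp

theorem isLocalDefiningFunction_localDefiningFunction (hC2 : HasC2Boundary Ω)
    (hp : p ∈ frontier Ω) : IsLocalDefiningFunction Ω p (localDefiningFunction Ω p) := by
  have h := hC2 p hp
  unfold localDefiningFunction
  rw [dif_pos h]
  exact h.choose_spec

theorem IsLocalDefiningFunction.outerUnitNormal_eq (h : IsLocalDefiningFunction Ω p ρ)
    (hΩ : IsOpen Ω) (hp : p ∈ frontier Ω) : outerUnitNormal Ω p = ‖∇ ρ p‖⁻¹ • ∇ ρ p := by
  have h' : IsLocalDefiningFunction Ω p (localDefiningFunction Ω p) := by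
    have h := (⟨ρ, h⟩ : ∃ ρ, IsLocalDefiningFunction Ω p ρ)
    unfold localDefiningFunction
    rw [dif_pos h]
    exact h.choose_spec
  exact h'.normal_unique h hΩ hp

/-- On the ball of radius `r` around `p`, the set `Ω` is the sublevel set of `ρ`. -/
structure IsBoundaryChart (Ω : Set (EuclideanSpace ℝ (Fin N))) (p : EuclideanSpace ℝ (Fin N))
    (ρ : EuclideanSpace ℝ (Fin N) → ℝ) (r : ℝ) : Prop where
  pos : 0 < r
  contDiffAt : ∀ x ∈ Metric.ball p r, ContDiffAt ℝ 2 ρ x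
  gradient_ne_zero : ∀ x ∈ Metric.ball p r, ∇ ρ x ≠ 0
  mem_iff : ∀ x ∈ Metric.ball p r, x ∈ Ω ↔ ρ x < 0
  mem_frontier_iff : ∀ x ∈ Metric.ball p r, x ∈ frontier Ω ↔ ρ x = 0
  normal_eq : ∀ x ∈ Metric.ball p r, x ∈ frontier Ω → outerUnitNormal Ω x = ‖∇ ρ x‖⁻¹ • ∇ ρ x

theorem IsBoundaryChart.mono {r s : ℝ} (h : IsBoundaryChart Ω p ρ r) (hs : 0 < s) (hsr : s ≤ r) :
    IsBoundaryChart Ω p ρ s := by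
  have hsub := Metric.ball_subset_ball (x := p) hsr
  exact ⟨hs, fun x hx => h.2 x (hsub hx), fun x hx => h.3 x (hsub hx),
    fun x hx => h.4 x (hsub hx), fun x hx => h.5 x (hsub hx), fun x hx => h.6 x (hsub hx)⟩

theorem exists_isBoundaryChart (hΩ : IsOpen Ω) (hC2 : HasC2Boundary Ω) (hp : p ∈ frontier Ω) :
    ∃ r, IsBoundaryChart Ω p (localDefiningFunction Ω p) r := by
  have h := isLocalDefiningFunction_localDefiningFunction hC2 hp
  set ρ := localDefiningFunction Ω p
  -- Being a local defining function is an open condition in the base point. One `ρ` thus serves all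
  -- boundary points near `p`, and uniqueness of the normal identifies its normalised gradient with
  -- the chosen normals there.
  have e1 : ∀ᶠ x in 𝓝 p, IsLocalDefiningFunction Ω x ρ :=
    (h.1.eventually (by norm_num)).and
      (((continuousAt_gradient h.1).eventually_ne h.2.1).and (eventually_eventually_nhds.2 h.2.2))
  obtain ⟨r, hr, hball⟩ := Metric.eventually_nhds_iff_ball.1 e1
  refine ⟨r, hr, fun x hx => (hball x hx).1, fun x hx => (hball x hx).2.1,
    fun x hx => (hball x hx).2.2.self_of_nhds, fun x hx => ⟨(hball x hx).eq_zero hΩ, fun h0 => ?_⟩,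
    fun x hx hxf => (hball x hx).outerUnitNormal_eq hΩ hxf⟩
  have hx' := hball x hx
  rw [hΩ.frontier_eq]
  refine ⟨?_, fun hxΩ => (hx'.2.2.self_of_nhds.1 hxΩ).ne h0⟩
  -- Descending along `-∇ρ` from a zero of `ρ` reaches points of `Ω` arbitrarily close to `x`.
  have e2 := eventually_lt_of_inner_gradient_neg (hx'.1.differentiableAt (by norm_num))
    (v := -∇ ρ x) (by
      rw [inner_neg_right, real_inner_self_eq_norm_sq]
      have := norm_pos_iff.2 hx'.2.1
      have : 0 < ‖∇ ρ x‖ ^ 2 := by positivity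
      linarith)
  have t := tendsto_add_smul_nhdsGT x (-∇ ρ x)
  refine mem_closure_of_tendsto t ?_
  filter_upwards [e2, t.eventually hx'.2.2] with s h1 h2
  exact h2.2 (h0 ▸ h1)

theorem norm_outerUnitNormal (hC2 : HasC2Boundary Ω) (hp : p ∈ frontier Ω) :
    ‖outerUnitNormal Ω p‖ = 1 := by
  have h := (isLocalDefiningFunction_localDefiningFunction hC2 hp).2.1
  rw [outerUnitNormal, normalField, norm_smul, norm_inv, norm_norm,
    inv_mul_cancel₀ (norm_ne_zero_iff.2 h)]

namespace IsBoundaryChart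

variable {r : ℝ}

theorem le_zero_of_mem_closure (h : IsBoundaryChart Ω p ρ r) (hΩ : IsOpen Ω)
    {x : EuclideanSpace ℝ (Fin N)} (hx : x ∈ Metric.ball p r) (hxK : x ∈ closure Ω) : ρ x ≤ 0 := by
  by_cases hxΩ : x ∈ Ω
  · exact ((h.mem_iff x hx).1 hxΩ).le
  · exact ((h.mem_frontier_iff x hx).1 (hΩ.frontier_eq ▸ ⟨hxK, hxΩ⟩)).le

theorem contDiffAt_normal (h : IsBoundaryChart Ω p ρ r) {x : EuclideanSpace ℝ (Fin N)}
    (hx : x ∈ Metric.ball p r) : ContDiffAt ℝ 1 (fun y => ‖∇ ρ y‖⁻¹ • ∇ ρ y) x := by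
  have h1 := contDiffAt_gradient (h.contDiffAt x hx)
  have h0 := h.gradient_ne_zero x hx
  exact ((h1.norm ℝ h0).inv (norm_ne_zero_iff.2 h0)).smul h1

theorem continuousAt_inner_gradient (h : IsBoundaryChart Ω p ρ r)
    (a : EuclideanSpace ℝ (Fin N)) : ContinuousAt (fun x => inner ℝ (∇ ρ x) a) p :=
  ((continuousAt_gradient (h.contDiffAt p (Metric.mem_ball_self h.pos))).inner continuousAt_const)

theorem inner_normal (h : IsBoundaryChart Ω p ρ r) {x : EuclideanSpace ℝ (Fin N)}
    (hx : x ∈ Metric.ball p r) (hxf : x ∈ frontier Ω) (a : EuclideanSpace ℝ (Fin N)) :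
    inner ℝ (outerUnitNormal Ω x) a = ‖∇ ρ x‖⁻¹ * inner ℝ (∇ ρ x) a := by
  rw [h.normal_eq x hx hxf, inner_smul_left]; rfl

/-- After shrinking, the defining function is increasing in a transverse direction. -/
theorem exists_inner_gradient_pos (h : IsBoundaryChart Ω p ρ r) (hp : p ∈ frontier Ω)
    {a : EuclideanSpace ℝ (Fin N)} (ha : 0 < inner ℝ (outerUnitNormal Ω p) a) :
    ∃ s, IsBoundaryChart Ω p ρ s ∧ ∀ x ∈ Metric.ball p s, 0 < inner ℝ (∇ ρ x) a := by
  have hpr := Metric.mem_ball_self h.pos (x := p)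
  have h0 : 0 < inner ℝ (∇ ρ p) a := by
    rw [h.inner_normal hpr hp] at ha
    exact pos_of_mul_pos_right ha (inv_nonneg.2 (norm_nonneg _))
  obtain ⟨s, hs, hball⟩ := Metric.eventually_nhds_iff_ball.1
    ((h.continuousAt_inner_gradient a).eventually_const_lt h0)
  exact ⟨min r s, h.mono (lt_min h.pos hs) (min_le_left _ _),
    fun x hx => hball x (Metric.ball_subset_ball (min_le_right _ _) hx)⟩

theorem strictMonoOn_line (h : IsBoundaryChart Ω p ρ r) {a : EuclideanSpace ℝ (Fin N)}
    (ha : ∀ x ∈ Metric.ball p r, 0 < inner ℝ (∇ ρ x) a) (x : EuclideanSpace ℝ (Fin N)) {I : Set ℝ}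
    (hI : Convex ℝ I) (hx : ∀ s ∈ I, x + s • a ∈ Metric.ball p r) :
    StrictMonoOn (fun s : ℝ => ρ (x + s • a)) I ∧
      ContinuousOn (fun s : ℝ => ρ (x + s • a)) I := by
  have hd : ∀ s ∈ I, HasDerivAt (fun s : ℝ => ρ (x + s • a)) (inner ℝ (∇ ρ (x + s • a)) a) s := by
    intro s hs
    rw [inner_gradient_eq_fderiv]
    have h1 := ((h.contDiffAt _ (hx s hs)).differentiableAt (by norm_num)).hasFDerivAt
    have h2 : HasDerivAt (fun s : ℝ => x + s • a) a s := by
      simpa using ((hasDerivAt_id s).smul_const a).const_add x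
    exact h1.comp_hasDerivAt s h2
  have hc : ContinuousOn (fun s : ℝ => ρ (x + s • a)) I := fun s hs =>
    (hd s hs).continuousAt.continuousWithinAt
  refine ⟨strictMonoOn_of_deriv_pos hI hc fun s hs => ?_, hc⟩
  rw [(hd s (interior_subset hs)).deriv]
  exact ha _ (hx s (interior_subset hs))

end IsBoundaryChart

/-- Points of the closure are moved into `Ω` by inward directions. -/
theorem exists_inward (hΩ : IsOpen Ω) (hC2 : HasC2Boundary Ω) (hp : p ∈ frontier Ω)
    {a : EuclideanSpace ℝ (Fin N)} (ha : inner ℝ (outerUnitNormal Ω p) a < 0) :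
    ∃ r > 0, ∃ h > (0 : ℝ), ∀ x ∈ closure Ω, x ∈ Metric.ball p r → ∀ s ∈ Ioc 0 h, x + s • a ∈ Ω := by
  obtain ⟨r₀, hch₀⟩ := exists_isBoundaryChart hΩ hC2 hp
  obtain ⟨r, hch, hr⟩ := hch₀.exists_inner_gradient_pos hp (a := -a) (by
    rw [inner_neg_right]; linarith)
  have hr0 := hch.pos
  set h := r / 2 / (‖a‖ + 1) with hh
  have hh0 : 0 < h := by positivity
  refine ⟨r / 2, half_pos hr0, h, hh0, fun x hxK hx s hs => ?_⟩
  -- The monotonicity statement is for directions in which `ρ` increases, so the inward segment is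
  -- parametrised by `-a` with negative parameters.
  have hball : ∀ t ∈ Icc (-s) 0, x + t • (-a) ∈ Metric.ball p r := by
    intro t ht
    rw [Metric.mem_ball, dist_eq_norm] at hx ⊢
    have h1 : ‖t • (-a)‖ ≤ r / 2 := by
      rw [norm_smul, norm_neg, Real.norm_eq_abs, abs_of_nonpos ht.2]
      have : h * (‖a‖ + 1) = r / 2 := by rw [hh]; field_simp
      nlinarith [norm_nonneg a, hs.2, ht.1, ht.2]
    calc ‖x + t • (-a) - p‖ = ‖(x - p) + t • (-a)‖ := by congr 1; abel
      _ ≤ ‖x - p‖ + ‖t • (-a)‖ := norm_add_le _ _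
      _ < r := by linarith
  have hm := (hch.strictMonoOn_line hr x (convex_Icc (-s) 0) hball).1
  have h1 := hm (left_mem_Icc.2 (by linarith [hs.1])) (right_mem_Icc.2 (by linarith [hs.1]))
    (by linarith [hs.1] : -s < 0)
  have h2 : x + (-s) • (-a) = x + s • a := by simp
  have h3 := hball (-s) (left_mem_Icc.2 (by linarith [hs.1]))
  simp only [h2, zero_smul, add_zero] at h1 h3
  refine (hch.mem_iff _ h3).2 (h1.trans_le (hch.le_zero_of_mem_closure hΩ ?_ hxK))
  exact Metric.ball_subset_ball (by linarith) hx

/-- At a boundary point a short segment in any inward direction stays in the closure, so the tangent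
cone contains a positive multiple of each vector of an open half-space; such vectors span the whole
space. -/
theorem uniqueDiffOn_closure (hΩ : IsOpen Ω) (hC2 : HasC2Boundary Ω) :
    UniqueDiffOn ℝ (closure Ω) := by
  intro x hx
  by_cases hxΩ : x ∈ Ω
  · exact uniqueDiffWithinAt_of_mem_nhds (mem_of_superset (hΩ.mem_nhds hxΩ) subset_closure)
  have hxf : x ∈ frontier Ω := hΩ.frontier_eq ▸ ⟨hx, hxΩ⟩
  have hn := norm_outerUnitNormal hC2 hxf
  set n := outerUnitNormal Ω x with hndef
  have hcone : ∀ a, inner ℝ n a < 0 →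
      a ∈ Submodule.span ℝ (tangentConeAt ℝ (closure Ω) x) := by
    intro a ha
    obtain ⟨r, hr, h, hh, hin⟩ := exists_inward hΩ hC2 hxf ha
    have h1 : h • a ∈ tangentConeAt ℝ (closure Ω) x := by
      have h2 := mem_tangentConeAt_of_segment_subset (x := x) (y := x + h • a) (s := closure Ω) (by
        rw [segment_eq_image_lineMap]
        rintro _ ⟨t, ht, rfl⟩
        rcases eq_or_lt_of_le ht.1 with rfl | ht0
        · simpa using hx
        · rw [AffineMap.lineMap_apply]
          have h3 := hin x hx (Metric.mem_ball_self hr) (t * h)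
            ⟨by positivity, mul_le_of_le_one_left hh.le ht.2⟩
          refine subset_closure ?_
          convert h3 using 1
          simp [smul_smul, add_comm])
      simpa using h2
    have h4 := Submodule.smul_mem _ h⁻¹ (Submodule.subset_span (R := ℝ) h1)
    rwa [smul_smul, inv_mul_cancel₀ hh.ne', one_smul] at h4
  refine ⟨?_, subset_closure.trans (by rw [closure_closure]) hx⟩
  have htop : Submodule.span ℝ (tangentConeAt ℝ (closure Ω) x) = ⊤ := by
    rw [eq_top_iff]
    intro v _
    set M := |inner ℝ n v| + 1
    have hM : 0 < M := by positivity
    -- Any `v` is the difference of `v - M n` and `-M n`, both inward once `M > |⟪n, v⟫|`.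
    have h1 := hcone (v - M • n) (by
      rw [inner_sub_right, inner_smul_right, real_inner_self_eq_norm_sq, hn]
      have := le_abs_self (inner ℝ n v)
      simp only [M]
      linarith)
    have h2 := hcone (-(M • n)) (by
      rw [inner_neg_right, inner_smul_right, real_inner_self_eq_norm_sq, hn]
      linarith)
    have := Submodule.sub_mem _ h1 h2
    simpa using this
  rw [htop]
  exact dense_univ

end Boundary

/-! ### The boundary measure, tangential derivatives, and an extension of the normal -/

section BoundaryMeasure

variable {N : ℕ} {Ω : Set (EuclideanSpace ℝ (Fin N))} {p q : EuclideanSpace ℝ (Fin N)}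
  {ρ : EuclideanSpace ℝ (Fin N) → ℝ}

theorem continuousOn_outerUnitNormal (hΩ : IsOpen Ω) (hC2 : HasC2Boundary Ω) :
    ContinuousOn (outerUnitNormal Ω) (frontier Ω) := by
  intro p hp
  obtain ⟨r, h⟩ := exists_isBoundaryChart hΩ hC2 hp
  refine ((h.contDiffAt_normal (Metric.mem_ball_self h.pos)).continuousAt.continuousWithinAt).congr_of_eventuallyEq
    ?_ (h.normal_eq p (Metric.mem_ball_self h.pos) hp)
  filter_upwards [self_mem_nhdsWithin, mem_nhdsWithin_of_mem_nhds (Metric.ball_mem_nhds p h.pos)]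
    with x hx hxb using h.normal_eq x hxb hx

/-- Chords of the boundary near `q` are almost orthogonal to the normal at `q`. -/
theorem exists_nhds_inner_normal_le (hΩ : IsOpen Ω) (hC2 : HasC2Boundary Ω) (hq : q ∈ frontier Ω)
    {δ : ℝ} (hδ : 0 < δ) : ∃ W ∈ 𝓝 q, ∀ x ∈ frontier Ω ∩ W, ∀ y ∈ frontier Ω ∩ W,
      |inner ℝ (outerUnitNormal Ω q) (x - y)| ≤ δ * ‖x - y‖ := by
  obtain ⟨r, h⟩ := exists_isBoundaryChart hΩ hC2 hq
  set ρ := localDefiningFunction Ω q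
  have hqr := Metric.mem_ball_self h.pos (x := q)
  have hg : 0 < ‖∇ ρ q‖ := norm_pos_iff.2 (h.gradient_ne_zero q hqr)
  have h1 := (h.contDiffAt q hqr).hasStrictFDerivAt (by norm_num)
  have h2 := (hasStrictFDerivAt_iff_isLittleO.1 h1).def (mul_pos hδ hg)
  rw [nhds_prod_eq] at h2
  obtain ⟨W, hW, hle⟩ := (eventually_prod_self_iff (r := fun x y =>
    ‖ρ x - ρ y - (fderiv ℝ ρ q) (x - y)‖ ≤ δ * ‖∇ ρ q‖ * ‖x - y‖)).1 h2
  refine ⟨W ∩ Metric.ball q r, inter_mem hW (Metric.ball_mem_nhds q h.pos), ?_⟩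
  rintro x ⟨hx, hxW, hxb⟩ y ⟨hy, hyW, hyb⟩
  have h3 := hle x hxW y hyW
  rw [(h.mem_frontier_iff x hxb).1 hx, (h.mem_frontier_iff y hyb).1 hy, sub_self, zero_sub,
    norm_neg, ← inner_gradient_eq_fderiv, Real.norm_eq_abs] at h3
  rw [h.inner_normal hqr hq, abs_mul, abs_of_pos (inv_pos.2 hg)]
  calc ‖∇ ρ q‖⁻¹ * |inner ℝ (∇ ρ q) (x - y)|
      ≤ ‖∇ ρ q‖⁻¹ * (δ * ‖∇ ρ q‖ * ‖x - y‖) := by gcongr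
    _ = _ := by field_simp

/-- A function vanishing on the boundary has no tangential derivative. -/
theorem hasFDerivWithinAt_apply_eq_zero_of_tangent {G : Type*} [NormedAddCommGroup G]
    [NormedSpace ℝ G] (hΩ : IsOpen Ω) (hC2 : HasC2Boundary Ω) (hp : p ∈ frontier Ω)
    {f : EuclideanSpace ℝ (Fin N) → G} {f' : EuclideanSpace ℝ (Fin N) →L[ℝ] G}
    (hf : HasFDerivWithinAt f f' (frontier Ω) p) (h0 : ∀ᶠ x in 𝓝[frontier Ω] p, f x = 0)
    {t : EuclideanSpace ℝ (Fin N)} (ht : inner ℝ (outerUnitNormal Ω p) t = 0) : f' t = 0 := by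
  obtain ⟨r, h⟩ := exists_isBoundaryChart hΩ hC2 hp
  set ρ := localDefiningFunction Ω p
  have hpr := Metric.mem_ball_self h.pos (x := p)
  have hg : 0 < ‖∇ ρ p‖ := norm_pos_iff.2 (h.gradient_ne_zero p hpr)
  have h1 := (h.contDiffAt p hpr).hasStrictFDerivAt (by norm_num)
  have hrange : (fderiv ℝ ρ p).range = ⊤ := by
    rw [LinearMap.range_eq_top]
    intro c
    refine ⟨(c / ‖∇ ρ p‖ ^ 2) • ∇ ρ p, ?_⟩
    show fderiv ℝ ρ p _ = c
    rw [← inner_gradient_eq_fderiv, inner_smul_right, real_inner_self_eq_norm_sq]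
    field_simp
  have htker : t ∈ (fderiv ℝ ρ p).ker := by
    rw [LinearMap.mem_ker]
    show fderiv ℝ ρ p t = 0
    rw [← inner_gradient_eq_fderiv]
    rw [h.inner_normal hpr hp] at ht
    simpa [hg.ne'] using ht
  -- The implicit function parametrises the boundary near `p` by the tangent hyperplane, with the
  -- inclusion as derivative at `0`. As `f ∘ φ` vanishes near `0`, the chain rule kills `f'` on
  -- tangent vectors.
  set φ := h1.implicitFunction ρ (fderiv ℝ ρ p) hrange (ρ p) with hφ
  have hφ0 : φ 0 = p := h1.implicitFunction_apply_image hrange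
  have hφd : HasFDerivAt φ (fderiv ℝ ρ p).ker.subtypeL 0 :=
    (h1.to_implicitFunction hrange).hasFDerivAt
  have hev : ∀ᶠ z : (fderiv ℝ ρ p).ker in 𝓝 0, ρ (φ z) = ρ p := by
    have h2 := h1.map_implicitFunction_eq hrange
    have h3 : Tendsto (fun z : (fderiv ℝ ρ p).ker => (ρ p, z)) (𝓝 0) (𝓝 (ρ p, 0)) :=
      (Continuous.prodMk_right (ρ p)).tendsto 0
    exact h3.eventually h2
  have hball : ∀ᶠ z : (fderiv ℝ ρ p).ker in 𝓝 0, φ z ∈ Metric.ball p r := by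
    have := hφd.continuousAt.tendsto
    rw [hφ0] at this
    exact this.eventually (Metric.ball_mem_nhds p h.pos)
  have hfr : ∀ᶠ z : (fderiv ℝ ρ p).ker in 𝓝 0, φ z ∈ frontier Ω := by
    filter_upwards [hev, hball] with z hz hzb
    rw [h.mem_frontier_iff _ hzb, hz, (h.mem_frontier_iff p hpr).1 hp]
  have htend : Tendsto φ (𝓝 0) (𝓝[frontier Ω] p) := by
    refine tendsto_nhdsWithin_iff.2 ⟨?_, hfr⟩
    have := hφd.continuousAt.tendsto
    rwa [hφ0] at this
  have hcomp : HasFDerivAt (f ∘ φ) (f' ∘L (fderiv ℝ ρ p).ker.subtypeL) 0 := by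
    rw [← hφ0] at hf
    have htend' : Tendsto φ (𝓝 0) (𝓝[frontier Ω] (φ 0)) := by rwa [hφ0]
    exact hasFDerivWithinAt_univ.1 (hf.comp_of_tendsto 0 hφd.hasFDerivWithinAt
      (by rwa [nhdsWithin_univ]))
  have hzero : HasFDerivAt (f ∘ φ) (0 : (fderiv ℝ ρ p).ker →L[ℝ] G) 0 := by
    refine (hasFDerivAt_const (0 : G) (0 : (fderiv ℝ ρ p).ker)).congr_of_eventuallyEq ?_
    filter_upwards [htend.eventually h0] with z hz using hz
  have := congrArg (fun L => L ⟨t, htker⟩) (hcomp.unique hzero)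
  simpa using this

/-- Near each point the area is controlled by the volume of the projection along the normal there,
which is bounded; compactness leaves finitely many such pieces. -/
theorem measure_frontier_lt_top (hN : 1 ≤ N) (hΩ : IsOpen Ω) (hbdd : Bornology.IsBounded Ω)
    (hC2 : HasC2Boundary Ω) : (μHE[N - 1] : Measure (EuclideanSpace ℝ (Fin N))) (frontier Ω) < ⊤ := by
  have hcomp : IsCompact (frontier Ω) :=
    (Metric.isCompact_of_isClosed_isBounded isClosed_frontier
      (hbdd.closure.subset frontier_subset_closure))
  have hloc : ∀ q ∈ frontier Ω, ∃ W ∈ 𝓝[frontier Ω] q,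
      (μHE[N - 1] : Measure (EuclideanSpace ℝ (Fin N))) (W) < ⊤ := by
    intro q hq
    obtain ⟨W, hW, hle⟩ := exists_nhds_inner_normal_le hΩ hC2 hq (δ := 1 / 2) (by norm_num)
    refine ⟨frontier Ω ∩ W, inter_mem_nhdsWithin _ hW, ?_⟩
    have hn := norm_outerUnitNormal hC2 hq
    have hin : inner ℝ (outerUnitNormal Ω q) (outerUnitNormal Ω q) = (1 : ℝ) := by
      rw [real_inner_self_eq_norm_sq, hn]; norm_num
    have hd : Module.finrank ℝ (EuclideanSpace ℝ (Fin N)) = (N - 1) + 1 := by simp; omega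
    -- With `e = n` and `k = 2` the required tolerance is `(1 - 1/2) · 1`, which is the `δ` chosen
    -- above.
    have h2 := (measure_projAlong_image_comparison hd hn hn (by rw [hin]; norm_num) (k := 2)
      (by norm_num) (B := frontier Ω ∩ W) (by
        intro x hx y hy
        rw [hin]
        refine (hle x hx y hy).trans (le_of_eq ?_)
        norm_num)).2
    rw [hin, ENNReal.ofReal_one, one_mul] at h2
    refine h2.trans_lt (ENNReal.mul_lt_top (by simp) ?_)
    refine Bornology.IsBounded.measure_lt_top ?_
    exact (projAlong _).lipschitz.isBounded_image
      (hbdd.closure.subset (inter_subset_left.trans frontier_subset_closure))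
  refine hcomp.induction_on (p := fun s => (μHE[N - 1] : Measure (EuclideanSpace ℝ (Fin N))) s < ⊤)
    (by simp) (fun s t hst ht => (measure_mono hst).trans_lt ht)
    (fun s t hs ht => (measure_union_le s t).trans_lt (ENNReal.add_lt_top.2 ⟨hs, ht⟩)) hloc

open scoped Manifold ContDiff in
/-- The outer unit normal extends to a field of class `C¹` on the whole space. -/
theorem exists_contDiff_extension_normal (hΩ : IsOpen Ω) (hC2 : HasC2Boundary Ω) :
    ∃ n : EuclideanSpace ℝ (Fin N) → EuclideanSpace ℝ (Fin N), ContDiff ℝ 1 n ∧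
      ∀ x ∈ frontier Ω, n x = outerUnitNormal Ω x := by
  classical
  -- The constraint is convex at every point, a singleton on the boundary and no condition
  -- elsewhere. Gluing the local normal fields by a partition of unity therefore keeps the exact
  -- values on the boundary.
  set t : EuclideanSpace ℝ (Fin N) → Set (EuclideanSpace ℝ (Fin N)) := fun x =>
    if x ∈ frontier Ω then {outerUnitNormal Ω x} else univ
  have ht : ∀ x, Convex ℝ (t x) := by
    intro x
    by_cases hx : x ∈ frontier Ω
    · simp [t, hx]
    · simp [t, hx, convex_univ]
  obtain ⟨g, hg⟩ := exists_contMDiffMap_forall_mem_convex_of_local (n := 1)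
    𝓘(ℝ, EuclideanSpace ℝ (Fin N)) (t := t) ht (by
    intro x
    by_cases hx : x ∈ frontier Ω
    · obtain ⟨r, h⟩ := exists_isBoundaryChart hΩ hC2 hx
      refine ⟨Metric.ball x r, Metric.ball_mem_nhds x h.pos, normalField Ω x, ?_, ?_⟩
      · exact fun y hy => (h.contDiffAt_normal hy).contMDiffAt.contMDiffWithinAt
      · intro y hy
        by_cases hyf : y ∈ frontier Ω
        · simp [t, hyf, h.normal_eq y hy hyf, normalField]
        · simp [t, hyf]
    · refine ⟨(frontier Ω)ᶜ, isClosed_frontier.isOpen_compl.mem_nhds hx, fun _ => 0,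
        contMDiffOn_const, fun y hy => ?_⟩
      simp [t, show y ∉ frontier Ω from hy])
  refine ⟨g, g.contMDiff.contDiff, fun x hx => ?_⟩
  have := hg x
  simpa [t, hx] using this

end BoundaryMeasure

/-! ### The Gauss–Green formula near a boundary point, for a transverse direction -/

/-- The fundamental theorem of calculus on the part of a line where an increasing function is
negative. -/
theorem setIntegral_deriv_sublevel {h h' φ : ℝ → ℝ} {D : Set ℝ} {a b : ℝ} (hab : a < b)
    (hφm : StrictMonoOn φ (Icc a b)) (hφc : ContinuousOn φ (Icc a b))
    (hD : ∀ s ∈ Icc a b, s ∈ D ↔ φ s < 0) (hDo : IsOpen D)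
    (hh : ContinuousOn h {s ∈ Icc a b | φ s ≤ 0}) (hd : ∀ s ∈ D, HasDerivAt h (h' s) s)
    (hout : ∀ s ∉ Ioo a b, h s = 0) (hint : IntegrableOn h' D) :
    (∀ s ∈ Icc a b, φ s = 0 → ∫ t in D, h' t = h s) ∧
      ((∀ s ∈ Icc a b, φ s ≠ 0) → ∫ t in D, h' t = 0) := by
  have ha0 : h a = 0 := hout a fun hx => lt_irrefl _ hx.1
  have hb0 : h b = 0 := hout b fun hx => lt_irrefl _ hx.2
  -- Outside `[a, b]` the function `h` is locally zero, hence so is its derivative, whatever `D`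
  -- looks like there.
  have h1 : ∫ t in D, h' t = ∫ t in D ∩ Icc a b, h' t := by
    refine setIntegral_eq_of_subset_of_forall_sdiff_eq_zero hDo.measurableSet inter_subset_left ?_
    rintro s ⟨hsD, hs⟩
    have hsI : s ∉ Icc a b := fun hI => hs ⟨hsD, hI⟩
    have h2 : HasDerivAt h 0 s := by
      refine (hasDerivAt_const s (0 : ℝ)).congr_of_eventuallyEq ?_
      filter_upwards [isClosed_Icc.isOpen_compl.mem_nhds hsI] with t ht
      exact hout t fun hI => ht (Ioo_subset_Icc_self hI)
    exact (hd s hsD).unique h2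
  have ftc : ∀ c ∈ Icc a b, (∀ s ∈ Ico a c, φ s < 0) → φ c ≤ 0 →
      ∫ t in Ico a c, h' t = h c - h a := by
    intro c hc hneg hc0
    have hsub : Ico a c ⊆ D := fun s hs => (hD s ⟨hs.1, hs.2.le.trans hc.2⟩).2 (hneg s hs)
    rw [integral_Ico_eq_integral_Ioo, ← integral_Ioc_eq_integral_Ioo,
      ← intervalIntegral.integral_of_le hc.1]
    refine intervalIntegral.integral_eq_sub_of_hasDerivAt_of_le hc.1 (hh.mono fun s hs => ?_)
      (fun s hs => hd s (hsub (Ioo_subset_Ico_self hs))) ?_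
    · refine ⟨⟨hs.1, hs.2.trans hc.2⟩, ?_⟩
      rcases eq_or_lt_of_le hs.2 with rfl | hlt
      · exact hc0
      · exact (hneg s ⟨hs.1, hlt⟩).le
    · rw [intervalIntegrable_iff_integrableOn_Ico_of_le hc.1]
      exact hint.mono_set hsub
  refine ⟨fun s hs hs0 => ?_, fun hne => ?_⟩
  · have h2 : D ∩ Icc a b = Ico a s := by
      ext t
      constructor
      · rintro ⟨htD, ht⟩
        have := (hD t ht).1 htD
        rw [← hs0] at this
        exact ⟨ht.1, (hφm.lt_iff_lt ht hs).1 this⟩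
      · intro ht
        have htI : t ∈ Icc a b := ⟨ht.1, ht.2.le.trans hs.2⟩
        exact ⟨(hD t htI).2 (hs0 ▸ (hφm.lt_iff_lt htI hs).2 ht.2), htI⟩
    rw [h1, h2, ftc s hs (fun t ht => ((hD t ⟨ht.1, ht.2.le.trans hs.2⟩).1
      (h2 ▸ ht : t ∈ D ∩ Icc a b).1)) hs0.le, ha0, sub_zero]
  · have haI : a ∈ Icc a b := left_mem_Icc.2 hab.le
    have hbI : b ∈ Icc a b := right_mem_Icc.2 hab.le
    -- With no zero of `φ`, the set `D` contains all of `[a, b]`, where the integral is `h b - h a =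
    -- 0`, or none of it; a change of sign is excluded by the intermediate value theorem.
    rcases lt_or_gt_of_ne (hne b hbI) with hb | hb
    · have hneg : ∀ s ∈ Icc a b, φ s < 0 := fun s hs =>
        ((hφm.le_iff_le hs hbI).2 hs.2).trans_lt hb
      have h2 : D ∩ Icc a b = Icc a b :=
        inter_eq_right.2 fun s hs => (hD s hs).2 (hneg s hs)
      rw [h1, h2, integral_Icc_eq_integral_Ico, ftc b hbI (fun s hs => hneg s (Ico_subset_Icc_self hs))
        hb.le, ha0, hb0, sub_zero]
    · rcases lt_or_gt_of_ne (hne a haI) with ha | ha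
      · obtain ⟨s, hs, hs0⟩ := intermediate_value_Icc hab.le hφc
          (show (0 : ℝ) ∈ Icc (φ a) (φ b) from ⟨ha.le, hb.le⟩)
        exact absurd hs0 (hne s hs)
      · have h2 : D ∩ Icc a b = ∅ := by
          refine eq_empty_of_forall_notMem ?_
          rintro s ⟨hsD, hs⟩
          have h3 := (hD s hs).1 hsD
          have h4 := (hφm.le_iff_le haI hs).2 hs.1
          linarith
        rw [h1, h2, setIntegral_empty]

section GaussGreen

variable {N : ℕ} {Ω : Set (EuclideanSpace ℝ (Fin N))} {p : EuclideanSpace ℝ (Fin N)}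

theorem hasDerivAt_line {F : EuclideanSpace ℝ (Fin N) → ℝ} {c : ℝ} {e y : EuclideanSpace ℝ (Fin N)}
    {s : ℝ} (h : HasLineDerivAt ℝ F c (s • e + y) e) : HasDerivAt (fun t => F (t • e + y)) c s := by
  have h1 : HasDerivAt (fun t : ℝ => F (s • e + y + t • e)) c (s - s) := by rw [sub_self]; exact h
  have h2 := HasDerivAt.comp_sub_const s s h1
  refine h2.congr_of_eventuallyEq (Eventually.of_forall fun t => ?_)
  show F (t • e + y) = F (s • e + y + (t - s) • e)
  congr 1
  module

/-- The integral over `Ω` as an iterated integral along lines. -/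
theorem setIntegral_eq_integral_lines (hΩ : IsOpen Ω) {e : EuclideanSpace ℝ (Fin N)} (he : ‖e‖ = 1)
    {f : EuclideanSpace ℝ (Fin N) → ℝ} (hf : IntegrableOn f Ω) :
    (∀ᵐ y : (Submodule.span ℝ {e})ᗮ,
      IntegrableOn (fun s : ℝ => f (s • e + y)) {s : ℝ | s • e + (y : EuclideanSpace ℝ (Fin N)) ∈ Ω}) ∧
    ∫ x in Ω, f x = ∫ y : (Submodule.span ℝ {e})ᗮ,
      ∫ s in {s : ℝ | s • e + (y : EuclideanSpace ℝ (Fin N)) ∈ Ω}, f (s • e + y) := by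
  have hmp := measurePreserving_lineProdEquiv e he
  have hopen : ∀ y : (Submodule.span ℝ {e})ᗮ,
      MeasurableSet {s : ℝ | s • e + (y : EuclideanSpace ℝ (Fin N)) ∈ Ω} := fun y =>
    (hΩ.preimage (by fun_prop : Continuous fun s : ℝ =>
      s • e + (y : EuclideanSpace ℝ (Fin N)))).measurableSet
  have hind : Integrable (Ω.indicator f) := (integrable_indicator_iff hΩ.measurableSet).2 hf
  have hint : Integrable (fun q : ℝ × (Submodule.span ℝ {e})ᗮ =>
      Ω.indicator f (q.1 • e + q.2)) (volume.prod volume) := by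
    have := (hmp.integrable_comp_emb (lineProdEquiv e he).measurableEmbedding
      (g := Ω.indicator f)).2 hind
    refine this.congr (Eventually.of_forall fun q => ?_)
    simp [lineProdEquiv_apply]
  have hslice : ∀ y : (Submodule.span ℝ {e})ᗮ,
      (fun s : ℝ => Ω.indicator f (s • e + y)) =
        {s : ℝ | s • e + (y : EuclideanSpace ℝ (Fin N)) ∈ Ω}.indicator (fun s => f (s • e + y)) :=
    fun y => rfl
  constructor
  · filter_upwards [hint.prod_left_ae] with y hy
    rw [← integrable_indicator_iff (hopen y), ← hslice]
    exact hy
  · rw [← integral_indicator hΩ.measurableSet,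
      ← hmp.integral_comp (lineProdEquiv e he).measurableEmbedding]
    simp_rw [lineProdEquiv_apply]
    rw [integral_prod_symm _ hint]
    refine integral_congr_ae (Eventually.of_forall fun y => ?_)
    show ∫ s : ℝ, Ω.indicator f (s • e + y) = _
    rw [hslice, integral_indicator (hopen y)]

theorem exists_gaussGreen_of_transverse_unit (hN : 1 ≤ N) (hΩ : IsOpen Ω) (hC2 : HasC2Boundary Ω)
    (hp : p ∈ frontier Ω) {e : EuclideanSpace ℝ (Fin N)} (he : ‖e‖ = 1)
    (hpos : 0 < inner ℝ (outerUnitNormal Ω p) e) :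
    ∃ r > 0, ∀ F F' : EuclideanSpace ℝ (Fin N) → ℝ, ContinuousOn F (closure Ω) →
      (∀ x ∉ Metric.ball p r, F x = 0) → (∀ x ∈ Ω, HasLineDerivAt ℝ F (F' x) x e) →
      IntegrableOn F' Ω →
      ∫ x in Ω, F' x = ∫ x in frontier Ω, F x * inner ℝ (outerUnitNormal Ω x) e ∂μHE[N - 1] := by
  obtain ⟨R₀, hch₀⟩ := exists_isBoundaryChart hΩ hC2 hp
  obtain ⟨R, hch, hR⟩ := hch₀.exists_inner_gradient_pos hp hpos
  set ρ := localDefiningFunction Ω p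
  -- `F` lives in the ball of radius `r` while the chart holds on radius `2r`. On a line at distance
  -- less than `r` from `p`, the window of half-length `3r/2` covers the support of `F` and stays in
  -- the chart, because `(3/2)² + 1 < 4`.
  obtain ⟨r, hr, rfl⟩ : ∃ r > 0, R = 2 * r := ⟨R / 2, half_pos hch.pos, by ring⟩
  refine ⟨r, hr, fun F F' hF hF0 hF' hint => ?_⟩
  set S := frontier Ω ∩ Metric.ball p (2 * r) with hS
  have hSm : MeasurableSet S := isClosed_frontier.measurableSet.inter Metric.isOpen_ball.measurableSet
  have hgradpos : ∀ x ∈ S, 0 < inner ℝ e (outerUnitNormal Ω x) := by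
    rintro x ⟨hx, hxb⟩
    rw [real_inner_comm, hch.inner_normal hxb hx]
    exact mul_pos (inv_pos.2 (norm_pos_iff.2 (hch.gradient_ne_zero x hxb))) (hR x hxb)
  have hdecomp : ∀ x, x = (inner ℝ e x : ℝ) • e + (projAlong e x : EuclideanSpace ℝ (Fin N)) := by
    intro x
    rw [coe_projAlong e he]
    abel
  have horth : ∀ y : (Submodule.span ℝ {e})ᗮ, inner ℝ e (y : EuclideanSpace ℝ (Fin N)) = 0 :=
    fun y => (Submodule.mem_orthogonal_singleton_iff_inner_right).1 y.2
  have hlineinj : ∀ (y : (Submodule.span ℝ {e})ᗮ) (s t : ℝ),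
      s • e + (y : EuclideanSpace ℝ (Fin N)) ∈ S → t • e + (y : EuclideanSpace ℝ (Fin N)) ∈ S →
      s = t := by
    intro y s t hs ht
    have hconv : Convex ℝ {s : ℝ | (y : EuclideanSpace ℝ (Fin N)) + s • e ∈ Metric.ball p (2 * r)} := by
      intro s hs t ht a b ha hb hab
      have h1 := convex_ball p (2 * r) hs ht ha hb hab
      obtain rfl : a = 1 - b := by linarith
      have h2 : (y : EuclideanSpace ℝ (Fin N)) + ((1 - b) • s + b • t) • e =
          (1 - b) • ((y : EuclideanSpace ℝ (Fin N)) + s • e) + b • (y + t • e) := by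
        rw [smul_eq_mul, smul_eq_mul]
        module
      rw [← h2] at h1
      exact h1
    have hm := (hch.strictMonoOn_line hR y hconv (fun s hs => hs)).1
    have hs' : s ∈ {s : ℝ | (y : EuclideanSpace ℝ (Fin N)) + s • e ∈ Metric.ball p (2 * r)} := by
      rw [mem_ofPred_eq, add_comm]; exact hs.2
    have ht' : t ∈ {s : ℝ | (y : EuclideanSpace ℝ (Fin N)) + s • e ∈ Metric.ball p (2 * r)} := by
      rw [mem_ofPred_eq, add_comm]; exact ht.2
    refine hm.injOn hs' ht' ?_
    show ρ (y + s • e) = ρ (y + t • e)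
    rw [add_comm _ (s • e), add_comm _ (t • e), (hch.mem_frontier_iff _ hs.2).1 hs.1,
      (hch.mem_frontier_iff _ ht.2).1 ht.1]
  have hinj : InjOn (projAlong e) S := by
    intro x hx x' hx' heq
    have h1 := hdecomp x
    have h2 := hdecomp x'
    rw [← heq] at h2
    have := hlineinj (projAlong e x) _ _ (h1 ▸ hx) (h2 ▸ hx')
    rw [h1, h2, this]
  have harea := comap_projAlong_eq_withDensity (d := N - 1) (by simp; omega) he hSm
    ((continuousOn_outerUnitNormal hΩ hC2).mono inter_subset_left)
    (fun x hx => norm_outerUnitNormal hC2 hx.1) hgradpos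
    (fun q hq δ hδ => by
      obtain ⟨W, hW, h⟩ := exists_nhds_inner_normal_le hΩ hC2 hq.1 hδ
      exact ⟨W, hW, fun x hx y hy => h x ⟨hx.1.1, hx.2⟩ y ⟨hy.1.1, hy.2⟩⟩) hinj
  have hemb : MeasurableEmbedding (S.domRestrict (projAlong e)) :=
    (projAlong e).continuous.continuousOn.measurableEmbedding hSm hinj
  obtain ⟨hae, hfub⟩ := setIntegral_eq_integral_lines hΩ he hint
  set Φ : (Submodule.span ℝ {e})ᗮ → ℝ := fun y =>
    ∫ s in {s : ℝ | s • e + (y : EuclideanSpace ℝ (Fin N)) ∈ Ω}, F' (s • e + y) with hΦ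
  set c : ℝ := inner ℝ e p with hc
  have hdist : ∀ (s : ℝ) (y : (Submodule.span ℝ {e})ᗮ),
      ‖s • e + (y : EuclideanSpace ℝ (Fin N)) - p‖ ^ 2 = (s - c) ^ 2 + ‖y - projAlong e p‖ ^ 2 := by
    intro s y
    have h1 : s • e + (y : EuclideanSpace ℝ (Fin N)) - p =
        (s - c) • e + ((y - projAlong e p : (Submodule.span ℝ {e})ᗮ) : EuclideanSpace ℝ (Fin N)) := by
      conv_lhs => rw [hdecomp p]
      rw [AddSubgroupClass.coe_sub, ← hc]
      module
    rw [h1]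
    generalize y - projAlong e p = w
    have h2 := horth w
    have h3 : inner ℝ (w : EuclideanSpace ℝ (Fin N)) e = 0 := by rw [real_inner_comm, h2]
    rw [← real_inner_self_eq_norm_sq, inner_add_left, inner_add_right, inner_add_right,
      inner_smul_left, inner_smul_left, inner_smul_right, inner_smul_right, h2, h3,
      real_inner_self_eq_norm_sq, real_inner_self_eq_norm_sq, he, Submodule.coe_norm]
    simp
    ring
  -- A line in direction `e` crosses `S` at most once. The integral of `F'` over its part in `Ω` is
  -- the value of `F` at the crossing, and zero if there is none.
  have hfib : ∀ y : (Submodule.span ℝ {e})ᗮ,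
      IntegrableOn (fun s : ℝ => F' (s • e + y))
        {s : ℝ | s • e + (y : EuclideanSpace ℝ (Fin N)) ∈ Ω} →
      (∀ s : ℝ, s • e + (y : EuclideanSpace ℝ (Fin N)) ∈ S → Φ y = F (s • e + y)) ∧
        ((∀ s : ℝ, s • e + (y : EuclideanSpace ℝ (Fin N)) ∉ S) → Φ y = 0) := by
    intro y hy
    have hder : ∀ s : ℝ, s • e + (y : EuclideanSpace ℝ (Fin N)) ∈ Ω →
        HasDerivAt (fun s : ℝ => F (s • e + y)) (F' (s • e + y)) s :=
      fun s hs => hasDerivAt_line (hF' _ hs)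
    have hline : Continuous fun s : ℝ => s • e + (y : EuclideanSpace ℝ (Fin N)) := by fun_prop
    by_cases hyr : r ≤ ‖y - projAlong e p‖
    · have hF0' : ∀ s : ℝ, F (s • e + y) = 0 := by
        intro s
        refine hF0 _ fun hb => ?_
        rw [Metric.mem_ball, dist_eq_norm] at hb
        have := hdist s y
        nlinarith [sq_nonneg (s - c), norm_nonneg (s • e + (y : EuclideanSpace ℝ (Fin N)) - p)]
      have hΦ0 : Φ y = 0 := by
        refine setIntegral_eq_zero_of_forall_eq_zero fun s hs => ?_
        have h1 := hder s hs
        simp_rw [hF0'] at h1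
        exact h1.unique (hasDerivAt_const s 0)
      exact ⟨fun s _ => by rw [hΦ0, hF0'], fun _ => hΦ0⟩
    · rw [not_le] at hyr
      have hball : ∀ s ∈ Icc (c - 3 / 2 * r) (c + 3 / 2 * r),
          s • e + (y : EuclideanSpace ℝ (Fin N)) ∈ Metric.ball p (2 * r) := by
        intro s hs
        rw [Metric.mem_ball, dist_eq_norm]
        have h1 := hdist s y
        have h2 : (s - c) ^ 2 ≤ (3 / 2 * r) ^ 2 := by
          apply sq_le_sq'
          · linarith [hs.1]
          · linarith [hs.2]
        have h3 : ‖y - projAlong e p‖ ^ 2 < r ^ 2 := by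
          nlinarith [norm_nonneg (y - projAlong e p)]
        nlinarith [norm_nonneg (s • e + (y : EuclideanSpace ℝ (Fin N)) - p)]
      obtain ⟨hm, hcont⟩ := hch.strictMonoOn_line hR y
        (convex_Icc (c - 3 / 2 * r) (c + 3 / 2 * r)) (fun s hs => by
          rw [add_comm]; exact hball s hs)
      simp_rw [add_comm (y : EuclideanSpace ℝ (Fin N)) _] at hm hcont
      obtain ⟨h1, h2⟩ := setIntegral_deriv_sublevel (h := fun s : ℝ => F (s • e + y)) (by linarith)
        hm hcont (fun s hs => hch.mem_iff _ (hball s hs)) (hΩ.preimage hline)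
        (hF.comp hline.continuousOn (by
          rintro s ⟨hs, hs0⟩
          rcases eq_or_lt_of_le hs0 with h0 | hlt
          · exact frontier_subset_closure ((hch.mem_frontier_iff _ (hball s hs)).2 h0)
          · exact subset_closure ((hch.mem_iff _ (hball s hs)).2 hlt)))
        hder (by
          intro s hs
          refine hF0 _ fun hb => hs ?_
          rw [Metric.mem_ball, dist_eq_norm] at hb
          have h3 := hdist s y
          have h4 : (s - c) ^ 2 < (3 / 2 * r) ^ 2 := by
            nlinarith [norm_nonneg (s • e + (y : EuclideanSpace ℝ (Fin N)) - p),
              sq_nonneg ‖y - projAlong e p‖]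
          have h5 := abs_lt_of_sq_lt_sq' h4 (by positivity)
          exact ⟨by linarith [h5.1], by linarith [h5.2]⟩) hy
      refine ⟨fun s hs => ?_, fun hno => h2 fun s hs h0 => hno s
        ⟨(hch.mem_frontier_iff _ (hball s hs)).2 h0, hball s hs⟩⟩
      by_cases hsI : s ∈ Icc (c - 3 / 2 * r) (c + 3 / 2 * r)
      · exact h1 s hsI ((hch.mem_frontier_iff _ hs.2).1 hs.1)
      -- A crossing outside the window is harmless: `F` vanishes there, and since it is the only
      -- crossing the window contains none.
      · have hFs : F (s • e + y) = 0 := by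
          refine hF0 _ fun hb => hsI ?_
          rw [Metric.mem_ball, dist_eq_norm] at hb
          have h3 := hdist s y
          have h4 : (s - c) ^ 2 < (3 / 2 * r) ^ 2 := by
            nlinarith [norm_nonneg (s • e + (y : EuclideanSpace ℝ (Fin N)) - p),
              sq_nonneg ‖y - projAlong e p‖]
          have h5 := abs_lt_of_sq_lt_sq' h4 (by positivity)
          exact ⟨by linarith [h5.1], by linarith [h5.2]⟩
        rw [hFs]
        refine h2 fun t ht h0 => hsI ?_
        rw [hlineinj y s t hs ⟨(hch.mem_frontier_iff _ (hball t ht)).2 h0, hball t ht⟩]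
        exact ht
  -- The boundary integral is brought to the form given by Fubini: the area formula absorbs the
  -- weight `⟪ν, e⟫` into the volume of the projection of `S`, `hfib` replaces `F` by the fibre
  -- integral `Φ`, and lines missing `S` contribute nothing.
  have hR1 : ∫ x in frontier Ω, F x * inner ℝ (outerUnitNormal Ω x) e ∂μHE[N - 1] =
      ∫ x in S, F x * inner ℝ (outerUnitNormal Ω x) e ∂μHE[N - 1] := by
    refine setIntegral_eq_of_subset_of_forall_sdiff_eq_zero isClosed_frontier.measurableSet
      inter_subset_left ?_
    rintro x ⟨hx, hxS⟩
    rw [hF0 x fun hb => hxS ⟨hx, Metric.ball_subset_ball (by linarith) hb⟩, zero_mul]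
  have hncont : Continuous fun x : S => inner ℝ e (outerUnitNormal Ω x) :=
    continuous_const.inner ((continuousOn_outerUnitNormal hΩ hC2).mono inter_subset_left).domRestrict
  have hR2 : ∫ x in S, F x * inner ℝ (outerUnitNormal Ω x) e ∂μHE[N - 1] =
      ∫ x : S, F x ∂(Measure.comap (S.domRestrict (projAlong e)) volume) := by
    have hmeas : Measurable fun x : S => ENNReal.ofReal (inner ℝ e (outerUnitNormal Ω x)) :=
      ENNReal.measurable_ofReal.comp hncont.measurable
    rw [harea, integral_withDensity_eq_integral_toReal_smul hmeas (by simp),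
      ← integral_subtype_comap hSm]
    refine integral_congr_ae (Eventually.of_forall fun x => ?_)
    show _ = (ENNReal.ofReal (inner ℝ e (outerUnitNormal Ω x))).toReal • F x
    rw [ENNReal.toReal_ofReal (hgradpos x x.2).le, smul_eq_mul, mul_comm, real_inner_comm]
  have hmap := hemb.map_comap volume
  have hR3 : ∫ x : S, F x ∂(Measure.comap (S.domRestrict (projAlong e)) volume) =
      ∫ y in range (S.domRestrict (projAlong e)), Φ y := by
    rw [← hmap, hemb.integral_map]
    have hae' : ∀ᵐ x : S ∂(Measure.comap (S.domRestrict (projAlong e)) volume),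
        IntegrableOn (fun s : ℝ => F' (s • e + projAlong e x))
          {s : ℝ | s • e + (projAlong e x : EuclideanSpace ℝ (Fin N)) ∈ Ω} := by
      have h1 := ae_restrict_of_ae (s := range (S.domRestrict (projAlong e))) hae
      rw [← hmap] at h1
      exact ae_of_ae_map hemb.measurable.aemeasurable h1
    refine integral_congr_ae (hae'.mono fun x hx => ?_)
    have h1 := (hfib (projAlong e x) hx).1 (inner ℝ e (x : EuclideanSpace ℝ (Fin N)))
      (by rw [← hdecomp]; exact x.2)
    rw [← hdecomp] at h1
    exact h1.symm
  have hR4 : ∫ y in range (S.domRestrict (projAlong e)), Φ y = ∫ y, Φ y := by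
    refine setIntegral_eq_integral_of_ae_compl_eq_zero ?_
    filter_upwards [hae] with y hy hyr
    refine (hfib y hy).2 fun s hs => hyr ⟨⟨_, hs⟩, ?_⟩
    rw [Set.domRestrict_apply, Subtype.ext_iff, coe_projAlong e he, inner_add_right,
      inner_smul_right, horth, real_inner_self_eq_norm_sq, he]
    simp
  rw [hfub, hR1, hR2, hR3, hR4]

end GaussGreen

/-! ### The global Gauss–Green formula -/

section GaussGreenGlobal

variable {N : ℕ} {Ω : Set (EuclideanSpace ℝ (Fin N))} {p : EuclideanSpace ℝ (Fin N)}

theorem hasLineDerivAt_zero_of_eventuallyEq {F : EuclideanSpace ℝ (Fin N) → ℝ}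
    {x v : EuclideanSpace ℝ (Fin N)} (h0 : F =ᶠ[𝓝 x] fun _ => 0) : HasLineDerivAt ℝ F 0 x v :=
  (((hasFDerivAt_const (0 : ℝ) x).congr_of_eventuallyEq h0).hasLineDerivAt v)

/-- For support in a ball whose closure lies in `Ω` the boundary term is zero, and so is the volume
term: integrate by parts over the whole space against the constant `1`. -/
theorem exists_gaussGreen_interior (hΩ : IsOpen Ω) (hp : p ∈ Ω) (v : EuclideanSpace ℝ (Fin N)) :
    ∃ r > 0, ∀ F F' : EuclideanSpace ℝ (Fin N) → ℝ, ContinuousOn F (closure Ω) →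
      (∀ x ∉ Metric.ball p r, F x = 0) → (∀ x ∈ Ω, HasLineDerivAt ℝ F (F' x) x v) →
      IntegrableOn F' Ω →
      ∫ x in Ω, F' x = ∫ x in frontier Ω, F x * inner ℝ (outerUnitNormal Ω x) v ∂μHE[N - 1] := by
  obtain ⟨r, hr, hsub⟩ := Metric.nhds_basis_closedBall.mem_iff.1 (hΩ.mem_nhds hp)
  refine ⟨r, hr, fun F F' hF hF0 hF' hint => ?_⟩
  have hbd : ∀ x ∈ frontier Ω, F x * inner ℝ (outerUnitNormal Ω x) v = 0 := by
    intro x hx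
    rw [hF0 x fun hb => ?_, zero_mul]
    rw [hΩ.frontier_eq] at hx
    exact hx.2 (hsub (Metric.ball_subset_closedBall hb))
  rw [setIntegral_eq_zero_of_forall_eq_zero hbd, ← integral_indicator hΩ.measurableSet]
  have hind : Integrable (Ω.indicator F') := (integrable_indicator_iff hΩ.measurableSet).2 hint
  have hFint : Integrable F := by
    rw [← integrableOn_iff_integrable_of_support_subset (s := Metric.closedBall p r)]
    · exact (hF.mono (hsub.trans subset_closure)).integrableOn_compact (isCompact_closedBall p r)
    · intro x hx
      by_contra hcon
      exact hx (hF0 x fun hb => hcon (Metric.ball_subset_closedBall hb))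
  have hder : ∀ x, HasLineDerivAt ℝ F (Ω.indicator F' x) x v := by
    intro x
    by_cases hx : x ∈ Ω
    · rw [indicator_of_mem hx]
      exact hF' x hx
    · rw [indicator_of_notMem hx]
      refine hasLineDerivAt_zero_of_eventuallyEq ?_
      filter_upwards [Metric.isClosed_closedBall.isOpen_compl.mem_nhds
        (fun hb => hx (hsub hb) : x ∈ (Metric.closedBall p r)ᶜ)] with y hy
      exact hF0 y fun hb => hy (Metric.ball_subset_closedBall hb)
  have := integral_bilinear_hasLineDerivAt_right_eq_neg_left_of_integrable (μ := volume)
    (B := ContinuousLinearMap.mul ℝ ℝ) (f := F) (f' := Ω.indicator F') (g := fun _ => (1 : ℝ))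
    (g' := fun _ => 0) (v := v) (by simpa using hind) (by simp) (by simpa using hFint)
    (fun x _ => hder x) (fun x _ => (hasFDerivAt_const (1 : ℝ) x).hasLineDerivAt v)
  simpa using this

theorem exists_gaussGreen_of_transverse (hN : 1 ≤ N) (hΩ : IsOpen Ω) (hC2 : HasC2Boundary Ω)
    (hp : p ∈ closure Ω) {v : EuclideanSpace ℝ (Fin N)}
    (hpos : p ∈ frontier Ω → 0 < inner ℝ (outerUnitNormal Ω p) v) :
    ∃ r > 0, ∀ F F' : EuclideanSpace ℝ (Fin N) → ℝ, ContinuousOn F (closure Ω) →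
      (∀ x ∉ Metric.ball p r, F x = 0) → (∀ x ∈ Ω, HasLineDerivAt ℝ F (F' x) x v) →
      IntegrableOn F' Ω →
      ∫ x in Ω, F' x = ∫ x in frontier Ω, F x * inner ℝ (outerUnitNormal Ω x) v ∂μHE[N - 1] := by
  by_cases hpΩ : p ∈ Ω
  · exact exists_gaussGreen_interior hΩ hpΩ v
  have hpf : p ∈ frontier Ω := hΩ.frontier_eq ▸ ⟨hp, hpΩ⟩
  have hv := hpos hpf
  have hv0 : v ≠ 0 := by rintro rfl; simp at hv
  have hvn : 0 < ‖v‖ := norm_pos_iff.2 hv0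
  obtain ⟨r, hr, h⟩ := exists_gaussGreen_of_transverse_unit hN hΩ hC2 hpf (e := ‖v‖⁻¹ • v)
    (by rw [norm_smul, norm_inv, norm_norm, inv_mul_cancel₀ hvn.ne'])
    (by rw [inner_smul_right]; positivity)
  refine ⟨r, hr, fun F F' hF hF0 hF' hint => ?_⟩
  have h1 := h F (fun x => ‖v‖⁻¹ * F' x) hF hF0 (fun x hx => (hF' x hx).smul _)
    (hint.const_mul _)
  simp_rw [inner_smul_right, mul_left_comm _ ‖v‖⁻¹] at h1
  rw [integral_const_mul, integral_const_mul] at h1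
  exact mul_left_cancel₀ (inv_ne_zero hvn.ne') h1

theorem hasFDerivAt_of_contDiffOn_closure {G : Type*} [NormedAddCommGroup G] [NormedSpace ℝ G]
    (hΩ : IsOpen Ω) {f : EuclideanSpace ℝ (Fin N) → G} {n : WithTop ℕ∞} (hn : n ≠ 0)
    (hf : ContDiffOn ℝ n f (closure Ω)) {x : EuclideanSpace ℝ (Fin N)} (hx : x ∈ Ω) :
    HasFDerivAt f (fderivWithin ℝ f (closure Ω) x) x := by
  have hK : closure Ω ∈ 𝓝 x := mem_of_superset (hΩ.mem_nhds hx) subset_closure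
  exact ((hf.differentiableOn hn x (subset_closure hx)).hasFDerivWithinAt).hasFDerivAt hK

theorem continuousOn_fderivWithin_closure_apply (hΩ : IsOpen Ω) (hC2 : HasC2Boundary Ω)
    {f : EuclideanSpace ℝ (Fin N) → ℝ} (hf : ContDiffOn ℝ 1 f (closure Ω))
    (v : EuclideanSpace ℝ (Fin N)) :
    ContinuousOn (fun x => fderivWithin ℝ f (closure Ω) x v) (closure Ω) :=
  (hf.continuousOn_fderivWithin (uniqueDiffOn_closure hΩ hC2) (by norm_num)).clm_apply
    continuousOn_const

theorem isCompact_closure_of_isBounded (hbdd : Bornology.IsBounded Ω) : IsCompact (closure Ω) :=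
  Metric.isCompact_of_isClosed_isBounded isClosed_closure hbdd.closure

theorem isCompact_frontier_of_isBounded (hbdd : Bornology.IsBounded Ω) : IsCompact (frontier Ω) :=
  (isCompact_closure_of_isBounded hbdd).of_isClosed_subset isClosed_frontier frontier_subset_closure

theorem ContinuousOn.integrableOn_of_closure (hbdd : Bornology.IsBounded Ω)
    {f : EuclideanSpace ℝ (Fin N) → ℝ} (hf : ContinuousOn f (closure Ω)) : IntegrableOn f Ω :=
  (hf.integrableOn_compact (isCompact_closure_of_isBounded hbdd)).mono_set subset_closure

theorem ContinuousOn.integrableOn_frontier (hN : 1 ≤ N) (hΩ : IsOpen Ω)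
    (hbdd : Bornology.IsBounded Ω) (hC2 : HasC2Boundary Ω)
    {f : EuclideanSpace ℝ (Fin N) → ℝ} (hf : ContinuousOn f (frontier Ω)) :
    IntegrableOn f (frontier Ω) μHE[N - 1] :=
  hf.integrableOn_of_subset_isCompact (isCompact_frontier_of_isBounded hbdd)
    (isClosed_frontier.measurableSet) Subset.rfl
    (measure_frontier_lt_top hN hΩ hbdd hC2).ne

theorem continuousOn_inner_normal (hΩ : IsOpen Ω) (hC2 : HasC2Boundary Ω)
    (v : EuclideanSpace ℝ (Fin N)) :
    ContinuousOn (fun x => inner ℝ (outerUnitNormal Ω x) v) (frontier Ω) :=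
  (continuousOn_outerUnitNormal hΩ hC2).inner continuousOn_const

/-- The formula is linear in the direction, and any `v` is the difference of `v + M n` and `M n`,
both transverse at `p` for large `M`. The smaller of the two radii serves for `v`. -/
theorem exists_integral_fderivWithin_eq (hN : 1 ≤ N) (hΩ : IsOpen Ω) (hbdd : Bornology.IsBounded Ω)
    (hC2 : HasC2Boundary Ω) (v : EuclideanSpace ℝ (Fin N)) (hp : p ∈ closure Ω) :
    ∃ r > 0, ∀ f : EuclideanSpace ℝ (Fin N) → ℝ, ContDiffOn ℝ 1 f (closure Ω) →
      (∀ x ∉ Metric.ball p r, f x = 0) →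
      ∫ x in Ω, fderivWithin ℝ f (closure Ω) x v =
        ∫ x in frontier Ω, f x * inner ℝ (outerUnitNormal Ω x) v ∂μHE[N - 1] := by
  set n := outerUnitNormal Ω p with hn
  set M := |inner ℝ n v| + 1 with hM
  have hM0 : 0 < M := by positivity
  have hnn : p ∈ frontier Ω → inner ℝ n n = (1 : ℝ) := fun hpf => by
    rw [real_inner_self_eq_norm_sq, norm_outerUnitNormal hC2 hpf]; norm_num
  obtain ⟨r₁, hr₁, h₁⟩ := exists_gaussGreen_of_transverse hN hΩ hC2 hp (v := v + M • n)
    (fun hpf => by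
      rw [← hn, inner_add_right, inner_smul_right, hnn hpf]
      linarith [neg_abs_le (inner ℝ n v)])
  obtain ⟨r₂, hr₂, h₂⟩ := exists_gaussGreen_of_transverse hN hΩ hC2 hp (v := M • n)
    (fun hpf => by
      rw [← hn, inner_smul_right, hnn hpf]
      linarith)
  refine ⟨min r₁ r₂, lt_min hr₁ hr₂, fun f hf hf0 => ?_⟩
  have hline : ∀ w, ∀ x ∈ Ω, HasLineDerivAt ℝ f (fderivWithin ℝ f (closure Ω) x w) x w :=
    fun w x hx => (hasFDerivAt_of_contDiffOn_closure hΩ (by norm_num) hf hx).hasLineDerivAt w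
  have hint : ∀ w, IntegrableOn (fun x => fderivWithin ℝ f (closure Ω) x w) Ω := fun w =>
    (continuousOn_fderivWithin_closure_apply hΩ hC2 hf w).integrableOn_of_closure hbdd
  have hintb : ∀ w, IntegrableOn (fun x => f x * inner ℝ (outerUnitNormal Ω x) w) (frontier Ω)
      μHE[N - 1] := fun w =>
    ((hf.continuousOn.mono frontier_subset_closure).mul
      (continuousOn_inner_normal hΩ hC2 w)).integrableOn_frontier hN hΩ hbdd hC2
  have e₁ := h₁ f _ hf.continuousOn
    (fun x hx => hf0 x fun hb => hx (Metric.ball_subset_ball (min_le_left _ _) hb))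
    (hline _) (hint _)
  have e₂ := h₂ f _ hf.continuousOn
    (fun x hx => hf0 x fun hb => hx (Metric.ball_subset_ball (min_le_right _ _) hb))
    (hline _) (hint _)
  simp_rw [inner_add_right, mul_add, map_add] at e₁
  rw [integral_add (hint _) (hint _), integral_add (hintb _) (hintb _), e₂] at e₁
  exact add_right_cancel e₁

open scoped Manifold ContDiff in
/-- An additive property of `C¹` functions on a compact set which holds for functions with small
support holds for all of them. -/
theorem ContDiffOn.induction_of_local {K : Set (EuclideanSpace ℝ (Fin N))} (hK : IsCompact K)
    {P : (EuclideanSpace ℝ (Fin N) → ℝ) → Prop} (hzero : P fun _ => 0)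
    (hadd : ∀ f g, ContDiffOn ℝ 1 f K → ContDiffOn ℝ 1 g K → P f → P g → P fun x => f x + g x)
    (hcongr : ∀ f g, EqOn f g K → P f → P g)
    (hloc : ∀ p ∈ K, ∃ r > 0, ∀ f, ContDiffOn ℝ 1 f K → (∀ x ∉ Metric.ball p r, f x = 0) → P f)
    (f : EuclideanSpace ℝ (Fin N) → ℝ) (hf : ContDiffOn ℝ 1 f K) : P f := by
  choose! r hr hP using hloc
  obtain ⟨t, htK, hcov⟩ := hK.elim_nhds_subcover (fun p => Metric.ball p (r p))
    (fun p hp => Metric.ball_mem_nhds p (hr p hp))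
  obtain ⟨η, hη⟩ := SmoothPartitionOfUnity.exists_isSubordinate 𝓘(ℝ, EuclideanSpace ℝ (Fin N))
    hK.isClosed (fun i : t => Metric.ball (i : EuclideanSpace ℝ (Fin N)) (r i))
    (fun i => Metric.isOpen_ball) (by simpa [iUnion_subtype] using hcov)
  have hηd : ∀ i, ContDiff ℝ 1 (η i) := fun i => ((η i).contMDiff.contDiff).of_le (by simp)
  have hsum : ∀ s : Finset t, ContDiffOn ℝ 1 (fun x => ∑ i ∈ s, η i x * f x) K ∧
      P fun x => ∑ i ∈ s, η i x * f x := by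
    intro s
    classical
    induction s using Finset.induction_on with
    | empty => simpa using ⟨contDiffOn_const, hzero⟩
    | insert i s his ih =>
      simp_rw [Finset.sum_insert his]
      have h1 : ContDiffOn ℝ 1 (fun x => η i x * f x) K := (hηd i).contDiffOn.mul hf
      refine ⟨h1.add ih.1, hadd _ _ h1 ih.1 (hP i (htK i i.2) _ h1 fun x hx => ?_) ih.2⟩
      have : η i x = 0 := by
        by_contra hne
        exact hx (hη i (subset_tsupport _ hne))
      rw [this, zero_mul]
  refine hcongr _ _ (fun x hx => ?_) (hsum Finset.univ).2
  have h1 := η.sum_eq_one hx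
  rw [finsum_eq_sum_of_fintype] at h1
  show ∑ i, η i x * f x = f x
  rw [← Finset.sum_mul, h1, one_mul]

theorem fderivWithin_congr_of_eqOn {K : Set (EuclideanSpace ℝ (Fin N))}
    {f g : EuclideanSpace ℝ (Fin N) → ℝ} (h : EqOn f g K) :
    EqOn (fderivWithin ℝ f K) (fderivWithin ℝ g K) K := fun _ hx => fderivWithin_congr h (h hx)

/-- The Gauss–Green formula. -/
theorem integral_fderivWithin_eq (hN : 1 ≤ N) (hΩ : IsOpen Ω) (hbdd : Bornology.IsBounded Ω)
    (hC2 : HasC2Boundary Ω) (v : EuclideanSpace ℝ (Fin N)) (f : EuclideanSpace ℝ (Fin N) → ℝ)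
    (hf : ContDiffOn ℝ 1 f (closure Ω)) :
    ∫ x in Ω, fderivWithin ℝ f (closure Ω) x v =
      ∫ x in frontier Ω, f x * inner ℝ (outerUnitNormal Ω x) v ∂μHE[N - 1] := by
  refine ContDiffOn.induction_of_local (isCompact_closure_of_isBounded hbdd)
    (P := fun f => ∫ x in Ω, fderivWithin ℝ f (closure Ω) x v =
      ∫ x in frontier Ω, f x * inner ℝ (outerUnitNormal Ω x) v ∂μHE[N - 1])
    (by simp) ?_ ?_ ?_ f hf
  · intro f g hf hg e₁ e₂
    have h1 : ∫ x in Ω, fderivWithin ℝ (fun x => f x + g x) (closure Ω) x v =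
        ∫ x in Ω, (fderivWithin ℝ f (closure Ω) x v + fderivWithin ℝ g (closure Ω) x v) := by
      refine setIntegral_congr_fun hΩ.measurableSet fun x hx => ?_
      have hxK := subset_closure hx
      show fderivWithin ℝ (fun x => f x + g x) (closure Ω) x v = _
      rw [fderivWithin_fun_add (uniqueDiffOn_closure hΩ hC2 x hxK)
        (hf.differentiableOn (by norm_num) x hxK) (hg.differentiableOn (by norm_num) x hxK)]
      rfl
    have hintb : ∀ f : EuclideanSpace ℝ (Fin N) → ℝ, ContDiffOn ℝ 1 f (closure Ω) →
        IntegrableOn (fun x => f x * inner ℝ (outerUnitNormal Ω x) v) (frontier Ω) μHE[N - 1] :=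
      fun f hf => ((hf.continuousOn.mono frontier_subset_closure).mul
        (continuousOn_inner_normal hΩ hC2 v)).integrableOn_frontier hN hΩ hbdd hC2
    simp_rw [add_mul]
    rw [h1, integral_add
      ((continuousOn_fderivWithin_closure_apply hΩ hC2 hf v).integrableOn_of_closure hbdd)
      ((continuousOn_fderivWithin_closure_apply hΩ hC2 hg v).integrableOn_of_closure hbdd),
      integral_add (hintb f hf) (hintb g hg), e₁, e₂]
  · intro f g hfg e
    have h1 : ∫ x in Ω, fderivWithin ℝ f (closure Ω) x v =
        ∫ x in Ω, fderivWithin ℝ g (closure Ω) x v :=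
      setIntegral_congr_fun hΩ.measurableSet fun x hx => by
        simp only [fderivWithin_congr_of_eqOn hfg (subset_closure hx)]
    have h2 : ∫ x in frontier Ω, f x * inner ℝ (outerUnitNormal Ω x) v ∂μHE[N - 1] =
        ∫ x in frontier Ω, g x * inner ℝ (outerUnitNormal Ω x) v ∂μHE[N - 1] :=
      setIntegral_congr_fun isClosed_frontier.measurableSet fun x hx => by
        simp only [hfg (frontier_subset_closure hx)]
    rw [← h1, ← h2, e]
  · exact fun p hp => exists_integral_fderivWithin_eq hN hΩ hbdd hC2 v hp

end GaussGreenGlobal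

/-! ### Averages along segments -/

section Steklov

variable {N : ℕ} {Ω : Set (EuclideanSpace ℝ (Fin N))} {p : EuclideanSpace ℝ (Fin N)}

/-- The average of `G` over the segment from `x` to `x + h • a`. -/
noncomputable def steklovAverage (G : EuclideanSpace ℝ (Fin N) → ℝ) (a : EuclideanSpace ℝ (Fin N))
    (h : ℝ) (x : EuclideanSpace ℝ (Fin N)) : ℝ :=
  h⁻¹ * ∫ s in (0 : ℝ)..h, G (x + s • a)

variable {G : EuclideanSpace ℝ (Fin N) → ℝ} {a : EuclideanSpace ℝ (Fin N)} {h : ℝ}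

theorem continuous_steklovAverage (hG : Continuous G) : Continuous (steklovAverage G a h) := by
  unfold steklovAverage
  refine continuous_const.mul ?_
  exact intervalIntegral.continuous_parametric_intervalIntegral_of_continuous'
    (f := fun x s => G (x + s • a)) (by fun_prop) 0 h

/-- Averaging a merely continuous function along `a` gains a derivative in that direction: on the
line it is an integral with moving endpoints. -/
theorem hasLineDerivAt_steklovAverage (hG : Continuous G) (x : EuclideanSpace ℝ (Fin N)) :
    HasLineDerivAt ℝ (steklovAverage G a h) (h⁻¹ * (G (x + h • a) - G x)) x a := by
  set φ : ℝ → ℝ := fun s => G (x + s • a) with hφ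
  have hφc : Continuous φ := by fun_prop
  have h1 : ∀ t : ℝ, steklovAverage G a h (x + t • a) =
      h⁻¹ * ((∫ s in (0 : ℝ)..(t + h), φ s) - ∫ s in (0 : ℝ)..t, φ s) := by
    intro t
    rw [intervalIntegral.integral_interval_sub_left (hφc.intervalIntegrable _ _)
      (hφc.intervalIntegrable _ _)]
    unfold steklovAverage
    congr 1
    have h2 : ∀ s : ℝ, G (x + t • a + s • a) = φ (t + s) := fun s => by
      simp only [hφ]; congr 1; module
    simp_rw [h2]
    rw [intervalIntegral.integral_comp_add_left (fun s => φ s), add_zero]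
  have h3 : ∀ t : ℝ, HasDerivAt (fun t => ∫ s in (0 : ℝ)..t, φ s) (φ t) t := fun t =>
    (hφc.integral_hasStrictDerivAt 0 t).hasDerivAt
  have h4 : HasDerivAt (fun t : ℝ => ∫ s in (0 : ℝ)..(t + h), φ s) (φ (0 + h)) 0 :=
    (h3 (0 + h)).comp_add_const 0 h
  have h5 := (h4.sub (h3 0)).const_mul h⁻¹
  have h6 : φ (0 + h) - φ 0 = G (x + h • a) - G x := by simp [hφ]
  rw [h6] at h5
  refine h5.congr_of_eventuallyEq (Eventually.of_forall fun t => h1 t)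

theorem abs_steklovAverage_le {M : ℝ} (hM : ∀ x, |G x| ≤ M) (hh : 0 < h)
    (x : EuclideanSpace ℝ (Fin N)) : |steklovAverage G a h x| ≤ M := by
  have h1 := intervalIntegral.norm_integral_le_of_norm_le_const (a := 0) (b := h)
    (f := fun s : ℝ => G (x + s • a)) (fun s _ => hM _)
  rw [sub_zero, abs_of_pos hh, Real.norm_eq_abs] at h1
  unfold steklovAverage
  rw [abs_mul, abs_of_pos (inv_pos.2 hh)]
  calc h⁻¹ * |∫ s in (0 : ℝ)..h, G (x + s • a)| ≤ h⁻¹ * (M * h) := by gcongr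
    _ = M := by field_simp

theorem tendsto_steklovAverage (hG : Continuous G) (x : EuclideanSpace ℝ (Fin N)) :
    Tendsto (fun h => steklovAverage G a h x) (𝓝[>] 0) (𝓝 (G x)) := by
  have hφc : Continuous fun s : ℝ => G (x + s • a) := by fun_prop
  have h1 := (hφc.integral_hasStrictDerivAt 0 0).hasDerivAt
  have h2 := (hasDerivAt_iff_tendsto_slope_zero.1 h1).mono_left
    (nhdsWithin_mono 0 (fun s (hs : s ∈ Ioi (0 : ℝ)) => ne_of_gt hs) : 𝓝[>] (0 : ℝ) ≤ 𝓝[≠] 0)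
  simpa [steklovAverage] using h2

/-- The average of `∂ₐg` is a difference quotient of `g`, so it is as smooth as `g` in every
direction, not only along `a`. -/
theorem steklovAverage_fderivWithin (hΩ : IsOpen Ω) {g : EuclideanSpace ℝ (Fin N) → ℝ}
    (hg : ContDiffOn ℝ 1 g (closure Ω)) (hG : Continuous G)
    (hGg : EqOn G (fun x => fderivWithin ℝ g (closure Ω) x a) (closure Ω))
    (hh : 0 < h) {x : EuclideanSpace ℝ (Fin N)} (hx : x ∈ closure Ω)
    (hseg : ∀ s ∈ Ioc 0 h, x + s • a ∈ Ω) :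
    steklovAverage G a h x = h⁻¹ * (g (x + h • a) - g x) := by
  unfold steklovAverage
  congr 1
  have hline : Continuous fun s : ℝ => x + s • a := by fun_prop
  have := intervalIntegral.integral_eq_sub_of_hasDerivAt_of_le (f := fun s : ℝ => g (x + s • a))
    (f' := fun s => G (x + s • a)) hh.le (hg.continuousOn.comp hline.continuousOn (fun s hs => by
      rcases eq_or_lt_of_le hs.1 with rfl | h0
      · simpa using hx
      · exact subset_closure (hseg s ⟨h0, hs.2⟩))) (fun s hs => by
      have hs' := hseg s ⟨hs.1, hs.2.le⟩
      rw [hGg (subset_closure hs')]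
      have h1 := hasFDerivAt_of_contDiffOn_closure hΩ (by norm_num) hg hs'
      have h2 : HasDerivAt (fun s : ℝ => x + s • a) a s := by
        simpa using ((hasDerivAt_id s).smul_const a).const_add x
      exact h1.comp_hasDerivAt s h2)
    ((hG.comp hline).intervalIntegrable _ _)
  simpa using this

/-- Tietze extension. Averages over segments that leave the closure then make sense, and the uniform
bound supplies the majorants for dominated convergence. -/
theorem exists_bounded_continuous_extension {K : Set (EuclideanSpace ℝ (Fin N))} (hK : IsCompact K)
    {f : EuclideanSpace ℝ (Fin N) → ℝ} (hf : ContinuousOn f K) :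
    ∃ G : EuclideanSpace ℝ (Fin N) → ℝ, Continuous G ∧ EqOn G f K ∧ ∃ M, ∀ x, |G x| ≤ M := by
  have : CompactSpace K := isCompact_iff_compactSpace.1 hK
  obtain ⟨g, -, hg⟩ := BoundedContinuousFunction.exists_norm_eq_domRestrict_eq_of_closed
    (BoundedContinuousFunction.mkOfCompact ⟨K.domRestrict f, hf.domRestrict⟩) hK.isClosed
  refine ⟨g, g.continuous, fun x hx => ?_, ‖g‖, fun x => g.norm_coe_le_norm x⟩
  exact congrArg (fun F => F ⟨x, hx⟩) hg

theorem exists_inward_of_mem_closure (hΩ : IsOpen Ω) (hC2 : HasC2Boundary Ω) (hp : p ∈ closure Ω)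
    (ha : p ∈ frontier Ω → inner ℝ (outerUnitNormal Ω p) a < 0) :
    ∃ r > 0, ∃ h > (0 : ℝ), ∀ x ∈ closure Ω, x ∈ Metric.ball p r →
      ∀ s ∈ Ioc 0 h, x + s • a ∈ Ω := by
  by_cases hpΩ : p ∈ Ω
  · obtain ⟨r, hr, hsub⟩ := Metric.isOpen_iff.1 hΩ p hpΩ
    refine ⟨r / 2, half_pos hr, r / 2 / (‖a‖ + 1), by positivity, fun x _ hx s hs => hsub ?_⟩
    rw [Metric.mem_ball, dist_eq_norm] at hx ⊢
    have h1 : ‖s • a‖ ≤ r / 2 := by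
      rw [norm_smul, Real.norm_eq_abs, abs_of_pos hs.1]
      have h2 : r / 2 / (‖a‖ + 1) * (‖a‖ + 1) = r / 2 := by field_simp
      nlinarith [norm_nonneg a, hs.2, hs.1]
    calc ‖x + s • a - p‖ = ‖(x - p) + s • a‖ := by congr 1; abel
      _ ≤ ‖x - p‖ + ‖s • a‖ := norm_add_le _ _
      _ < r := by linarith
  · have hpf : p ∈ frontier Ω := hΩ.frontier_eq ▸ ⟨hp, hpΩ⟩
    exact exists_inward hΩ hC2 hpf (ha hpf)

end Steklov

/-! ### The boundary formula for the integral of `df ∧ dg` -/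

section CurlFormula

variable {N : ℕ} {Ω : Set (EuclideanSpace ℝ (Fin N))} {p : EuclideanSpace ℝ (Fin N)}

/-- For smooth `g` one would integrate `∂ₐ(f ∂_b g) - ∂_b(f ∂ₐg)`, where the second derivatives of
`g` cancel. Here `∂ₐg` and `∂_b g` are replaced by their averages over segments of length parameter
`h` along the inward vector `a`. The derivative along `a` of the averaged `∂_b g` and the derivative
along `b` of the averaged `∂ₐg` are the same difference quotient of `∂_b g`, so the cancellation
survives; then `h` tends to `0`. -/
theorem exists_curl_formula_of_inward (hN : 1 ≤ N) (hΩ : IsOpen Ω) (hbdd : Bornology.IsBounded Ω)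
    (hC2 : HasC2Boundary Ω) (hp : p ∈ closure Ω) {a : EuclideanSpace ℝ (Fin N)}
    (ha : p ∈ frontier Ω → inner ℝ (outerUnitNormal Ω p) a < 0) (b : EuclideanSpace ℝ (Fin N)) :
    ∃ r > 0, ∀ f g : EuclideanSpace ℝ (Fin N) → ℝ, ContDiffOn ℝ 1 f (closure Ω) →
      ContDiffOn ℝ 1 g (closure Ω) → (∀ x ∉ Metric.ball p r, f x = 0) →
      ∫ x in Ω, (fderivWithin ℝ f (closure Ω) x a * fderivWithin ℝ g (closure Ω) x b -
          fderivWithin ℝ f (closure Ω) x b * fderivWithin ℝ g (closure Ω) x a) =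
        ∫ x in frontier Ω, f x * (fderivWithin ℝ g (closure Ω) x b * inner ℝ (outerUnitNormal Ω x) a -
          fderivWithin ℝ g (closure Ω) x a * inner ℝ (outerUnitNormal Ω x) b) ∂μHE[N - 1] := by
  obtain ⟨r₁, hr₁, h₀, hh₀, hin⟩ := exists_inward_of_mem_closure hΩ hC2 hp ha
  obtain ⟨r₂, hr₂, hGG⟩ := exists_gaussGreen_of_transverse hN hΩ hC2 hp (v := -a) (fun hpf => by
    rw [inner_neg_right]; linarith [ha hpf])
  have hK := isCompact_closure_of_isBounded hbdd
  -- Halving `r₁` makes `f` vanish in a neighbourhood of each point outside the ball of radius `r₁`,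
  -- so its derivative vanishes at the points of `Ω` there and products with `f` are trivially
  -- smooth where shifted points may leave `Ω`.
  refine ⟨min (r₁ / 2) r₂, lt_min (half_pos hr₁) hr₂, fun f g hf hg hf0 => ?_⟩
  set Df := fderivWithin ℝ f (closure Ω) with hDf
  set Dg := fderivWithin ℝ g (closure Ω) with hDg
  have hDfc := fun v => continuousOn_fderivWithin_closure_apply hΩ hC2 hf v
  have hDgc := fun v => continuousOn_fderivWithin_closure_apply hΩ hC2 hg v
  obtain ⟨Ga, hGa, hGag, Ma, hMa⟩ := exists_bounded_continuous_extension hK (hDgc a)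
  obtain ⟨Gb, hGb, hGbg, Mb, hMb⟩ := exists_bounded_continuous_extension hK (hDgc b)
  have hfar : ∀ x ∉ Metric.ball p r₁, f =ᶠ[𝓝 x] fun _ => 0 := by
    intro x hx
    have hx' : x ∈ (Metric.closedBall p (r₁ / 2))ᶜ := fun hb =>
      hx (Metric.closedBall_subset_ball (by linarith) hb)
    filter_upwards [Metric.isClosed_closedBall.isOpen_compl.mem_nhds hx'] with y hy
    exact hf0 y fun hb => hy (Metric.ball_subset_closedBall
      (Metric.ball_subset_ball (min_le_left _ _) hb))
  have hfar0 : ∀ x ∉ Metric.ball p r₁, f x = 0 := fun x hx => (hfar x hx).self_of_nhds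
  have hfarD : ∀ x ∈ Ω, x ∉ Metric.ball p r₁ → Df x = 0 := by
    intro x hxΩ hx
    have h1 := hasFDerivAt_of_contDiffOn_closure hΩ (by norm_num) hf hxΩ
    exact h1.unique ((hasFDerivAt_const (0 : ℝ) x).congr_of_eventuallyEq (hfar x hx))
  have hfc := hf.continuousOn
  have key : ∀ h ∈ Ioc 0 h₀,
      ∫ x in Ω, (Df x a * steklovAverage Gb a h x - Df x b * steklovAverage Ga a h x) =
        ∫ x in frontier Ω, f x * (steklovAverage Gb a h x * inner ℝ (outerUnitNormal Ω x) a -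
          steklovAverage Ga a h x * inner ℝ (outerUnitNormal Ω x) b) ∂μHE[N - 1] := by
    intro h hh
    have hAa := continuous_steklovAverage (a := a) (h := h) hGa
    have hAb := continuous_steklovAverage (a := a) (h := h) hGb
    have hshift : Continuous fun x : EuclideanSpace ℝ (Fin N) => Gb (x + h • a) := by fun_prop
    -- the formula in the direction `a`
    have e₁ := hGG (fun x => f x * steklovAverage Gb a h x)
      (fun x => -(Df x a * steklovAverage Gb a h x + f x * (h⁻¹ * (Gb (x + h • a) - Gb x))))
      (hfc.mul hAb.continuousOn)
      (fun x hx => by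
        rw [hf0 x fun hb => hx (Metric.ball_subset_ball (min_le_right _ _) hb), zero_mul])
      (fun x hx => by
        have h1 := (hasFDerivAt_of_contDiffOn_closure hΩ (by norm_num) hf hx).hasLineDerivAt a
        have h2 : HasLineDerivAt ℝ (fun x => f x * steklovAverage Gb a h x)
            (Df x a * steklovAverage Gb a h x + f x * (h⁻¹ * (Gb (x + h • a) - Gb x))) x a := by
          have h3 := HasDerivAt.mul h1 (hasLineDerivAt_steklovAverage (a := a) (h := h) hGb x)
          simp only [zero_smul, add_zero] at h3
          exact h3
        simpa using h2.smul (-1))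
      (((((hDfc a).mul hAb.continuousOn).add (hfc.mul (continuous_const.mul
        (hshift.sub hGb)).continuousOn)).neg).integrableOn_of_closure hbdd)
    -- the formula in the direction `b`
    set F₂ : EuclideanSpace ℝ (Fin N) → ℝ := fun x => f x * (h⁻¹ * (g (x + h • a) - g x)) with hF₂
    have hF₂d : ContDiffOn ℝ 1 F₂ (closure Ω) := by
      intro x hx
      by_cases hxb : x ∈ Metric.ball p r₁
      · have h1 : ContDiffWithinAt ℝ 1 (fun x => g (x + h • a)) (closure Ω) x := by
          have h2 := hin x hx hxb h ⟨hh.1, hh.2⟩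
          have h3 : ContDiffAt ℝ 1 g (x + h • a) :=
            (hg _ (subset_closure h2)).contDiffAt (mem_of_superset (hΩ.mem_nhds h2) subset_closure)
          exact (h3.comp x (by fun_prop)).contDiffWithinAt
        exact (hf x hx).mul (contDiffWithinAt_const.mul (h1.sub (hg x hx)))
      · refine ((contDiffAt_const (c := (0 : ℝ))).congr_of_eventuallyEq ?_).contDiffWithinAt
        filter_upwards [hfar x hxb] with y hy
        simp [hF₂, hy]
    have e₂ := integral_fderivWithin_eq hN hΩ hbdd hC2 b F₂ hF₂d
    have hAeq : ∀ x ∈ closure Ω, x ∈ Metric.ball p r₁ →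
        steklovAverage Ga a h x = h⁻¹ * (g (x + h • a) - g x) := fun x hx hxb =>
      steklovAverage_fderivWithin hΩ hg hGa hGag hh.1 hx
        (fun s hs => hin x hx hxb s ⟨hs.1, hs.2.trans hh.2⟩)
    have hD₂ : ∀ x ∈ Ω, fderivWithin ℝ F₂ (closure Ω) x b =
        Df x b * steklovAverage Ga a h x + f x * (h⁻¹ * (Gb (x + h • a) - Gb x)) := by
      intro x hx
      have h0 := hasFDerivAt_of_contDiffOn_closure hΩ (by norm_num) hF₂d hx
      by_cases hxb : x ∈ Metric.ball p r₁
      · have h2 := hin x (subset_closure hx) hxb h ⟨hh.1, hh.2⟩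
        have h3 : HasFDerivAt (fun x => g (x + h • a)) (Dg (x + h • a)) x := by
          have := hasFDerivAt_of_contDiffOn_closure hΩ (by norm_num) hg h2
          exact (hasFDerivAt_comp_add_right (h • a)).2 this
        have h4 : HasFDerivAt F₂ _ x := (hasFDerivAt_of_contDiffOn_closure hΩ (by norm_num) hf hx).mul
          ((h3.sub (hasFDerivAt_of_contDiffOn_closure hΩ (by norm_num) hg hx)).const_mul h⁻¹)
        have h5 := h0.unique h4
        rw [h5, hAeq x (subset_closure hx) hxb, hGbg (subset_closure hx),
          hGbg (subset_closure h2)]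
        simp
        ring
      · have h4 : HasFDerivAt F₂ (0 : EuclideanSpace ℝ (Fin N) →L[ℝ] ℝ) x := by
          refine (hasFDerivAt_const (0 : ℝ) x).congr_of_eventuallyEq ?_
          filter_upwards [hfar x hxb] with y hy
          simp [hF₂, hy]
        rw [h0.unique h4, hfarD x hx hxb, hfar0 x hxb]
        simp
    have hB₂ : ∀ x ∈ frontier Ω, F₂ x = f x * steklovAverage Ga a h x := by
      intro x hx
      by_cases hxb : x ∈ Metric.ball p r₁
      · rw [hAeq x (frontier_subset_closure hx) hxb]
      · simp [hF₂, hfar0 x hxb]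
    rw [setIntegral_congr_fun hΩ.measurableSet hD₂,
      setIntegral_congr_fun (g := fun x => f x * steklovAverage Ga a h x *
        inner ℝ (outerUnitNormal Ω x) b) isClosed_frontier.measurableSet
        (fun x hx => by simp only [hB₂ x hx])] at e₂
    rw [integral_neg] at e₁
    simp_rw [inner_neg_right, mul_neg] at e₁
    rw [integral_neg, neg_inj] at e₁
    have i₁ := (((hDfc a).mul hAb.continuousOn).add (hfc.mul (continuous_const (y := h⁻¹).mul
        (hshift.sub hGb)).continuousOn)).integrableOn_of_closure hbdd
    have i₂ := (((hDfc b).mul hAa.continuousOn).add (hfc.mul (continuous_const (y := h⁻¹).mul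
        (hshift.sub hGb)).continuousOn)).integrableOn_of_closure hbdd
    have j₁ := (((hfc.mono frontier_subset_closure).mul hAb.continuousOn).mul
      (continuousOn_inner_normal hΩ hC2 a)).integrableOn_frontier hN hΩ hbdd hC2
    have j₂ := (((hfc.mono frontier_subset_closure).mul hAa.continuousOn).mul
      (continuousOn_inner_normal hΩ hC2 b)).integrableOn_frontier hN hΩ hbdd hC2
    have e₃ := integral_sub i₁ i₂
    have e₄ := integral_sub j₁ j₂
    -- On subtracting the two formulas, the terms `f x * (h⁻¹ * (Gb (x + h • a) - Gb x))` cancel.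
    rw [show (∫ x in Ω, (Df x a * steklovAverage Gb a h x - Df x b * steklovAverage Ga a h x)) =
      _ from (integral_congr_ae (Eventually.of_forall fun x => by simp; ring)).trans e₃]
    rw [show (∫ x in frontier Ω, f x * (steklovAverage Gb a h x * inner ℝ (outerUnitNormal Ω x) a -
          steklovAverage Ga a h x * inner ℝ (outerUnitNormal Ω x) b) ∂μHE[N - 1]) =
      _ from (integral_congr_ae (Eventually.of_forall fun x => by simp; ring)).trans e₄]
    exact congrArg₂ (· - ·) e₁ e₂
  have hIoc : ∀ᶠ h in 𝓝[>] (0 : ℝ), h ∈ Ioc 0 h₀ := Ioc_mem_nhdsGT hh₀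
  have hfin : ∀ x, |Df x a * Gb x - Df x b * Ga x| ≤ |Df x a| * Mb + |Df x b| * Ma := by
    intro x
    refine (abs_sub _ _).trans ?_
    rw [abs_mul, abs_mul]
    gcongr
    exacts [hMb x, hMa x]
  have t₁ : Tendsto (fun h => ∫ x in Ω, (Df x a * steklovAverage Gb a h x -
      Df x b * steklovAverage Ga a h x)) (𝓝[>] 0) (𝓝 (∫ x in Ω, (Df x a * Gb x - Df x b * Ga x))) := by
    refine tendsto_integral_filter_of_dominated_convergence
      (fun x => |Df x a| * Mb + |Df x b| * Ma) ?_ ?_ ?_ ?_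
    · refine Eventually.of_forall fun h => ?_
      exact (((hDfc a).mul (continuous_steklovAverage hGb).continuousOn).sub
        ((hDfc b).mul (continuous_steklovAverage hGa).continuousOn)).integrableOn_of_closure
          hbdd |>.aestronglyMeasurable
    · filter_upwards [hIoc] with h hh
      refine Eventually.of_forall fun x => ?_
      rw [Real.norm_eq_abs]
      refine (abs_sub _ _).trans ?_
      rw [abs_mul, abs_mul]
      gcongr
      exacts [abs_steklovAverage_le hMb hh.1 x, abs_steklovAverage_le hMa hh.1 x]
    · exact (((hDfc a).abs.mul continuousOn_const).add
        ((hDfc b).abs.mul continuousOn_const)).integrableOn_of_closure hbdd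
    · refine Eventually.of_forall fun x => ?_
      exact ((tendsto_steklovAverage hGb x).const_mul _).sub
        ((tendsto_steklovAverage hGa x).const_mul _)
  have t₂ : Tendsto (fun h => ∫ x in frontier Ω, f x * (steklovAverage Gb a h x *
      inner ℝ (outerUnitNormal Ω x) a - steklovAverage Ga a h x *
        inner ℝ (outerUnitNormal Ω x) b) ∂μHE[N - 1]) (𝓝[>] 0)
      (𝓝 (∫ x in frontier Ω, f x * (Gb x * inner ℝ (outerUnitNormal Ω x) a - Ga x *
        inner ℝ (outerUnitNormal Ω x) b) ∂μHE[N - 1])) := by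
    have hna := continuousOn_inner_normal hΩ hC2 a
    have hnb := continuousOn_inner_normal hΩ hC2 b
    have hfb := hfc.mono frontier_subset_closure
    refine tendsto_integral_filter_of_dominated_convergence
      (fun x => |f x| * (Mb * |inner ℝ (outerUnitNormal Ω x) a| +
        Ma * |inner ℝ (outerUnitNormal Ω x) b|)) ?_ ?_ ?_ ?_
    · refine Eventually.of_forall fun h => ?_
      exact (hfb.mul (((continuous_steklovAverage hGb).continuousOn.mul hna).sub
        ((continuous_steklovAverage hGa).continuousOn.mul hnb))).integrableOn_frontier hN hΩ hbdd hC2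
          |>.aestronglyMeasurable
    · filter_upwards [hIoc] with h hh
      refine Eventually.of_forall fun x => ?_
      rw [Real.norm_eq_abs, abs_mul]
      gcongr
      refine (abs_sub _ _).trans ?_
      rw [abs_mul, abs_mul]
      gcongr
      exacts [abs_steklovAverage_le hMb hh.1 x, abs_steklovAverage_le hMa hh.1 x]
    · exact (hfb.abs.mul ((continuousOn_const.mul hna.abs).add
        (continuousOn_const.mul hnb.abs))).integrableOn_frontier hN hΩ hbdd hC2
    · refine Eventually.of_forall fun x => ?_
      exact (((tendsto_steklovAverage hGb x).mul_const _).sub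
        ((tendsto_steklovAverage hGa x).mul_const _)).const_mul _
  have e := tendsto_nhds_unique (t₁.congr' (hIoc.mono fun h hh => key h hh)) t₂
  rw [setIntegral_congr_fun (g := fun x => Df x a * Gb x - Df x b * Ga x) hΩ.measurableSet
    (fun x hx => by simp only [hDg, hGbg (subset_closure hx), hGag (subset_closure hx)]), e]
  exact setIntegral_congr_fun isClosed_frontier.measurableSet
    (fun x hx => by
      simp only [hDg, hGbg (frontier_subset_closure hx), hGag (frontier_subset_closure hx)])

end CurlFormula

section CurlFormulaGlobal

variable {N : ℕ} {Ω : Set (EuclideanSpace ℝ (Fin N))} {p : EuclideanSpace ℝ (Fin N)}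

theorem integrableOn_curl (hΩ : IsOpen Ω) (hbdd : Bornology.IsBounded Ω) (hC2 : HasC2Boundary Ω)
    {f g : EuclideanSpace ℝ (Fin N) → ℝ} (hf : ContDiffOn ℝ 1 f (closure Ω))
    (hg : ContDiffOn ℝ 1 g (closure Ω)) (a b : EuclideanSpace ℝ (Fin N)) :
    IntegrableOn (fun x => fderivWithin ℝ f (closure Ω) x a * fderivWithin ℝ g (closure Ω) x b -
      fderivWithin ℝ f (closure Ω) x b * fderivWithin ℝ g (closure Ω) x a) Ω :=
  (((continuousOn_fderivWithin_closure_apply hΩ hC2 hf a).mul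
    (continuousOn_fderivWithin_closure_apply hΩ hC2 hg b)).sub
    ((continuousOn_fderivWithin_closure_apply hΩ hC2 hf b).mul
    (continuousOn_fderivWithin_closure_apply hΩ hC2 hg a))).integrableOn_of_closure hbdd

theorem integrableOn_curl_frontier (hN : 1 ≤ N) (hΩ : IsOpen Ω) (hbdd : Bornology.IsBounded Ω)
    (hC2 : HasC2Boundary Ω)
    {f g : EuclideanSpace ℝ (Fin N) → ℝ} (hf : ContDiffOn ℝ 1 f (closure Ω))
    (hg : ContDiffOn ℝ 1 g (closure Ω)) (a b : EuclideanSpace ℝ (Fin N)) :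
    IntegrableOn (fun x => f x *
      (fderivWithin ℝ g (closure Ω) x b * inner ℝ (outerUnitNormal Ω x) a -
        fderivWithin ℝ g (closure Ω) x a * inner ℝ (outerUnitNormal Ω x) b))
      (frontier Ω) μHE[N - 1] :=
  ((hf.continuousOn.mono frontier_subset_closure).mul
    ((((continuousOn_fderivWithin_closure_apply hΩ hC2 hg b).mono frontier_subset_closure).mul
      (continuousOn_inner_normal hΩ hC2 a)).sub
    (((continuousOn_fderivWithin_closure_apply hΩ hC2 hg a).mono frontier_subset_closure).mul
      (continuousOn_inner_normal hΩ hC2 b)))).integrableOn_frontier hN hΩ hbdd hC2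

/-- Both sides are linear in `a`, and `a` is the difference of the inward vectors `a - M n` and `-M
n`. -/
theorem exists_curl_formula (hN : 1 ≤ N) (hΩ : IsOpen Ω) (hbdd : Bornology.IsBounded Ω)
    (hC2 : HasC2Boundary Ω) (hp : p ∈ closure Ω) (a b : EuclideanSpace ℝ (Fin N)) :
    ∃ r > 0, ∀ f g : EuclideanSpace ℝ (Fin N) → ℝ, ContDiffOn ℝ 1 f (closure Ω) →
      ContDiffOn ℝ 1 g (closure Ω) → (∀ x ∉ Metric.ball p r, f x = 0) →
      ∫ x in Ω, (fderivWithin ℝ f (closure Ω) x a * fderivWithin ℝ g (closure Ω) x b -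
          fderivWithin ℝ f (closure Ω) x b * fderivWithin ℝ g (closure Ω) x a) =
        ∫ x in frontier Ω, f x * (fderivWithin ℝ g (closure Ω) x b * inner ℝ (outerUnitNormal Ω x) a -
          fderivWithin ℝ g (closure Ω) x a * inner ℝ (outerUnitNormal Ω x) b) ∂μHE[N - 1] := by
  set n := outerUnitNormal Ω p with hn
  set M := |inner ℝ n a| + 1 with hM
  have hM0 : 0 < M := by positivity
  have hnn : p ∈ frontier Ω → inner ℝ n n = (1 : ℝ) := fun hpf => by
    rw [real_inner_self_eq_norm_sq, norm_outerUnitNormal hC2 hpf]; norm_num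
  obtain ⟨r₁, hr₁, h₁⟩ := exists_curl_formula_of_inward hN hΩ hbdd hC2 hp (a := a + (-M) • n)
    (fun hpf => by
      rw [← hn, inner_add_right, inner_smul_right, hnn hpf]
      linarith [le_abs_self (inner ℝ n a)]) b
  obtain ⟨r₂, hr₂, h₂⟩ := exists_curl_formula_of_inward hN hΩ hbdd hC2 hp (a := (-M) • n)
    (fun hpf => by
      rw [← hn, inner_smul_right, hnn hpf]
      linarith) b
  refine ⟨min r₁ r₂, lt_min hr₁ hr₂, fun f g hf hg hf0 => ?_⟩
  have e₁ := h₁ f g hf hg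
    (fun x hx => hf0 x fun hb => hx (Metric.ball_subset_ball (min_le_left _ _) hb))
  have e₂ := h₂ f g hf hg
    (fun x hx => hf0 x fun hb => hx (Metric.ball_subset_ball (min_le_right _ _) hb))
  have e₃ := congrArg₂ (· - ·) e₁ e₂
  simp only at e₃
  rw [← integral_sub (integrableOn_curl hΩ hbdd hC2 hf hg _ _)
      (integrableOn_curl hΩ hbdd hC2 hf hg _ _),
    ← integral_sub (integrableOn_curl_frontier hN hΩ hbdd hC2 hf hg _ _)
      (integrableOn_curl_frontier hN hΩ hbdd hC2 hf hg _ _)] at e₃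
  simp only [map_add, inner_add_right] at e₃
  convert e₃ using 3 <;> ring

/-- The integral of `df ∧ dg` over `Ω` in terms of boundary values. -/
theorem curl_formula (hN : 1 ≤ N) (hΩ : IsOpen Ω) (hbdd : Bornology.IsBounded Ω)
    (hC2 : HasC2Boundary Ω) (a b : EuclideanSpace ℝ (Fin N))
    {f g : EuclideanSpace ℝ (Fin N) → ℝ} (hf : ContDiffOn ℝ 1 f (closure Ω))
    (hg : ContDiffOn ℝ 1 g (closure Ω)) :
    ∫ x in Ω, (fderivWithin ℝ f (closure Ω) x a * fderivWithin ℝ g (closure Ω) x b -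
        fderivWithin ℝ f (closure Ω) x b * fderivWithin ℝ g (closure Ω) x a) =
      ∫ x in frontier Ω, f x * (fderivWithin ℝ g (closure Ω) x b * inner ℝ (outerUnitNormal Ω x) a -
        fderivWithin ℝ g (closure Ω) x a * inner ℝ (outerUnitNormal Ω x) b) ∂μHE[N - 1] := by
  refine ContDiffOn.induction_of_local (isCompact_closure_of_isBounded hbdd)
    (P := fun f => ∫ x in Ω, (fderivWithin ℝ f (closure Ω) x a * fderivWithin ℝ g (closure Ω) x b -
        fderivWithin ℝ f (closure Ω) x b * fderivWithin ℝ g (closure Ω) x a) =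
      ∫ x in frontier Ω, f x * (fderivWithin ℝ g (closure Ω) x b * inner ℝ (outerUnitNormal Ω x) a -
        fderivWithin ℝ g (closure Ω) x a * inner ℝ (outerUnitNormal Ω x) b) ∂μHE[N - 1])
    (by simp) ?_ ?_ ?_ f hf
  · intro f₁ f₂ hf₁ hf₂ e₁ e₂
    have e₃ := congrArg₂ (· + ·) e₁ e₂
    simp only at e₃
    rw [← integral_add (integrableOn_curl hΩ hbdd hC2 hf₁ hg _ _)
        (integrableOn_curl hΩ hbdd hC2 hf₂ hg _ _),
      ← integral_add (integrableOn_curl_frontier hN hΩ hbdd hC2 hf₁ hg _ _)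
        (integrableOn_curl_frontier hN hΩ hbdd hC2 hf₂ hg _ _)] at e₃
    refine Eq.trans (setIntegral_congr_fun hΩ.measurableSet fun x hx => ?_) (e₃.trans
      (setIntegral_congr_fun isClosed_frontier.measurableSet fun x hx => ?_))
    · have hxK := subset_closure hx
      simp only [fderivWithin_fun_add (uniqueDiffOn_closure hΩ hC2 x hxK)
        (hf₁.differentiableOn (by norm_num) x hxK) (hf₂.differentiableOn (by norm_num) x hxK),
        add_apply]
      ring
    · simp only
      ring
  · intro f₁ f₂ hff e
    refine Eq.trans (setIntegral_congr_fun hΩ.measurableSet fun x hx => ?_) (e.trans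
      (setIntegral_congr_fun isClosed_frontier.measurableSet fun x hx => ?_))
    · simp only [fderivWithin_congr_of_eqOn hff (subset_closure hx)]
    · simp only [hff (frontier_subset_closure hx)]
  · intro p hp
    obtain ⟨r, hr, h⟩ := exists_curl_formula hN hΩ hbdd hC2 hp a b
    exact ⟨r, hr, fun f hf hf0 => h f g hf hg hf0⟩

end CurlFormulaGlobal

/-! ### Curvature through a global extension of the normal -/

section Curvature

variable {N : ℕ} {Ω : Set (EuclideanSpace ℝ (Fin N))} {p : EuclideanSpace ℝ (Fin N)}

theorem mem_boundaryTangentSpace {t : EuclideanSpace ℝ (Fin N)} :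
    t ∈ boundaryTangentSpace Ω p ↔ inner ℝ (outerUnitNormal Ω p) t = 0 :=
  Submodule.mem_orthogonal_singleton_iff_inner_right

/-- The shape operator in terms of an arbitrary extension of the normal. -/
theorem fderiv_normalField_eq (hΩ : IsOpen Ω) (hC2 : HasC2Boundary Ω) (hp : p ∈ frontier Ω)
    {n : EuclideanSpace ℝ (Fin N) → EuclideanSpace ℝ (Fin N)} (hn : ContDiff ℝ 1 n)
    (hnν : ∀ x ∈ frontier Ω, n x = outerUnitNormal Ω x) {t : EuclideanSpace ℝ (Fin N)}
    (ht : t ∈ boundaryTangentSpace Ω p) : fderiv ℝ (normalField Ω p) p t = fderiv ℝ n p t := by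
  obtain ⟨r, h⟩ := exists_isBoundaryChart hΩ hC2 hp
  have hpr := Metric.mem_ball_self h.pos (x := p)
  have h1 : HasFDerivAt (normalField Ω p) (fderiv ℝ (normalField Ω p) p) p :=
    ((h.contDiffAt_normal hpr).differentiableAt (by norm_num)).hasFDerivAt
  have h2 := (hn.differentiable (by norm_num) p).hasFDerivAt
  have h3 := hasFDerivWithinAt_apply_eq_zero_of_tangent hΩ hC2 hp
    (h1.sub h2).hasFDerivWithinAt (by
      filter_upwards [self_mem_nhdsWithin, mem_nhdsWithin_of_mem_nhds (Metric.ball_mem_nhds p h.pos)]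
        with x hx hxb
      rw [Pi.sub_apply, hnν x hx, h.normal_eq x hxb hx]
      exact sub_self _) (mem_boundaryTangentSpace.1 ht)
  exact sub_eq_zero.1 h3

/-- The function `|n|² - 1` vanishes on the boundary, so its tangential derivative `2⟪dn t, ν⟫` is
zero. Off the boundary `n` need not have length one. -/
theorem inner_fderiv_normal_eq_zero (hΩ : IsOpen Ω) (hC2 : HasC2Boundary Ω) (hp : p ∈ frontier Ω)
    {n : EuclideanSpace ℝ (Fin N) → EuclideanSpace ℝ (Fin N)} (hn : ContDiff ℝ 1 n)
    (hnν : ∀ x ∈ frontier Ω, n x = outerUnitNormal Ω x) {t : EuclideanSpace ℝ (Fin N)}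
    (ht : t ∈ boundaryTangentSpace Ω p) :
    inner ℝ (fderiv ℝ n p t) (outerUnitNormal Ω p) = 0 := by
  have h2 := (hn.differentiable (by norm_num) p).hasFDerivAt
  have h3 := hasFDerivWithinAt_apply_eq_zero_of_tangent (f := fun x => inner ℝ (n x) (n x) - (1 : ℝ))
    hΩ hC2 hp ((h2.inner ℝ h2).sub_const 1).hasFDerivWithinAt (by
      filter_upwards [self_mem_nhdsWithin] with x hx
      rw [hnν x hx, real_inner_self_eq_norm_sq, norm_outerUnitNormal hC2 hx]
      norm_num) (mem_boundaryTangentSpace.1 ht)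
  rw [hnν p hp] at h3
  have h4 : inner ℝ (outerUnitNormal Ω p) (fderiv ℝ n p t) +
      inner ℝ (fderiv ℝ n p t) (outerUnitNormal Ω p) = 0 := by
    simpa only [ContinuousLinearMap.comp_apply, ContinuousLinearMap.prod_apply,
      fderivInnerCLM_apply] using h3
  rw [real_inner_comm] at h4
  linarith

theorem shapeOperator_eq (hΩ : IsOpen Ω) (hC2 : HasC2Boundary Ω) (hp : p ∈ frontier Ω)
    {n : EuclideanSpace ℝ (Fin N) → EuclideanSpace ℝ (Fin N)} (hn : ContDiff ℝ 1 n)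
    (hnν : ∀ x ∈ frontier Ω, n x = outerUnitNormal Ω x) :
    shapeOperator Ω p = (boundaryTangentSpace Ω p).orthogonalProjectionOnto.toLinearMap ∘ₗ
      ((fderiv ℝ n p).toLinearMap ∘ₗ (boundaryTangentSpace Ω p).subtype) := by
  ext1 t
  show (boundaryTangentSpace Ω p).orthogonalProjectionOnto (fderiv ℝ (normalField Ω p) p t) =
    (boundaryTangentSpace Ω p).orthogonalProjectionOnto (fderiv ℝ n p t)
  rw [fderiv_normalField_eq hΩ hC2 hp hn hnν t.2]

/-- `N - 1` times the mean curvature is the tangential divergence of the normal. -/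
theorem meanCurvature_eq (hN : 2 ≤ N) (hΩ : IsOpen Ω) (hC2 : HasC2Boundary Ω)
    (hp : p ∈ frontier Ω)
    {n : EuclideanSpace ℝ (Fin N) → EuclideanSpace ℝ (Fin N)} (hn : ContDiff ℝ 1 n)
    (hnν : ∀ x ∈ frontier Ω, n x = outerUnitNormal Ω x) {ι : Type*} [Fintype ι]
    (b : OrthonormalBasis ι ℝ (EuclideanSpace ℝ (Fin N))) :
    ((N : ℝ) - 1) * meanCurvature Ω p = ∑ i, inner ℝ (fderiv ℝ n p (b i)) (b i) -
      inner ℝ (fderiv ℝ n p (outerUnitNormal Ω p)) (outerUnitNormal Ω p) := by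
  have hN' : ((N : ℝ) - 1) ≠ 0 := by
    have : (2 : ℝ) ≤ N := by exact_mod_cast hN
    linarith
  have h1 : ((N : ℝ) - 1) * meanCurvature Ω p =
      LinearMap.trace ℝ (boundaryTangentSpace Ω p) (shapeOperator Ω p) := by
    rw [meanCurvature, ← mul_assoc, mul_one_div_cancel hN', one_mul,
      (shapeOperator_isSymmetric Ω p).trace_eq_sum_eigenvalues rfl]
    simp [principalCurvature]
  -- Cyclicity moves the trace from the tangent hyperplane to the whole space, where it can be
  -- computed in the fixed basis `b`.
  rw [h1, shapeOperator_eq hΩ hC2 hp hn hnν, LinearMap.trace_comp_comm',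
    LinearMap.trace_eq_sum_inner _ b]
  have hνn := norm_outerUnitNormal hC2 hp
  set ν := outerUnitNormal Ω p with hν
  have h2 : ∀ i, (((boundaryTangentSpace Ω p).orthogonalProjectionOnto (b i) :
      boundaryTangentSpace Ω p) : EuclideanSpace ℝ (Fin N)) = b i - (inner ℝ ν (b i) : ℝ) • ν :=
    fun i => coe_projAlong ν hνn (b i)
  have h3 : ∀ i, inner ℝ (b i) ((((fderiv ℝ n p).toLinearMap ∘ₗ
      (boundaryTangentSpace Ω p).subtype) ∘ₗ
        (boundaryTangentSpace Ω p).orthogonalProjectionOnto.toLinearMap) (b i)) =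
      inner ℝ (fderiv ℝ n p (b i)) (b i) -
        inner ℝ (fderiv ℝ n p ν) (b i) * inner ℝ (b i) ν := by
    intro i
    show inner ℝ (b i) (fderiv ℝ n p (((boundaryTangentSpace Ω p).orthogonalProjectionOnto (b i) :
      boundaryTangentSpace Ω p) : EuclideanSpace ℝ (Fin N))) = _
    rw [h2, map_sub, map_smul, inner_sub_right, inner_smul_right, real_inner_comm _ (b i),
      real_inner_comm (fderiv ℝ n p ν) (b i), real_inner_comm (b i) ν]
    ring
  simp_rw [h3]
  rw [Finset.sum_sub_distrib, b.sum_inner_mul_inner]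

theorem LinearMap.IsSymmetric.le_inner_of_le_eigenvalues {T : Type*} [NormedAddCommGroup T]
    [InnerProductSpace ℝ T] [FiniteDimensional ℝ T] {S : T →ₗ[ℝ] T} (hS : S.IsSymmetric) {d : ℕ}
    (hd : Module.finrank ℝ T = d) {c : ℝ} (hc : ∀ i, c ≤ hS.eigenvalues hd i) (w : T) :
    c * ‖w‖ ^ 2 ≤ inner ℝ (S w) w := by
  set b := hS.eigenvectorBasis hd
  have h1 : ∀ i, inner ℝ (S w) (b i) = hS.eigenvalues hd i * inner ℝ w (b i) := by
    intro i
    rw [hS w (b i), hS.apply_eigenvectorBasis hd i, inner_smul_right]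
    rfl
  rw [← b.sum_inner_mul_inner (S w) w, ← real_inner_self_eq_norm_sq, ← b.sum_inner_mul_inner w w,
    Finset.mul_sum]
  refine Finset.sum_le_sum fun i _ => ?_
  rw [h1, real_inner_comm w (b i)]
  nlinarith [hc i, mul_self_nonneg (inner ℝ w (b i) : ℝ),
    mul_nonneg (sub_nonneg.2 (hc i)) (mul_self_nonneg (inner ℝ w (b i) : ℝ))]

theorem neg_le_principalCurvature {β : ℝ} (hp : p ∈ frontier Ω)
    (hκ : 0 ≤ (β : EReal) + minPrincipalCurvature Ω)
    (i : Fin (Module.finrank ℝ (boundaryTangentSpace Ω p))) : -β ≤ principalCurvature Ω p i := by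
  have h1 : minPrincipalCurvature Ω ≤ (principalCurvature Ω p i : EReal) :=
    (iInf₂_le p hp).trans (iInf_le _ i)
  have h2 : (0 : EReal) ≤ ((β + principalCurvature Ω p i : ℝ) : EReal) := by
    rw [EReal.coe_add]
    exact hκ.trans (by gcongr)
  have h3 : 0 ≤ β + principalCurvature Ω p i := by exact_mod_cast h2
  linarith

theorem neg_mul_norm_sq_le_inner_fderiv_normal (hΩ : IsOpen Ω) (hC2 : HasC2Boundary Ω)
    (hp : p ∈ frontier Ω)
    {n : EuclideanSpace ℝ (Fin N) → EuclideanSpace ℝ (Fin N)} (hn : ContDiff ℝ 1 n)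
    (hnν : ∀ x ∈ frontier Ω, n x = outerUnitNormal Ω x) {β : ℝ}
    (hκ : 0 ≤ (β : EReal) + minPrincipalCurvature Ω) {t : EuclideanSpace ℝ (Fin N)}
    (ht : t ∈ boundaryTangentSpace Ω p) : -β * ‖t‖ ^ 2 ≤ inner ℝ (fderiv ℝ n p t) t := by
  have h := (shapeOperator_isSymmetric Ω p).le_inner_of_le_eigenvalues rfl
    (fun i => neg_le_principalCurvature hp hκ i) ⟨t, ht⟩
  rw [shapeOperator_eq hΩ hC2 hp hn hnν] at h
  simpa using h

end Curvature

/-! ### Contractions in an orthonormal basis -/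

section HessianIdentities

variable {ι V : Type*} [Fintype ι] [NormedAddCommGroup V] [InnerProductSpace ℝ V]

theorem OrthonormalBasis.sum_inner_mul_apply (b : OrthonormalBasis ι ℝ V) (L : V →L[ℝ] ℝ) (x : V) :
    ∑ i, inner ℝ x (b i) * L (b i) = L x := by
  conv_rhs => rw [← b.sum_repr' x, map_sum]
  exact Finset.sum_congr rfl fun i _ => by rw [map_smul, smul_eq_mul, real_inner_comm]

theorem OrthonormalBasis.sum_sum_mul_apply (b : OrthonormalBasis ι ℝ V) (H : V →L[ℝ] V →L[ℝ] ℝ)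
    (x y : V) : ∑ i, ∑ j, inner ℝ x (b i) * (inner ℝ y (b j) * H (b i) (b j)) = H x y := by
  simp_rw [← Finset.mul_sum, b.sum_inner_mul_apply]
  exact b.sum_inner_mul_apply (H.flip y) x

theorem OrthonormalBasis.sum_inner_mul_inner' (b : OrthonormalBasis ι ℝ V) (x y : V) :
    ∑ i, inner ℝ x (b i) * inner ℝ y (b i) = inner ℝ x y := by
  rw [← b.sum_inner_mul_inner x y]
  exact Finset.sum_congr rfl fun i _ => by rw [real_inner_comm (b i) y]

/-- The boundary integrand of `∫ ((Δu)² - |D²u|²)` as the divergence of `Δu ∇u - D²u ∇u`. -/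
theorem OrthonormalBasis.sum_sum_hessian_curl (b : OrthonormalBasis ι ℝ V)
    (H : V →L[ℝ] V →L[ℝ] ℝ) (U ν : V) :
    ∑ i, ∑ j, inner ℝ U (b i) * (H (b j) (b j) * inner ℝ ν (b i) -
      H (b i) (b j) * inner ℝ ν (b j)) = (∑ j, H (b j) (b j)) * inner ℝ U ν - H U ν := by
  rw [← b.sum_sum_mul_apply H U ν, ← b.sum_inner_mul_inner' U ν, mul_comm, Finset.sum_mul_sum]
  simp_rw [← Finset.sum_sub_distrib]
  exact Finset.sum_congr rfl fun i _ => Finset.sum_congr rfl fun j _ => by ring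

/-- With `c = u`, `A = Dn`, `U = ∇u` and `H = D²u`, the summand is `∂ⱼg νᵢ - ∂ᵢg νⱼ` for `g = nᵢ u
∂ⱼu`, expanded by the product rule. The length of `ν` enters through `∑ νᵢ² = 1`. -/
theorem OrthonormalBasis.sum_sum_weighted_curl (b : OrthonormalBasis ι ℝ V)
    (H : V →L[ℝ] V →L[ℝ] ℝ) (A : V →L[ℝ] V) (U ν : V) (hν : ‖ν‖ = 1) (c : ℝ) :
    ∑ i, ∑ j,
      ((inner ℝ (A (b j)) (b i) * (c * inner ℝ U (b j)) + inner ℝ ν (b i) *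
          (inner ℝ U (b j) * inner ℝ U (b j) + c * H (b j) (b j))) * inner ℝ ν (b i) -
        (inner ℝ (A (b i)) (b i) * (c * inner ℝ U (b j)) + inner ℝ ν (b i) *
          (inner ℝ U (b i) * inner ℝ U (b j) + c * H (b i) (b j))) * inner ℝ ν (b j)) =
      c * inner ℝ (A U) ν + ‖U‖ ^ 2 + c * ∑ j, H (b j) (b j) -
        c * (∑ i, inner ℝ (A (b i)) (b i)) * inner ℝ U ν - inner ℝ U ν ^ 2 - c * H ν ν := by
  have hνν : ∑ i, inner ℝ ν (b i) * inner ℝ ν (b i) = (1 : ℝ) := by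
    rw [b.sum_inner_mul_inner', real_inner_self_eq_norm_sq, hν, one_pow]
  have h1 : inner ℝ (A U) ν =
      ∑ i, ∑ j, inner ℝ U (b j) * (inner ℝ (A (b j)) (b i) * inner ℝ ν (b i)) := by
    rw [Finset.sum_comm]
    simp_rw [← Finset.mul_sum, b.sum_inner_mul_inner']
    rw [real_inner_comm]
    exact (b.sum_inner_mul_apply ((innerSL ℝ ν).comp A) U).symm.trans
      (Finset.sum_congr rfl fun i _ => by simp [real_inner_comm])
  have h2 : ‖U‖ ^ 2 = ∑ i, ∑ j,
      (inner ℝ ν (b i) * inner ℝ ν (b i)) * (inner ℝ U (b j) * inner ℝ U (b j)) := by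
    rw [← Finset.sum_mul_sum, hνν, b.sum_inner_mul_inner', real_inner_self_eq_norm_sq, one_mul]
  have h3 : ∑ j, H (b j) (b j) =
      ∑ i, ∑ j, (inner ℝ ν (b i) * inner ℝ ν (b i)) * H (b j) (b j) := by
    rw [← Finset.sum_mul_sum, hνν, one_mul]
  have h4 : c * (∑ i, inner ℝ (A (b i)) (b i)) * inner ℝ U ν = c * ∑ i, ∑ j,
      inner ℝ (A (b i)) (b i) * (inner ℝ U (b j) * inner ℝ ν (b j)) := by
    rw [← Finset.sum_mul_sum, b.sum_inner_mul_inner', mul_assoc]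
  have h5 : inner ℝ U ν ^ 2 = ∑ i, ∑ j,
      (inner ℝ U (b i) * inner ℝ ν (b i)) * (inner ℝ U (b j) * inner ℝ ν (b j)) := by
    rw [← Finset.sum_mul_sum, b.sum_inner_mul_inner', sq]
  rw [h4, h1, h2, h3, h5, ← b.sum_sum_mul_apply H ν ν]
  simp_rw [Finset.mul_sum, ← Finset.sum_add_distrib, ← Finset.sum_sub_distrib]
  exact Finset.sum_congr rfl fun i _ => Finset.sum_congr rfl fun j _ => by ring

end HessianIdentities

/-! ### Second derivatives up to the boundary -/

section ClosureHessian

variable {N : ℕ} {Ω : Set (EuclideanSpace ℝ (Fin N))} {u : EuclideanSpace ℝ (Fin N) → ℝ}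

theorem inner_closureGradient (x v : EuclideanSpace ℝ (Fin N)) :
    inner ℝ (closureGradient Ω u x) v = fderivWithin ℝ u (closure Ω) x v :=
  toDual_symm_apply

theorem contDiffOn_fderivWithin_closure (hΩ : IsOpen Ω) (hC2 : HasC2Boundary Ω)
    (hu : ContDiffOn ℝ 2 u (closure Ω)) :
    ContDiffOn ℝ 1 (fderivWithin ℝ u (closure Ω)) (closure Ω) :=
  hu.fderivWithin (uniqueDiffOn_closure hΩ hC2) (by norm_num)

theorem contDiffOn_fderivWithin_closure_apply (hΩ : IsOpen Ω) (hC2 : HasC2Boundary Ω)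
    (hu : ContDiffOn ℝ 2 u (closure Ω)) (a : EuclideanSpace ℝ (Fin N)) :
    ContDiffOn ℝ 1 (fun x => fderivWithin ℝ u (closure Ω) x a) (closure Ω) :=
  (contDiffOn_fderivWithin_closure hΩ hC2 hu).clm_apply contDiffOn_const

theorem hasFDerivWithinAt_fderivWithin_closure (hΩ : IsOpen Ω) (hC2 : HasC2Boundary Ω)
    (hu : ContDiffOn ℝ 2 u (closure Ω)) {x : EuclideanSpace ℝ (Fin N)} (hx : x ∈ closure Ω) :
    HasFDerivWithinAt (fderivWithin ℝ u (closure Ω))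
      (fderivWithin ℝ (fderivWithin ℝ u (closure Ω)) (closure Ω) x) (closure Ω) x :=
  ((contDiffOn_fderivWithin_closure hΩ hC2 hu).differentiableOn (by norm_num) x hx).hasFDerivWithinAt

theorem fderivWithin_fderivWithin_closure_apply (hΩ : IsOpen Ω) (hC2 : HasC2Boundary Ω)
    (hu : ContDiffOn ℝ 2 u (closure Ω)) {x : EuclideanSpace ℝ (Fin N)} (hx : x ∈ closure Ω)
    (v a : EuclideanSpace ℝ (Fin N)) :
    fderivWithin ℝ (fun y => fderivWithin ℝ u (closure Ω) y a) (closure Ω) x v =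
      fderivWithin ℝ (fderivWithin ℝ u (closure Ω)) (closure Ω) x v a := by
  have h := (hasFDerivWithinAt_fderivWithin_closure hΩ hC2 hu hx).clm_apply
    (hasFDerivWithinAt_const a x (closure Ω))
  rw [h.fderivWithin (uniqueDiffOn_closure hΩ hC2 x hx)]
  simp

theorem fderivWithin_fderivWithin_closure_comm (hΩ : IsOpen Ω) (hC2 : HasC2Boundary Ω)
    (hu : ContDiffOn ℝ 2 u (closure Ω)) {x : EuclideanSpace ℝ (Fin N)} (hx : x ∈ closure Ω)
    (v a : EuclideanSpace ℝ (Fin N)) :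
    fderivWithin ℝ (fderivWithin ℝ u (closure Ω)) (closure Ω) x v a =
      fderivWithin ℝ (fderivWithin ℝ u (closure Ω)) (closure Ω) x a v :=
  (hu x hx).isSymmSndFDerivWithinAt (by simp) (uniqueDiffOn_closure hΩ hC2)
    (closure_mono (interior_maximal subset_closure hΩ) hx) hx v a

/-- The equation holds in the open set, where the two notions of second derivative agree, and
extends to the closure by continuity. -/
theorem sum_fderivWithin_fderivWithin_closure (hΩ : IsOpen Ω) (hC2 : HasC2Boundary Ω)
    (hu : ContDiffOn ℝ 2 u (closure Ω)) {c : ℝ} (hpde : ∀ x ∈ Ω, Δ u x = c) {ι : Type*} [Fintype ι]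
    (b : OrthonormalBasis ι ℝ (EuclideanSpace ℝ (Fin N)))
    {x : EuclideanSpace ℝ (Fin N)} (hx : x ∈ closure Ω) :
    ∑ i, fderivWithin ℝ (fderivWithin ℝ u (closure Ω)) (closure Ω) x (b i) (b i) = c := by
  have hcont : ContinuousOn (fun y => ∑ i, fderivWithin ℝ (fderivWithin ℝ u (closure Ω))
      (closure Ω) y (b i) (b i)) (closure Ω) := by
    refine continuousOn_finsetSum _ fun i _ => ?_
    refine (continuousOn_fderivWithin_closure_apply hΩ hC2
      (contDiffOn_fderivWithin_closure_apply hΩ hC2 hu (b i)) (b i)).congr fun y hy => ?_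
    exact (fderivWithin_fderivWithin_closure_apply hΩ hC2 hu hy _ _).symm
  refine Set.EqOn.of_subset_closure (s := Ω) (fun y hy => ?_) hcont continuousOn_const
    subset_closure subset_rfl hx
  have h1 : fderivWithin ℝ u (closure Ω) =ᶠ[𝓝 y] fderiv ℝ u := by
    filter_upwards [hΩ.mem_nhds hy] with z hz
    exact ((hasFDerivAt_of_contDiffOn_closure hΩ (by norm_num) hu hz).fderiv).symm
  have h2 : fderivWithin ℝ (fderivWithin ℝ u (closure Ω)) (closure Ω) y =
      fderiv ℝ (fderiv ℝ u) y := by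
    rw [fderivWithin_of_mem_nhds (mem_of_superset (hΩ.mem_nhds hy) subset_closure)]
    exact h1.fderiv_eq
  rw [← hpde y hy, laplacian_eq_iteratedFDeriv_orthonormalBasis u b, h2]
  simp [iteratedFDeriv_two_apply]

end ClosureHessian

/-! ### Integral identities for `C²` functions -/

section IntegralIdentities

variable {N : ℕ} {Ω : Set (EuclideanSpace ℝ (Fin N))} {u : EuclideanSpace ℝ (Fin N) → ℝ}
  {ι : Type*} [Fintype ι]

/-- Reilly-type identity: the integral of `(Δu)² - |D²u|²` is a boundary integral. -/
theorem integral_sum_hessian_minors (hN : 1 ≤ N) (hΩ : IsOpen Ω) (hbdd : Bornology.IsBounded Ω)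
    (hC2 : HasC2Boundary Ω) (hu : ContDiffOn ℝ 2 u (closure Ω))
    (b : OrthonormalBasis ι ℝ (EuclideanSpace ℝ (Fin N))) {H : EuclideanSpace ℝ (Fin N) →
      EuclideanSpace ℝ (Fin N) →L[ℝ] EuclideanSpace ℝ (Fin N) →L[ℝ] ℝ}
    (hH : H = fderivWithin ℝ (fderivWithin ℝ u (closure Ω)) (closure Ω)) :
    IntegrableOn (fun x => ∑ i, ∑ j,
      (H x (b i) (b i) * H x (b j) (b j) - H x (b i) (b j) ^ 2)) Ω ∧
    IntegrableOn (fun x => (∑ j, H x (b j) (b j)) *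
        inner ℝ (closureGradient Ω u x) (outerUnitNormal Ω x) -
          H x (closureGradient Ω u x) (outerUnitNormal Ω x)) (frontier Ω) μHE[N - 1] ∧
    ∫ x in Ω, ∑ i, ∑ j, (H x (b i) (b i) * H x (b j) (b j) - H x (b i) (b j) ^ 2) =
      ∫ x in frontier Ω, ((∑ j, H x (b j) (b j)) *
        inner ℝ (closureGradient Ω u x) (outerUnitNormal Ω x) -
          H x (closureGradient Ω u x) (outerUnitNormal Ω x)) ∂μHE[N - 1] := by
  have hd := contDiffOn_fderivWithin_closure_apply hΩ hC2 hu
  have hH2 : ∀ x ∈ closure Ω, ∀ v a, fderivWithin ℝ (fun y => fderivWithin ℝ u (closure Ω) y a)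
      (closure Ω) x v = H x v a := fun x hx v a => by
    rw [hH, fderivWithin_fderivWithin_closure_apply hΩ hC2 hu hx]
  have hint := fun i j => integrableOn_curl hΩ hbdd hC2 (hd (b i)) (hd (b j)) (b i) (b j)
  have hint' := fun i j => integrableOn_curl_frontier hN hΩ hbdd hC2 (hd (b i)) (hd (b j))
    (b i) (b j)
  have hfr := frontier_subset_closure (s := Ω)
  -- The curl formula is applied to `f = ∂ᵢu` and `g = ∂ⱼu` in the directions `i` and `j`: `df ∧ dg`
  -- is then a two by two minor of the Hessian, and no third derivative of `u` appears.
  have e1 : EqOn (fun x => ∑ i, ∑ j,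
      (fderivWithin ℝ (fun y => fderivWithin ℝ u (closure Ω) y (b i)) (closure Ω) x (b i) *
        fderivWithin ℝ (fun y => fderivWithin ℝ u (closure Ω) y (b j)) (closure Ω) x (b j) -
      fderivWithin ℝ (fun y => fderivWithin ℝ u (closure Ω) y (b i)) (closure Ω) x (b j) *
        fderivWithin ℝ (fun y => fderivWithin ℝ u (closure Ω) y (b j)) (closure Ω) x (b i)))
      (fun x => ∑ i, ∑ j, (H x (b i) (b i) * H x (b j) (b j) - H x (b i) (b j) ^ 2)) Ω := by
    intro x hx
    refine Finset.sum_congr rfl fun i _ => Finset.sum_congr rfl fun j _ => ?_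
    have hs : H x (b j) (b i) = H x (b i) (b j) := by
      rw [hH, fderivWithin_fderivWithin_closure_comm hΩ hC2 hu (subset_closure hx)]
    rw [hH2 x (subset_closure hx), hH2 x (subset_closure hx), hH2 x (subset_closure hx),
      hH2 x (subset_closure hx), hs, sq]
  have e2 : EqOn (fun x => ∑ i, ∑ j, fderivWithin ℝ u (closure Ω) x (b i) *
      (fderivWithin ℝ (fun y => fderivWithin ℝ u (closure Ω) y (b j)) (closure Ω) x (b j) *
          inner ℝ (outerUnitNormal Ω x) (b i) -
        fderivWithin ℝ (fun y => fderivWithin ℝ u (closure Ω) y (b j)) (closure Ω) x (b i) *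
          inner ℝ (outerUnitNormal Ω x) (b j)))
      (fun x => (∑ j, H x (b j) (b j)) *
        inner ℝ (closureGradient Ω u x) (outerUnitNormal Ω x) -
          H x (closureGradient Ω u x) (outerUnitNormal Ω x)) (frontier Ω) := by
    intro x hx
    dsimp only
    rw [← b.sum_sum_hessian_curl]
    refine Finset.sum_congr rfl fun i _ => Finset.sum_congr rfl fun j _ => ?_
    rw [hH2 x (hfr hx), hH2 x (hfr hx), inner_closureGradient]
  refine ⟨IntegrableOn.congr_fun (integrable_finsetSum _ fun i _ =>
      integrable_finsetSum _ fun j _ => hint i j) e1 hΩ.measurableSet,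
    IntegrableOn.congr_fun (integrable_finsetSum _ fun i _ =>
      integrable_finsetSum _ fun j _ => hint' i j) e2 isClosed_frontier.measurableSet, ?_⟩
  rw [← setIntegral_congr_fun hΩ.measurableSet e1,
    ← setIntegral_congr_fun isClosed_frontier.measurableSet e2,
    integral_finsetSum _ fun i _ => integrable_finsetSum _ fun j _ => hint i j,
    integral_finsetSum _ fun i _ => integrable_finsetSum _ fun j _ => hint' i j]
  refine Finset.sum_congr rfl fun i _ => ?_
  rw [integral_finsetSum _ fun j _ => hint i j, integral_finsetSum _ fun j _ => hint' i j]
  exact Finset.sum_congr rfl fun j _ => curl_formula hN hΩ hbdd hC2 (b i) (b j) (hd _) (hd _)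

/-- The tangential divergence of `u ∇u` on `∂Ω`, weighted by the normal, integrates to zero. -/
theorem integral_tangential_divergence (hN : 1 ≤ N) (hΩ : IsOpen Ω) (hbdd : Bornology.IsBounded Ω)
    (hC2 : HasC2Boundary Ω) (hu : ContDiffOn ℝ 2 u (closure Ω))
    (b : OrthonormalBasis ι ℝ (EuclideanSpace ℝ (Fin N))) {H : EuclideanSpace ℝ (Fin N) →
      EuclideanSpace ℝ (Fin N) →L[ℝ] EuclideanSpace ℝ (Fin N) →L[ℝ] ℝ}
    (hH : H = fderivWithin ℝ (fderivWithin ℝ u (closure Ω)) (closure Ω))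
    {n : EuclideanSpace ℝ (Fin N) → EuclideanSpace ℝ (Fin N)} (hn : ContDiff ℝ 1 n)
    (hnν : ∀ x ∈ frontier Ω, n x = outerUnitNormal Ω x)
    {B : EuclideanSpace ℝ (Fin N) → ℝ} (hB : B = fun x =>
      u x * inner ℝ (fderiv ℝ n x (closureGradient Ω u x)) (outerUnitNormal Ω x) +
        ‖closureGradient Ω u x‖ ^ 2 + u x * ∑ j, H x (b j) (b j) -
        u x * (∑ i, inner ℝ (fderiv ℝ n x (b i)) (b i)) *
          inner ℝ (closureGradient Ω u x) (outerUnitNormal Ω x) -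
        inner ℝ (closureGradient Ω u x) (outerUnitNormal Ω x) ^ 2 -
        u x * H x (outerUnitNormal Ω x) (outerUnitNormal Ω x)) :
    IntegrableOn B (frontier Ω) μHE[N - 1] ∧ ∫ x in frontier Ω, B x ∂μHE[N - 1] = 0 := by
  have hd := contDiffOn_fderivWithin_closure_apply hΩ hC2 hu
  have hfr := frontier_subset_closure (s := Ω)
  have hni : ∀ a, ContDiff ℝ 1 fun x => inner ℝ (n x) a := fun a => hn.inner ℝ contDiff_const
  have hg : ∀ i j, ContDiffOn ℝ 1 (fun x => inner ℝ (n x) (b i) *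
      (u x * fderivWithin ℝ u (closure Ω) x (b j))) (closure Ω) := fun i j =>
    (hni (b i)).contDiffOn.mul ((hu.of_le (by norm_num)).mul (hd (b j)))
  -- With `f = 1` the volume side of the curl formula is zero, which leaves a Stokes theorem on the
  -- closed hypersurface.
  have h1 : ContDiffOn ℝ 1 (fun _ : EuclideanSpace ℝ (Fin N) => (1 : ℝ)) (closure Ω) :=
    contDiffOn_const
  have hD : ∀ i j, ∀ x ∈ frontier Ω, ∀ v, fderivWithin ℝ (fun x => inner ℝ (n x) (b i) *
      (u x * fderivWithin ℝ u (closure Ω) x (b j))) (closure Ω) x v =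
      inner ℝ (fderiv ℝ n x v) (b i) * (u x * inner ℝ (closureGradient Ω u x) (b j)) +
        inner ℝ (outerUnitNormal Ω x) (b i) *
          (inner ℝ (closureGradient Ω u x) v * inner ℝ (closureGradient Ω u x) (b j) +
            u x * H x v (b j)) := by
    intro i j x hx v
    have d1 := ((hn.differentiable (by norm_num) x).hasFDerivAt.inner ℝ
      (hasFDerivAt_const (b i) x)).hasFDerivWithinAt (s := closure Ω)
    have d2 := (hu.differentiableOn (by norm_num) x (hfr hx)).hasFDerivWithinAt
    have d3 := (hasFDerivWithinAt_fderivWithin_closure hΩ hC2 hu (hfr hx)).clm_apply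
      (hasFDerivWithinAt_const (b j) x (closure Ω))
    refine (congrArg (fun L => L v) ((d1.mul (d2.mul d3)).fderivWithin
      (uniqueDiffOn_closure hΩ hC2 x (hfr hx)))).trans ?_
    simp [hnν x hx, inner_closureGradient, hH]
    ring
  have hint := fun i j => integrableOn_curl_frontier hN hΩ hbdd hC2 h1 (hg i j) (b i) (b j)
  have e2 : EqOn (fun x => ∑ i, ∑ j, 1 *
      (fderivWithin ℝ (fun x => inner ℝ (n x) (b i) *
          (u x * fderivWithin ℝ u (closure Ω) x (b j))) (closure Ω) x (b j) *
          inner ℝ (outerUnitNormal Ω x) (b i) -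
        fderivWithin ℝ (fun x => inner ℝ (n x) (b i) *
          (u x * fderivWithin ℝ u (closure Ω) x (b j))) (closure Ω) x (b i) *
          inner ℝ (outerUnitNormal Ω x) (b j))) B (frontier Ω) := by
    intro x hx
    rw [hB]
    dsimp only
    rw [← b.sum_sum_weighted_curl _ _ _ _ (norm_outerUnitNormal hC2 hx)]
    refine Finset.sum_congr rfl fun i _ => Finset.sum_congr rfl fun j _ => ?_
    rw [hD i j x hx, hD i j x hx, one_mul]
  refine ⟨IntegrableOn.congr_fun (integrable_finsetSum _ fun i _ =>
      integrable_finsetSum _ fun j _ => hint i j) e2 isClosed_frontier.measurableSet, ?_⟩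
  rw [← setIntegral_congr_fun isClosed_frontier.measurableSet e2,
    integral_finsetSum _ fun i _ => integrable_finsetSum _ fun j _ => hint i j]
  refine Finset.sum_eq_zero fun i _ => ?_
  rw [integral_finsetSum _ fun j _ => hint i j]
  refine Finset.sum_eq_zero fun j _ => ?_
  rw [← curl_formula hN hΩ hbdd hC2 (b i) (b j) h1 (hg i j)]
  simp

/-- The divergence theorem for `∇u`. -/
theorem integral_normal_derivative (hN : 1 ≤ N) (hΩ : IsOpen Ω) (hbdd : Bornology.IsBounded Ω)
    (hC2 : HasC2Boundary Ω) (hu : ContDiffOn ℝ 2 u (closure Ω)) {c : ℝ}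
    (hpde : ∀ x ∈ Ω, Δ u x = c) :
    ∫ x in frontier Ω, outerNormalDeriv Ω u x ∂μHE[N - 1] = c * domainVolume Ω := by
  set b := EuclideanSpace.basisFun (Fin N) ℝ
  have hd := contDiffOn_fderivWithin_closure_apply hΩ hC2 hu
  have e1 : EqOn (fun x => ∑ i, fderivWithin ℝ (fun y => fderivWithin ℝ u (closure Ω) y (b i))
      (closure Ω) x (b i)) (fun _ => c) Ω := by
    intro x hx
    dsimp only
    rw [← sum_fderivWithin_fderivWithin_closure hΩ hC2 hu hpde b (subset_closure hx)]
    exact Finset.sum_congr rfl fun i _ =>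
      fderivWithin_fderivWithin_closure_apply hΩ hC2 hu (subset_closure hx) _ _
  have e2 : EqOn (fun x => ∑ i, fderivWithin ℝ u (closure Ω) x (b i) *
      inner ℝ (outerUnitNormal Ω x) (b i)) (outerNormalDeriv Ω u) (frontier Ω) := by
    intro x _
    dsimp only
    rw [outerNormalDeriv, ← b.sum_inner_mul_inner']
    exact Finset.sum_congr rfl fun i _ => by rw [inner_closureGradient]
  have h0 : ∫ x in Ω, c = c * domainVolume Ω := by
    simp [domainVolume, Measure.real, mul_comm]
  rw [← h0, ← setIntegral_congr_fun isClosed_frontier.measurableSet e2,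
    ← setIntegral_congr_fun hΩ.measurableSet e1, integral_finsetSum, integral_finsetSum]
  · exact Finset.sum_congr rfl fun i _ =>
      (integral_fderivWithin_eq hN hΩ hbdd hC2 (b i) _ (hd (b i))).symm
  · exact fun i _ => ContinuousOn.integrableOn_of_closure hbdd
      (continuousOn_fderivWithin_closure_apply hΩ hC2 (hd (b i)) (b i))
  · exact fun i _ => ContinuousOn.integrableOn_frontier hN hΩ hbdd hC2
      (((hd (b i)).continuousOn.mono frontier_subset_closure).mul
        (continuousOn_inner_normal hΩ hC2 (b i)))

end IntegralIdentities

/-! ### The pointwise inequality on the boundary -/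

section RobinProblem

variable {N : ℕ} {Ω : Set (EuclideanSpace ℝ (Fin N))} {u : EuclideanSpace ℝ (Fin N) → ℝ} {β : ℝ}

/-- The tangential derivative of the Robin condition. -/
theorem robin_tangential_derivative (hΩ : IsOpen Ω) (hC2 : HasC2Boundary Ω)
    (hu : ContDiffOn ℝ 2 u (closure Ω))
    (hrobin : ∀ x ∈ frontier Ω, outerNormalDeriv Ω u x + β * u x = 0)
    {n : EuclideanSpace ℝ (Fin N) → EuclideanSpace ℝ (Fin N)} (hn : ContDiff ℝ 1 n)
    (hnν : ∀ x ∈ frontier Ω, n x = outerUnitNormal Ω x) {p t : EuclideanSpace ℝ (Fin N)}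
    (hp : p ∈ frontier Ω) (ht : inner ℝ (outerUnitNormal Ω p) t = 0) :
    fderivWithin ℝ (fderivWithin ℝ u (closure Ω)) (closure Ω) p t (outerUnitNormal Ω p) +
      inner ℝ (closureGradient Ω u p) (fderiv ℝ n p t) +
        β * inner ℝ (closureGradient Ω u p) t = 0 := by
  have hpK := frontier_subset_closure hp
  have d1 := (hasFDerivWithinAt_fderivWithin_closure hΩ hC2 hu hpK).clm_apply
    (hn.differentiable (by norm_num) p).hasFDerivAt.hasFDerivWithinAt
  have d2 := (hu.differentiableOn (by norm_num) p hpK).hasFDerivWithinAt.const_mul β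
  have h := hasFDerivWithinAt_apply_eq_zero_of_tangent hΩ hC2 hp
    ((d1.add d2).mono frontier_subset_closure) (by
      filter_upwards [self_mem_nhdsWithin] with x hx
      have := hrobin x hx
      rw [outerNormalDeriv, inner_closureGradient] at this
      simpa [hnν x hx] using this) ht
  rw [inner_closureGradient, inner_closureGradient, ← h]
  simp [hnν p hp]
  ring

/-- The right side is the sum of the two boundary integrands, the second taken `β` times. The weight
`β` is what makes the Robin condition cancel `D²u(ν, ν)`. The lower bound is affine in the normal
derivative, the only boundary quantity whose integral is known. -/
theorem boundary_integrand_ge (hN : 2 ≤ N) (hΩ : IsOpen Ω) (hC2 : HasC2Boundary Ω)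
    (hβ : 0 < β) (R : ℝ) {C : ℝ} (hu : ContDiffOn ℝ 2 u (closure Ω))
    (hpde : ∀ x ∈ Ω, Δ u x = N)
    (hrobin : ∀ x ∈ frontier Ω, outerNormalDeriv Ω u x + β * u x = 0)
    (hover : ∀ x ∈ frontier Ω,
      ‖closureGradient Ω u x‖ ^ 2 + 2 * N * u x - 2 * β ^ 2 * u x ^ 2
        + ((N : ℝ) - 1) * β * u x ^ 2 * meanCurvature Ω x = C)
    (hκ : 0 ≤ (β : EReal) + minPrincipalCurvature Ω)
    {ι : Type*} [Fintype ι] (b : OrthonormalBasis ι ℝ (EuclideanSpace ℝ (Fin N)))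
    {H : EuclideanSpace ℝ (Fin N) →
      EuclideanSpace ℝ (Fin N) →L[ℝ] EuclideanSpace ℝ (Fin N) →L[ℝ] ℝ}
    (hH : H = fderivWithin ℝ (fderivWithin ℝ u (closure Ω)) (closure Ω))
    {n : EuclideanSpace ℝ (Fin N) → EuclideanSpace ℝ (Fin N)} (hn : ContDiff ℝ 1 n)
    (hnν : ∀ x ∈ frontier Ω, n x = outerUnitNormal Ω x) {x : EuclideanSpace ℝ (Fin N)}
    (hx : x ∈ frontier Ω) :
    β * C - β * R ^ 2 + (2 * β * R + 2 * N) * outerNormalDeriv Ω u x ≤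
      ((∑ j, H x (b j) (b j)) * inner ℝ (closureGradient Ω u x) (outerUnitNormal Ω x) -
          H x (closureGradient Ω u x) (outerUnitNormal Ω x)) +
      β * (u x * inner ℝ (fderiv ℝ n x (closureGradient Ω u x)) (outerUnitNormal Ω x) +
        ‖closureGradient Ω u x‖ ^ 2 + u x * ∑ j, H x (b j) (b j) -
        u x * (∑ i, inner ℝ (fderiv ℝ n x (b i)) (b i)) *
          inner ℝ (closureGradient Ω u x) (outerUnitNormal Ω x) -
        inner ℝ (closureGradient Ω u x) (outerUnitNormal Ω x) ^ 2 -
        u x * H x (outerUnitNormal Ω x) (outerUnitNormal Ω x)) := by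
  have htr : ∑ j, H x (b j) (b j) = N := by
    rw [hH]
    exact sum_fderivWithin_fderivWithin_closure hΩ hC2 hu hpde b (frontier_subset_closure hx)
  have hT := meanCurvature_eq hN hΩ hC2 hx hn hnν b
  have hr := hrobin x hx
  have ho := hover x hx
  have hνn := norm_outerUnitNormal hC2 hx
  have hνν : inner ℝ (outerUnitNormal Ω x) (outerUnitNormal Ω x) = (1 : ℝ) := by
    rw [real_inner_self_eq_norm_sq, hνn, one_pow]
  have hrt := fun t => robin_tangential_derivative hΩ hC2 hu hrobin hn hnν hx (t := t)
  have hnt := fun t (ht : t ∈ boundaryTangentSpace Ω x) =>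
    inner_fderiv_normal_eq_zero hΩ hC2 hx hn hnν ht
  have hκt := fun t (ht : t ∈ boundaryTangentSpace Ω x) =>
    neg_mul_norm_sq_le_inner_fderiv_normal hΩ hC2 hx hn hnν hκ ht
  simp_rw [mem_boundaryTangentSpace] at hnt hκt
  rw [← hH] at hrt
  rw [htr]
  unfold outerNormalDeriv at hr ⊢
  set U := closureGradient Ω u x
  set ν := outerUnitNormal Ω x
  set v : ℝ := inner ℝ U ν with hv
  set w := U - v • ν with hw
  have hUw : U = w + v • ν := by rw [hw, sub_add_cancel]
  have hwν : inner ℝ ν w = 0 := by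
    rw [hw, inner_sub_right, inner_smul_right, hνν, hv, real_inner_comm]
    ring
  have f1 : H x U ν = H x w ν + v * H x ν ν := by
    rw [hUw]; simp
  have f2 : inner ℝ (fderiv ℝ n x U) ν = v * inner ℝ (fderiv ℝ n x ν) ν := by
    rw [hUw, map_add, map_smul, inner_add_left, inner_smul_left, hnt w hwν]
    simp
  have f3 : ‖U‖ ^ 2 = ‖w‖ ^ 2 + v ^ 2 := by
    rw [hUw, ← real_inner_self_eq_norm_sq, ← real_inner_self_eq_norm_sq]
    simp only [inner_add_left, inner_add_right, inner_smul_left, inner_smul_right, hνν, hwν,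
      real_inner_comm ν w]
    simp
    ring
  -- The Robin condition is differentiated along `w` itself, which trades `D²u(w, ν)` for the
  -- curvature term.
  have f5 : H x w ν + inner ℝ (fderiv ℝ n x w) w + β * ‖w‖ ^ 2 = 0 := by
    have h := hrt w hwν
    have h1 : inner ℝ U (fderiv ℝ n x w) = inner ℝ (fderiv ℝ n x w) w := by
      rw [hUw, inner_add_left, inner_smul_left, real_inner_comm (fderiv ℝ n x w) ν, hnt w hwν,
        real_inner_comm]
      simp
    have h2 : inner ℝ U w = ‖w‖ ^ 2 := by
      rw [hUw, inner_add_left, inner_smul_left, hwν, real_inner_self_eq_norm_sq]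
      simp
    rwa [h1, h2] at h
  have f6 := hκt w hwν
  rw [f1, f2, f3]
  rw [f3] at ho
  generalize inner ℝ (fderiv ℝ n x w) w = q at *
  generalize inner ℝ (fderiv ℝ n x ν) ν = a at *
  generalize H x w ν = hwn at *
  generalize H x ν ν = hnn at *
  generalize ‖w‖ ^ 2 = W at *
  have hv' : v = -β * u x := by linarith
  -- The overdetermined condition times `β`, with `β²u² = v²`; the mean curvature then has the same
  -- weight `v²` as in the integrand.
  have ho2 : β * W - β * v ^ 2 + 2 * N * (β * u x) +
      v ^ 2 * (((N : ℝ) - 1) * meanCurvature Ω x) = β * C := by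
    rw [← ho, hv']; ring
  rw [hT] at ho2
  have hwn' : hwn = -q - β * W := by linarith
  have hβu : β * u x = -v := by linarith
  -- This replaces `v²` by its tangent line at `R`, the mean value of `v` over the boundary.
  have hsq := mul_nonneg hβ.le (sq_nonneg (v - R))
  -- Substituting `βu = -v` cancels `hnn` and the two terms with the factor `N`, and `hwn` is
  -- eliminated by `f5`.
  have key : (N : ℝ) * v - (hwn + v * hnn) + β * (u x * (v * a) + (W + v ^ 2) + u x * N -
      u x * (∑ i, inner ℝ (fderiv ℝ n x (b i)) (b i)) * v - v ^ 2 - u x * hnn) =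
      q + 2 * β * W + v ^ 2 * (∑ i, inner ℝ (fderiv ℝ n x (b i)) (b i) - a) := by
    rw [hwn', hv']; ring
  rw [key]
  rw [hβu] at ho2
  linarith

end RobinProblem

/-! ### Equality: the Hessian is the identity -/

section Rigidity

variable {N : ℕ} {Ω : Set (EuclideanSpace ℝ (Fin N))} {u : EuclideanSpace ℝ (Fin N) → ℝ} {β : ℝ}

theorem setIntegral_const_frontier (c : ℝ) :
    ∫ _ in frontier Ω, c ∂(μHE[N - 1] : Measure (EuclideanSpace ℝ (Fin N))) =
      c * boundaryArea Ω := by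
  simp [boundaryArea, Measure.real, mul_comm]

theorem integrableOn_outerNormalDeriv (hN : 1 ≤ N) (hΩ : IsOpen Ω) (hbdd : Bornology.IsBounded Ω)
    (hC2 : HasC2Boundary Ω) (hu : ContDiffOn ℝ 2 u (closure Ω))
    (hrobin : ∀ x ∈ frontier Ω, outerNormalDeriv Ω u x + β * u x = 0) :
    IntegrableOn (outerNormalDeriv Ω u) (frontier Ω) μHE[N - 1] := by
  refine ContinuousOn.integrableOn_frontier hN hΩ hbdd hC2 (ContinuousOn.congr
    (f := fun x => -β * u x)
    (continuousOn_const.mul (hu.continuousOn.mono frontier_subset_closure)) fun x hx => ?_)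
  linarith [hrobin x hx]

theorem mul_boundaryArea_eq (hN : 1 ≤ N) (hΩ : IsOpen Ω) (hbdd : Bornology.IsBounded Ω)
    (hC2 : HasC2Boundary Ω) (hu : ContDiffOn ℝ 2 u (closure Ω)) (hpde : ∀ x ∈ Ω, Δ u x = N)
    {R : ℝ} (hR : R = N * domainVolume Ω / boundaryArea Ω) :
    R * boundaryArea Ω = N * domainVolume Ω := by
  -- If the area were zero, the quotient defining `R` would carry no information; the divergence
  -- theorem then gives `N|Ω| = 0` as well.
  by_cases hS : boundaryArea Ω = 0
  · have h0 : (μHE[N - 1] : Measure (EuclideanSpace ℝ (Fin N))) (frontier Ω) = 0 :=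
      (ENNReal.toReal_eq_zero_iff _).1 hS |>.resolve_right
        (measure_frontier_lt_top hN hΩ hbdd hC2).ne
    rw [hS, mul_zero, ← integral_normal_derivative hN hΩ hbdd hC2 hu hpde,
      setIntegral_measure_zero _ h0]
  · rw [hR, div_mul_cancel₀ _ hS]

theorem fderivWithin_fderivWithin_eq_inner (hN : 2 ≤ N) (hΩ : IsOpen Ω)
    (hbdd : Bornology.IsBounded Ω) (hC2 : HasC2Boundary Ω)
    (hβ : 0 < β) {R C : ℝ} (hR : R = N * domainVolume Ω / boundaryArea Ω)
    (hC : C = -R ^ 2 - R * ((N + 1) / β)) (hu : ContDiffOn ℝ 2 u (closure Ω))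
    (hpde : ∀ x ∈ Ω, Δ u x = N)
    (hrobin : ∀ x ∈ frontier Ω, outerNormalDeriv Ω u x + β * u x = 0)
    (hover : ∀ x ∈ frontier Ω,
      ‖closureGradient Ω u x‖ ^ 2 + 2 * N * u x - 2 * β ^ 2 * u x ^ 2
        + ((N : ℝ) - 1) * β * u x ^ 2 * meanCurvature Ω x = C)
    (hκ : 0 ≤ (β : EReal) + minPrincipalCurvature Ω) {x : EuclideanSpace ℝ (Fin N)} (hx : x ∈ Ω)
    (v w : EuclideanSpace ℝ (Fin N)) :
    fderivWithin ℝ (fderivWithin ℝ u (closure Ω)) (closure Ω) x v w = inner ℝ v w := by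
  have hN1 : 1 ≤ N := by omega
  set b := EuclideanSpace.basisFun (Fin N) ℝ
  obtain ⟨n, hn, hnν⟩ := exists_contDiff_extension_normal hΩ hC2
  obtain ⟨H, hH⟩ : ∃ H, H = fderivWithin ℝ (fderivWithin ℝ u (closure Ω)) (closure Ω) := ⟨_, rfl⟩
  obtain ⟨i1, i2, h12⟩ := integral_sum_hessian_minors hN1 hΩ hbdd hC2 hu b hH
  obtain ⟨i3, h3⟩ := integral_tangential_divergence hN1 hΩ hbdd hC2 hu b hH hn hnν rfl
  have hvi := integrableOn_outerNormalDeriv hN1 hΩ hbdd hC2 hu hrobin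
  have hcf : IntegrableOn (fun _ => β * C - β * R ^ 2) (frontier Ω)
      (μHE[N - 1] : Measure (EuclideanSpace ℝ (Fin N))) :=
    integrableOn_const (measure_frontier_lt_top hN1 hΩ hbdd hC2).ne
  have hmono := setIntegral_mono_on (hcf.add (hvi.const_mul (2 * β * R + 2 * N)))
    (i2.add (i3.const_mul β)) isClosed_frontier.measurableSet fun x hx =>
      boundary_integrand_ge hN hΩ hC2 hβ R hu hpde hrobin hover hκ b hH hn hnν hx
  have hRS := mul_boundaryArea_eq hN1 hΩ hbdd hC2 hu hpde hR
  simp only [Pi.add_apply] at hmono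
  rw [integral_add hcf (hvi.const_mul _), integral_add i2 (i3.const_mul β), integral_const_mul,
    integral_const_mul, h3, mul_zero, add_zero, setIntegral_const_frontier,
    integral_normal_derivative hN1 hΩ hbdd hC2 hu hpde, ← h12] at hmono
  have hbC : β * C - β * R ^ 2 = -2 * β * R ^ 2 - R * (N + 1) := by
    rw [hC]; field_simp; ring
  -- Here the precise value of `C` matters: after `R|∂Ω| = N|Ω|` the terms with `βR` cancel, and `2N
  -- - (N + 1) = N - 1` remains.
  have hlow : ((N : ℝ) - 1) * (N * domainVolume Ω) ≤
      ∫ x in Ω, ∑ i, ∑ j, (H x (b i) (b i) * H x (b j) (b j) - H x (b i) (b j) ^ 2) := by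
    refine le_trans (le_of_eq ?_) hmono
    rw [hbC]
    linear_combination (2 * β * R + (N + 1)) * hRS
  set F : EuclideanSpace ℝ (Fin N) → ℝ := fun x =>
    ∑ i, ∑ j, (H x (b i) (b j) - inner ℝ (b i) (b j)) ^ 2 with hF
  have htr : ∀ y ∈ closure Ω, ∑ j, H y (b j) (b j) = N := fun y hy => by
    rw [hH]
    exact sum_fderivWithin_fderivWithin_closure hΩ hC2 hu hpde b hy
  -- This is `|H - I|² = |H|² - 2 tr H + N` with `tr H = N`, so the deficit in the lower bound is
  -- exactly the distance of the Hessian from the identity.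
  have hFeq : EqOn F (fun x => ((N : ℝ) ^ 2 - N) -
      ∑ i, ∑ j, (H x (b i) (b i) * H x (b j) (b j) - H x (b i) (b j) ^ 2)) Ω := by
    intro y hy
    have ht := htr y (subset_closure hy)
    have e1 : ∑ i, ∑ j, H y (b i) (b i) * H y (b j) (b j) = (N : ℝ) ^ 2 := by
      rw [← Finset.sum_mul_sum, ht, sq]
    have e2 : ∑ i, ∑ j, (2 * (inner ℝ (b i) (b j) * H y (b i) (b j)) -
        inner ℝ (b i) (b j) * inner ℝ (b i) (b j)) = (N : ℝ) := by
      simp_rw [Finset.sum_sub_distrib, ← Finset.mul_sum, b.sum_inner_mul_apply,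
        b.sum_inner_mul_inner', ht]
      simp
      ring
    simp only [hF]
    rw [← e1, ← e2]
    simp_rw [← Finset.sum_sub_distrib]
    exact Finset.sum_congr rfl fun i _ => Finset.sum_congr rfl fun j _ => by ring
  have hcV : IntegrableOn (fun _ => (N : ℝ) ^ 2 - N) Ω :=
    integrableOn_const hbdd.measure_lt_top.ne
  have hFi : IntegrableOn F Ω := IntegrableOn.congr_fun (hcV.sub i1) hFeq.symm hΩ.measurableSet
  have hF0 : ∀ y, 0 ≤ F y := fun y =>
    Finset.sum_nonneg fun i _ => Finset.sum_nonneg fun j _ => sq_nonneg _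
  have hFint : ∫ y in Ω, F y = 0 := by
    refine le_antisymm ?_ (integral_nonneg hF0)
    rw [setIntegral_congr_fun hΩ.measurableSet hFeq, integral_sub hcV i1]
    have : ∫ y in Ω, ((N : ℝ) ^ 2 - N) = ((N : ℝ) ^ 2 - N) * domainVolume Ω := by
      simp [domainVolume, Measure.real, mul_comm]
    rw [this]
    linarith
  have hFc : ContinuousOn F Ω := by
    refine continuousOn_finsetSum _ fun i _ => continuousOn_finsetSum _ fun j _ => ?_
    refine ContinuousOn.pow (ContinuousOn.sub ?_ continuousOn_const) 2
    refine ((continuousOn_fderivWithin_closure_apply hΩ hC2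
      (contDiffOn_fderivWithin_closure_apply hΩ hC2 hu (b j)) (b i)).mono subset_closure).congr
      fun y hy => ?_
    rw [hH]
    exact (fderivWithin_fderivWithin_closure_apply hΩ hC2 hu (subset_closure hy) _ _).symm
  -- A nonnegative function with zero integral vanishes almost everywhere, and by continuity at
  -- every point of the open set.
  have hFzero : F x = 0 :=
    Measure.eqOn_open_of_ae_eq ((integral_eq_zero_iff_of_nonneg hF0 hFi).1 hFint) hΩ hFc
      continuousOn_const hx
  have hij : ∀ i j, H x (b i) (b j) = inner ℝ (b i) (b j) := by
    intro i j
    have h1 := (Finset.sum_eq_zero_iff_of_nonneg fun i _ =>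
      Finset.sum_nonneg fun j _ => sq_nonneg _).1 hFzero i (Finset.mem_univ i)
    have h2 := (Finset.sum_eq_zero_iff_of_nonneg fun j _ => sq_nonneg _).1 h1 j (Finset.mem_univ j)
    exact sub_eq_zero.1 (pow_eq_zero_iff (by norm_num) |>.1 h2)
  rw [← hH, ← b.sum_sum_mul_apply (H x) v w]
  simp_rw [hij]
  exact b.sum_sum_mul_apply (innerSL ℝ) v w

/-- A function on a domain whose Hessian is the identity is half the squared distance to a point,
up to a constant. -/
theorem exists_eq_half_norm_sq (hΩ : IsOpen Ω) (hconn : IsConnected Ω)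
    (hu : ContDiffOn ℝ 2 u (closure Ω)) (hC2 : HasC2Boundary Ω)
    (hH : ∀ x ∈ Ω, ∀ v w,
      fderivWithin ℝ (fderivWithin ℝ u (closure Ω)) (closure Ω) x v w = inner ℝ v w) :
    ∃ (z : EuclideanSpace ℝ (Fin N)) (c : ℝ), ∀ x ∈ closure Ω,
      closureGradient Ω u x = x - z ∧ u x = ‖x - z‖ ^ 2 / 2 + c := by
  obtain ⟨x₀, hx₀⟩ := hconn.nonempty
  have hpre := hconn.isPreconnected
  have hd1 := contDiffOn_fderivWithin_closure hΩ hC2 hu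
  -- `du - ⟪y, ·⟫` has zero derivative, hence is a constant functional on the connected set `Ω`; its
  -- Riesz vector, with the sign changed, is the centre `z`.
  have hder1 : ∀ x ∈ Ω, HasFDerivAt (fun y => fderivWithin ℝ u (closure Ω) y - innerSL ℝ y)
      (0 : EuclideanSpace ℝ (Fin N) →L[ℝ] EuclideanSpace ℝ (Fin N) →L[ℝ] ℝ) x := by
    intro x hx
    have h := (hasFDerivAt_of_contDiffOn_closure hΩ (by norm_num) hd1 hx).sub
      (innerSL ℝ (E := EuclideanSpace ℝ (Fin N))).hasFDerivAt
    refine h.congr_fderiv ?_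
    ext1 v
    ext1 w
    exact sub_eq_zero.2 (hH x hx v w)
  obtain ⟨L, hL⟩ := hΩ.exists_is_const_of_fderiv_eq_zero hpre
    (fun x hx => (hder1 x hx).differentiableAt.differentiableWithinAt)
    (fun x hx => (hder1 x hx).fderiv)
  set z := -(toDual ℝ (EuclideanSpace ℝ (Fin N))).symm L with hz
  have hLz : ∀ v, L v = inner ℝ (-z) v := fun v => by
    rw [hz, neg_neg, toDual_symm_apply]
  have hDx : ∀ x ∈ Ω, ∀ v, fderivWithin ℝ u (closure Ω) x v = inner ℝ (x - z) v := by
    intro x hx v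
    have := congrArg (fun M => M v) (hL x hx)
    simp only [sub_apply, innerSL_apply_apply, hLz] at this
    rw [sub_eq_add_neg, inner_add_left]
    linarith
  have hder2 : ∀ x ∈ Ω, HasFDerivAt (fun y => u y - 1 / 2 * ‖y - z‖ ^ 2)
      (0 : EuclideanSpace ℝ (Fin N) →L[ℝ] ℝ) x := by
    intro x hx
    have h2 := (((hasFDerivAt_id x).sub_const z).norm_sq).const_mul (1 / 2)
    have h := (hasFDerivAt_of_contDiffOn_closure hΩ (by norm_num) hu hx).sub h2
    refine h.congr_fderiv ?_
    ext1 v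
    simp [hDx x hx, inner_sub_left]
  obtain ⟨c, hc⟩ := hΩ.exists_is_const_of_fderiv_eq_zero hpre
    (fun x hx => (hder2 x hx).differentiableAt.differentiableWithinAt)
    (fun x hx => (hder2 x hx).fderiv)
  refine ⟨z, c, fun x hx => ⟨?_, ?_⟩⟩
  · refine ext_inner_right ℝ fun v => ?_
    rw [inner_closureGradient]
    exact Set.EqOn.of_subset_closure (s := Ω) (fun y hy => hDx y hy v)
      (continuousOn_fderivWithin_closure_apply hΩ hC2 (hu.of_le (by norm_num)) v)
      (by fun_prop) subset_closure subset_rfl hx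
  · refine Set.EqOn.of_subset_closure (s := Ω) (f := u) (g := fun y => ‖y - z‖ ^ 2 / 2 + c)
      (fun y hy => ?_) hu.continuousOn (by fun_prop) subset_closure subset_rfl hx
    have := hc y hy
    dsimp only at this ⊢
    linarith

end Rigidity

/-! ### From the radial function to the ball -/

section Ball

variable {N : ℕ} {Ω : Set (EuclideanSpace ℝ (Fin N))} {p z : EuclideanSpace ℝ (Fin N)}

/-- At an extremum over `∂Ω` of the distance to `z`, the vector `p - z` is normal to `∂Ω`. -/
theorem sub_eq_smul_normal_of_isLocalExtrOn (hΩ : IsOpen Ω) (hC2 : HasC2Boundary Ω)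
    (hp : p ∈ frontier Ω) (hext : IsLocalExtrOn (fun x => ‖x - z‖ ^ 2) (frontier Ω) p) :
    p - z = (inner ℝ (p - z) (outerUnitNormal Ω p) : ℝ) • outerUnitNormal Ω p := by
  obtain ⟨r, h⟩ := exists_isBoundaryChart hΩ hC2 hp
  have hpr := Metric.mem_ball_self h.pos (x := p)
  set ρ := localDefiningFunction Ω p
  have hρp : ρ p = 0 := (h.mem_frontier_iff p hpr).1 hp
  have hset : frontier Ω =ᶠ[𝓝 p] {x | ρ x = ρ p} := by
    filter_upwards [Metric.ball_mem_nhds p h.pos] with x hx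
    rw [hρp]
    exact propext (h.mem_frontier_iff x hx)
  have hext' : IsLocalExtrOn (fun x => ‖x - z‖ ^ 2) {x | ρ x = ρ p} p := by
    unfold IsLocalExtrOn at hext ⊢
    rwa [← nhdsWithin_eq_iff_eventuallyEq.2 hset]
  have hρ' := (h.contDiffAt p hpr).hasStrictFDerivAt (by norm_num)
  have hφc : ContDiffAt ℝ 1 (fun x => ‖x - z‖ ^ 2) p :=
    ((contDiff_id.sub contDiff_const).norm_sq ℝ).contDiffAt
  have hφ' := hφc.hasStrictFDerivAt' ((hasFDerivAt_id p).sub_const z).norm_sq (by norm_num)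
  obtain ⟨a, b, hab, hlin⟩ := hext'.exists_multipliers_of_hasStrictFDerivAt_1d hρ' hφ'
  have hlin' : ∀ t, a * inner ℝ (∇ ρ p) t + b * (2 * inner ℝ (p - z) t) = 0 := by
    intro t
    have := congrArg (fun L => L t) hlin
    simpa [inner_gradient_eq_fderiv, inner_sub_left] using this
  -- The degenerate multiplier is excluded because `∇ρ` does not vanish at `p`.
  have hb : b ≠ 0 := by
    rintro rfl
    have ha : a ≠ 0 := fun ha => hab (by rw [ha]; rfl)
    have := hlin' (∇ ρ p)
    simp [ha, h.gradient_ne_zero p hpr] at this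
  have htan : ∀ t, inner ℝ (outerUnitNormal Ω p) t = 0 → inner ℝ (p - z) t = 0 := by
    intro t ht
    have ht' : inner ℝ (∇ ρ p) t = 0 := by
      rw [h.inner_normal hpr hp] at ht
      exact (mul_eq_zero.1 ht).resolve_left
        (inv_ne_zero (norm_ne_zero_iff.2 (h.gradient_ne_zero p hpr)))
    have := hlin' t
    rw [ht'] at this
    simpa [hb] using this
  have hνν : inner ℝ (outerUnitNormal Ω p) (outerUnitNormal Ω p) = (1 : ℝ) := by
    rw [real_inner_self_eq_norm_sq, norm_outerUnitNormal hC2 hp, one_pow]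
  set s : ℝ := inner ℝ (p - z) (outerUnitNormal Ω p) with hs
  have h1 : inner ℝ (outerUnitNormal Ω p) (p - z - s • outerUnitNormal Ω p) = 0 := by
    rw [inner_sub_right, inner_smul_right, hνν, real_inner_comm, ← hs, mul_one, sub_self]
  refine sub_eq_zero.1 (inner_self_eq_zero (𝕜 := ℝ).1 ?_)
  rw [inner_sub_left, inner_smul_left, h1, htan _ h1]
  simp

/-- If the support function `⟨x - z, ν⟩` is a nonincreasing affine function of `|x - z|²` along
the boundary, then `Ω` is a ball centred at `z`. -/
theorem eq_ball_of_inner_normal_eq (hN : 1 ≤ N) (hΩ : IsOpen Ω) (hne : Ω.Nonempty)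
    (hbdd : Bornology.IsBounded Ω) (hC2 : HasC2Boundary Ω) {β c : ℝ} (hβ : 0 ≤ β)
    (hnor : ∀ x ∈ frontier Ω,
      inner ℝ (x - z) (outerUnitNormal Ω x) = -β * (‖x - z‖ ^ 2 / 2 + c)) :
    ∃ r, 0 < r ∧ Ω = Metric.ball z r := by
  have : Nonempty (Fin N) := ⟨⟨0, hN⟩⟩
  have hcont : Continuous fun x => ‖x - z‖ ^ 2 := by fun_prop
  obtain ⟨p, hpK, hp⟩ := (isCompact_closure_of_isBounded hbdd).exists_isMaxOn hne.closure
    hcont.continuousOn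
  have hle : ∀ x ∈ closure Ω, ‖x - z‖ ≤ ‖p - z‖ := fun x hx =>
    le_of_sq_le_sq (hp hx) (norm_nonneg _)
  have hsubc : Ω ⊆ Metric.closedBall z ‖p - z‖ := fun x hx => by
    rw [Metric.mem_closedBall, dist_eq_norm]
    exact hle x (subset_closure hx)
  have hr0 : ‖p - z‖ ≠ 0 := by
    intro h0
    rw [h0, Metric.closedBall_zero] at hsubc
    have h1 := interior_maximal hsubc hΩ
    rw [interior_singleton] at h1
    exact hne.not_subset_empty h1
  -- An open set inside the closed ball lies in the open one, so the farthest point `p` of the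
  -- closure is on the boundary.
  have hsub : Ω ⊆ Metric.ball z ‖p - z‖ := by
    rw [← interior_closedBall z hr0]
    exact interior_maximal hsubc hΩ
  have hrpos : 0 < ‖p - z‖ := (norm_nonneg _).lt_of_ne' hr0
  have hpf : p ∈ frontier Ω := by
    rw [hΩ.frontier_eq]
    refine ⟨hpK, fun hpΩ => ?_⟩
    have := hsub hpΩ
    rw [Metric.mem_ball, dist_eq_norm] at this
    exact lt_irrefl _ this
  have hsq : ∀ x ∈ frontier Ω, IsLocalExtrOn (fun x => ‖x - z‖ ^ 2) (frontier Ω) x →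
      ‖x - z‖ ^ 2 = inner ℝ (x - z) (outerUnitNormal Ω x) ^ 2 := by
    intro x hx hext
    have := congrArg norm (sub_eq_smul_normal_of_isLocalExtrOn hΩ hC2 hx hext)
    rw [norm_smul, norm_outerUnitNormal hC2 hx, mul_one] at this
    rw [this, Real.norm_eq_abs, sq_abs]
  have hpext : IsLocalExtrOn (fun x => ‖x - z‖ ^ 2) (frontier Ω) p :=
    ((hp.on_subset frontier_subset_closure).localize).isExtr
  have hpν := sub_eq_smul_normal_of_isLocalExtrOn hΩ hC2 hpf hpext
  have hp2 := hsq p hpf hpext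
  have hp3 := hnor p hpf
  have hνp := norm_outerUnitNormal hC2 hpf
  -- If `p - z` were a negative multiple of the outer normal, a step from `p` into `Ω` along `-ν`
  -- would increase the distance to `z`.
  have hpos : 0 ≤ (inner ℝ (p - z) (outerUnitNormal Ω p) : ℝ) := by
    by_contra! hneg
    obtain ⟨ε, hε, h, hh, hin⟩ := exists_inward hΩ hC2 hpf (a := -outerUnitNormal Ω p) (by
      rw [inner_neg_right, real_inner_self_eq_norm_sq, hνp]; norm_num)
    have h1 := hsub (hin p hpK (Metric.mem_ball_self hε) h ⟨hh, le_rfl⟩)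
    rw [Metric.mem_ball, dist_eq_norm] at h1
    have h2 : p + h • -outerUnitNormal Ω p - z =
        ((inner ℝ (p - z) (outerUnitNormal Ω p) : ℝ) - h) • outerUnitNormal Ω p := by
      rw [sub_smul, ← hpν, smul_neg]; abel
    rw [h2, norm_smul, hνp, mul_one, Real.norm_eq_abs, abs_of_neg (by linarith)] at h1
    nlinarith
  obtain ⟨q, hqf, hq⟩ := (isCompact_frontier_of_isBounded hbdd).exists_isMinOn ⟨p, hpf⟩
    hcont.continuousOn
  have hq2 := hsq q hqf (hq.localize.isExtr)
  have hq3 := hnor q hqf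
  have hqp : ‖q - z‖ ^ 2 ≤ ‖p - z‖ ^ 2 := hp (frontier_subset_closure hqf)
  -- At both extrema the distance is the absolute value of the support function. The smaller
  -- distance at `q` gives it the larger support value by `hnor`, while that value is at most `|q -
  -- z| ≤ |p - z|`, the support value at `p`.
  have heq : ‖q - z‖ ^ 2 = ‖p - z‖ ^ 2 := by
    rw [hp2, hq2] at hqp
    have h1 := abs_le_of_sq_le_sq' hqp hpos
    have h2 : inner ℝ (p - z) (outerUnitNormal Ω p) ≤ (inner ℝ (q - z) (outerUnitNormal Ω q) : ℝ) := by
      rw [hp3, hq3]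
      rw [← hp2, ← hq2] at hqp
      nlinarith
    rw [hp2, hq2, le_antisymm h1.2 h2]
  have hsph : ∀ x ∈ frontier Ω, ‖x - z‖ = ‖p - z‖ := fun x hx =>
    le_antisymm (hle x (frontier_subset_closure hx))
      (le_of_sq_le_sq (heq ▸ hq hx) (norm_nonneg _))
  refine ⟨‖p - z‖, hrpos, hsub.antisymm ?_⟩
  -- Boundary points lie on the sphere, so `Ω` is open and closed relative to the connected ball.
  refine (convex_ball z ‖p - z‖).isPreconnected.subset_of_closure_inter_subset hΩ ?_ ?_
  · obtain ⟨x, hx⟩ := hne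
    exact ⟨x, hsub hx, hx⟩
  · rintro x ⟨hxK, hxb⟩
    by_contra hxΩ
    rw [Metric.mem_ball, dist_eq_norm, hsph x (by rw [hΩ.frontier_eq]; exact ⟨hxK, hxΩ⟩)] at hxb
    exact lt_irrefl _ hxb

end Ball

theorem mainTheorem1 (N : ℕ) (hN : 2 ≤ N) (Ω : Set (EuclideanSpace ℝ (Fin N)))
    (hΩopen : IsOpen Ω) (hΩconn : IsConnected Ω) (hΩbdd : Bornology.IsBounded Ω)
    (hΩC2 : HasC2Boundary Ω)
    (β : ℝ) (hβ : 0 < β)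
    (R C : ℝ) (hR : R = N * domainVolume Ω / boundaryArea Ω)
    (hC : C = -R ^ 2 - R * ((N + 1) / β))
    (u : EuclideanSpace ℝ (Fin N) → ℝ) (hu : ContDiffOn ℝ 2 u (closure Ω))
    (hpde : ∀ x ∈ Ω, Δ u x = N)
    (hrobin : ∀ x ∈ frontier Ω, outerNormalDeriv Ω u x + β * u x = 0)
    (hover : ∀ x ∈ frontier Ω,
      ‖closureGradient Ω u x‖ ^ 2 + 2 * N * u x - 2 * β ^ 2 * u x ^ 2
        + ((N : ℝ) - 1) * β * u x ^ 2 * meanCurvature Ω x = C)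
    (hκ : 0 ≤ (β : EReal) + minPrincipalCurvature Ω) :
    ∃ (z : EuclideanSpace ℝ (Fin N)) (r : ℝ), 0 < r ∧ Ω = Metric.ball z r ∧
      ∃ f : ℝ → ℝ, ∀ x ∈ closure Ω, u x = f (dist x z) := by
  obtain ⟨z, c, hzc⟩ := exists_eq_half_norm_sq hΩopen hΩconn hu hΩC2 fun x hx v w =>
    fderivWithin_fderivWithin_eq_inner hN hΩopen hΩbdd hΩC2 hβ hR hC hu hpde hrobin hover hκ hx v w
  obtain ⟨r, hr, hball⟩ := eq_ball_of_inner_normal_eq (z := z) (c := c) (by omega) hΩopen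
    hΩconn.nonempty hΩbdd hΩC2 hβ.le fun x hx => by
      obtain ⟨h1, h2⟩ := hzc x (frontier_subset_closure hx)
      have h3 := hrobin x hx
      rw [outerNormalDeriv, h1, h2] at h3
      linarith
  refine ⟨z, r, hr, hball, fun s => s ^ 2 / 2 + c, fun x hx => ?_⟩
  rw [(hzc x hx).2, dist_eq_norm]
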